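/- Let $L=(L(t))_{t\in\mathbb R}$ be a strictly increasing two-sided real Lévy process on a probability space $(\Omega,\mathcal F,\mathbb P)$: $L(0)=0$ a.s., the increments over the whole real line are independent and stationary, $L$ is continuous in probability, and almost all paths are càdlàg and strictly increasing. For $x\in\mathbb R$ let $L^*(x)=\inf\{t\in\mathbb R: L(t)\ge x\}$ be the hitting time and $L(L^*(x)^-)=\lim_{u\uparrow L^*(x)}L(u)$ the undershoot. Let $J_x$ be the joint law of $(L^*(x),L(L^*(x)^-))$ on $\mathbb R^2$. For $t>0$ let $\kappa_{x,t}(s,y)$ denote the regular conditional law of $L(L^*(x)-t)$ (that is, of $L(s-t)$) given $L^*(x)=s$ and $L(L^*(x)^-)=y$. Let $L'$ be a copy of $L$ (a process, on any probability space, with the same law as $L$). Call a probability kernel $K$ from $\{(r,s,y)\}=\mathbb R^3$ to $\mathbb R$ a version of the Lévy bridge of $L'$ if for all $0\le r\le s$, $K(r,s,y)=\mathbf P_{L'(r)\mid L'(s)=y}$ for $\mathbf P_{L'(s)}$-almost every $y$. (Each $\mathbf P_{L'(r)\mid L'(s)=y}$ is determined only up to a $\mathbf P_{L'(s)}$-null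 set of $y$.) For every $x\in\mathbb R$ the infimum $L^*(x)$ is a.s. finite, and $L^*(x)$, $L(L^*(x)^-)$ and $L(L^*(x)-t)$, $t>0$, are random variables (measurable up to null sets). Moreover, $J_x$-almost every $(s,y)$ satisfies $s\ge0$ and $0\le y\le x$ if $x\ge0$, and $s<0$ and $y\le x$ if $x<0$. Furthermore, for $t>0$: (1) For all $x\in\mathbb R$ and all Borel sets $A\subseteq\mathbb R$, $$\mathbb P(L(L^*(x)-t)\in A)=\iint_{\mathbb R^2}\kappa_{x,t}(s,y)(A)\,J_x(ds,dy).$$ (2) If $x>0$, $t\le s$ and $0\le y\le x$, then $\kappa_{x,t}(s,y)$ is the Lévy bridge law $\mathbf P_{L'(s-t)\mid L'(s)=y}$, in the following sense. (2a) For every $x>0$ there is a version $K$ of the Lévy bridge such that for every $t>0$, $\kappa_{x,t}(s,y)=K(s-t,s,y)$ for $J_x$-almost all $(s,y)$ with $t\le s$ and $0\le y\le x$. (2b) For every version $K$ of the Lévy bridge and every $t>0$: for every $x>0$, $\kappa_{x,t}(s,y)=K(s-t,s,y)$ for $J_x$-almost all $(s,y)$ with $t\le s$ and $0\le y<x$;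 and for Lebesgue-almost every $x>0$ the same holds for $J_x$-almost all $(s,y)$ with $t\le s$ and $0\le y\le x$. (3) If $x\ge0$, then $\kappa_{x,t}(s,y)$ is the law of $-L'(t-s)$ for $J_x$-almost all $(s,y)$ with $0\le s<t$ and $0\le y\le x$. (4) If $x<0$, then $\kappa_{x,t}(s,y)$ is the law of $y-L'(t)$ for $J_x$-almost all $(s,y)$ with $s<0$ and $y\le x$. -/

import Mathlib

open MeasureTheory ProbabilityTheory Filter Topology

namespace LevyChar

variable {Ω : Type*} [MeasurableSpace Ω]

/-- `L = (L t)_{t ∈ ℝ}` is a two-sided real Lévy process under `P`: it starts at `0`, has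
independent and stationary increments over the whole real line, is continuous in probability, and
almost every path is right-continuous with left-hand limits. -/
structure IsTwoSidedLevy (L : ℝ → Ω → ℝ) (P : Measure Ω) : Prop where
  measurable : ∀ t, Measurable (L t)
  zero : ∀ᵐ ω ∂P, L 0 ω = 0
  indep : HasIndepIncrements L P
  stationary : ∀ s h : ℝ, 0 ≤ h →
    IdentDistrib (fun ω => L (s + h) ω - L s ω) (fun ω => L h ω) P P
  stochCont : ∀ t, TendstoInMeasure P L (𝓝 t) (L t)
  cadlag : ∀ᵐ ω ∂P, ∀ t : ℝ,
    ContinuousWithinAt (fun u => L u ω) (Set.Ici t) t ∧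
      ∃ l : ℝ, Tendsto (fun u => L u ω) (𝓝[<] t) (𝓝 l)

/-- A two-sided Lévy process almost all of whose paths are strictly increasing. -/
structure IsStrictlyIncreasingLevy (L : ℝ → Ω → ℝ) (P : Measure Ω) : Prop
    extends IsTwoSidedLevy L P where
  strictMono : ∀ᵐ ω ∂P, StrictMono (fun t => L t ω)

/-- The hitting time `L^*(x) = inf {t ∈ ℝ : L(t) ≥ x}`. -/
noncomputable def hit (L : ℝ → Ω → ℝ) (x : ℝ) (ω : Ω) : ℝ :=
  sInf {t : ℝ | x ≤ L t ω}

/-- The undershoot `L(L^*(x)^-)`, the left-hand limit of the path at the hitting time. -/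
noncomputable def undershoot (L : ℝ → Ω → ℝ) (x : ℝ) (ω : Ω) : ℝ :=
  Function.leftLim (fun t => L t ω) (hit L x ω)

/-- The random variable `L(L^*(x) - t)`. -/
noncomputable def charBase (L : ℝ → Ω → ℝ) (x t : ℝ) (ω : Ω) : ℝ :=
  L (hit L x ω - t) ω

/-- The joint law of hitting time and undershoot, `P_{L^*(x), L(L^*(x)^-)}`, on pairs `(s, y)`. -/
noncomputable def hitUnderLaw (L : ℝ → Ω → ℝ) (P : Measure Ω) (x : ℝ) : Measure (ℝ × ℝ) :=
  P.map (fun ω => (hit L x ω, undershoot L x ω))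

/-- The regular conditional law of `L(L^*(x) - t)` given `L^*(x) = s` and `L(L^*(x)^-) = y`,
as a probability kernel in `(s, y)`. -/
noncomputable def condLaw (L : ℝ → Ω → ℝ) (P : Measure Ω) [IsFiniteMeasure P] (x t : ℝ) :
    Kernel (ℝ × ℝ) ℝ :=
  condDistrib (charBase L x t) (fun ω => (hit L x ω, undershoot L x ω)) P

/-- `K` is a jointly measurable version of the family of Lévy bridge laws of `L`: for all
`0 ≤ r ≤ s`, the probability measure `K (r, s, y)` is the conditional law of `L(r)` given
`L(s) = y`, for almost every `y` with respect to the law of `L(s)`. -/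
structure IsLevyBridge (L : ℝ → Ω → ℝ) (P : Measure Ω) [IsFiniteMeasure P]
    (K : Kernel (ℝ × ℝ × ℝ) ℝ) : Prop where
  markov : IsMarkovKernel K
  bridge : ∀ r s : ℝ, 0 ≤ r → r ≤ s →
    ∀ᵐ y ∂(P.map (L s)), K (r, s, y) = condDistrib (L r) (L s) P y

end LevyChar

/-! Write T for the hitting time of x and Y for the undershoot. The difficulty is that T is random
and L(T - t) looks backwards from it, so independence of increments, a property of deterministic
times, does not apply directly. The remedy is an averaging identity. For each path, the times s with
L(s) < x ≤ L(s + ε) form exactly the interval [T - ε, T). Hence ε⁻¹ times the integral over s and ω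
of F(s, s + ε, L(s), L(s + ε - t)), restricted to these crossings, tends to E F(T, T, Y, L(T - t))
for bounded continuous F (`tendsto_average`). Before the limit all times are deterministic, and
Fubini allows work at fixed s. Conditional laws are then read off by testing against bounded
continuous functions times a weight in (T, Y) that is positive on the region of interest
(`condDistrib_ae_eq_of_integral_eq`).

If T < t or x < 0, the crossing and the increment that determines the earlier value are independent
at fixed s, and the averaged identity passes to the limit (`condLaw_of_lt`, `condLaw_of_neg`).

If T ≥ t and x > 0, then at fixed s the crossing depends on L(s) and on the next increment, which is
independent of the past, so g(L(s - t)) may be replaced by its bridge expectation given L(s)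
(`average_bridge`). That expectation is only measurable in (s, y), so passing to the limit needs
domination. Under the weight 1 - exp(-(x - y)) a crossing costs at most 1 - exp(-increment), whose
mean is O(ε) by the Laplace transform (`abs_average_le`). The averages are thus bounded by a fixed
L¹ norm, and measurable functions are approximated in L¹ (`tendsto_average_measurable`). This
settles undershoots strictly below x (`condLaw_of_undershoot_lt`), where the weight is positive.

Creeping, Y = x, is invisible to that weight. Here one integrates over the level: with a cutoff in x
- y, the x-integral at a fixed window is a function of the increment alone, so it factors out as a
constant free of the test functions. Letting first the window and then the cutoff shrink, the
weighted law of (T, Y, L(T - t)) over all crept levels is a multiple of that of (s, L(s), L(s - t))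
under Lebesgue measure in s (`exists_creepLaw_eq_smul`), which the bridge disintegrates. Since the
level equals Y on creeping, this descends to almost every level (`condLaw_of_undershoot_eq`).

For a single level x, an arbitrary bridge version may be wrong at y = x, but redefining it there is
harmless: it matters only if L(s) has an atom at x, and then {L(s) = x} is a.s. the event of
creeping over x at time s, so the creeping conditional law is the forced value
(`isLevyBridge_levelBridge`). -/

open scoped ENNReal BoundedContinuousFunction

/-! ### Regular paths: hitting times, undershoots and joint measurability -/

namespace LevyChar

/-- A strictly increasing two-sided Lévy process all of whose paths are right-continuous, strictly
increasing, unbounded in both directions, and null at time zero. -/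
structure RegularLevy {Ω : Type*} [MeasurableSpace Ω] (L : ℝ → Ω → ℝ) (P : Measure Ω) : Prop where
  levy : IsStrictlyIncreasingLevy L P
  zero : ∀ ω, L 0 ω = 0
  strictMono : ∀ ω, StrictMono (fun t => L t ω)
  rightCont : ∀ ω t, ContinuousWithinAt (fun u => L u ω) (Set.Ici t) t
  exists_ge : ∀ ω x, ∃ t, x ≤ L t ω
  exists_lt : ∀ ω x, ∃ t, L t ω < x

namespace RegularLevy

variable {Ω : Type*} [MeasurableSpace Ω] {P : Measure Ω} {L : ℝ → Ω → ℝ}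

lemma measurable (hL : RegularLevy L P) (t : ℝ) : Measurable (L t) := hL.levy.measurable t

/-- A fixed time is almost surely a continuity point. -/
lemma leftLim_eq (hL : RegularLevy L P) (s : ℝ) :
    ∀ᵐ ω ∂P, Function.leftLim (fun u => L u ω) s = L s ω := by
  have hu : Tendsto (fun n : ℕ => s - 1 / ((n : ℝ) + 1)) atTop (𝓝[<] s) := by
    refine tendsto_nhdsWithin_iff.2 ⟨?_, Eventually.of_forall fun n => ?_⟩
    · simpa using tendsto_const_nhds.sub (tendsto_one_div_add_atTop_nhds_zero_nat (𝕜 := ℝ))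
    · have : (0 : ℝ) < 1 / ((n : ℝ) + 1) := by positivity
      simp only [Set.mem_Iio]; linarith
  have h1 : TendstoInMeasure P (fun n : ℕ => L (s - 1 / ((n : ℝ) + 1))) atTop (L s) :=
    fun ε hε => (hL.levy.stochCont s ε hε).comp (hu.mono_right nhdsWithin_le_nhds)
  -- Monotonicity already provides the left limit; a subsequence converging almost surely is enough
  -- to identify it.
  obtain ⟨ns, hns, hlim⟩ := h1.exists_seq_tendsto_ae
  filter_upwards [hlim] with ω hω
  exact tendsto_nhds_unique (((hL.strictMono ω).monotone.tendsto_leftLim s).comp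
    (hu.comp hns.tendsto_atTop)) hω

lemma bddBelow_hitSet (hL : RegularLevy L P) (x : ℝ) (ω : Ω) : BddBelow {t : ℝ | x ≤ L t ω} := by
  obtain ⟨t, ht⟩ := hL.exists_lt ω x
  refine ⟨t, fun u hu => ?_⟩
  by_contra! h
  exact absurd (hL.strictMono ω h) (by have : x ≤ L u ω := hu; dsimp only; linarith)

/-- Right-continuity: the infimum is attained. -/
lemma le_apply_hit (hL : RegularLevy L P) (x : ℝ) (ω : Ω) : x ≤ L (hit L x ω) ω := by
  have h1 : Tendsto (fun u => L u ω) (𝓝[>] (hit L x ω)) (𝓝 (L (hit L x ω) ω)) :=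
    (hL.rightCont ω _).mono Set.Ioi_subset_Ici_self
  refine ge_of_tendsto h1 ?_
  filter_upwards [self_mem_nhdsWithin] with u hu
  obtain ⟨v, hv, hvu⟩ := exists_lt_of_csInf_lt (hL.exists_ge ω x) (show hit L x ω < u from hu)
  exact le_trans hv ((hL.strictMono ω).monotone hvu.le)

/-- The hitting time is the generalised inverse of the path. Every event about it becomes an event
at a deterministic time. -/
lemma hit_le_iff (hL : RegularLevy L P) {x s : ℝ} {ω : Ω} : hit L x ω ≤ s ↔ x ≤ L s ω :=
  ⟨fun h => (hL.le_apply_hit x ω).trans ((hL.strictMono ω).monotone h),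
    fun h => csInf_le (hL.bddBelow_hitSet x ω) h⟩

lemma lt_hit_iff (hL : RegularLevy L P) {x s : ℝ} {ω : Ω} : s < hit L x ω ↔ L s ω < x := by
  rw [← not_le, hL.hit_le_iff, not_le]

lemma tendsto_undershoot (hL : RegularLevy L P) (x : ℝ) (ω : Ω) :
    Tendsto (fun u => L u ω) (𝓝[<] (hit L x ω)) (𝓝 (undershoot L x ω)) :=
  (hL.strictMono ω).monotone.tendsto_leftLim _

lemma undershoot_le (hL : RegularLevy L P) (x : ℝ) (ω : Ω) : undershoot L x ω ≤ x := by
  refine le_of_tendsto (hL.tendsto_undershoot x ω) ?_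
  filter_upwards [self_mem_nhdsWithin] with u hu
  exact (hL.lt_hit_iff.1 hu).le

lemma le_undershoot (hL : RegularLevy L P) {x s : ℝ} {ω : Ω} (h : s < hit L x ω) :
    L s ω ≤ undershoot L x ω :=
  (hL.strictMono ω).monotone.le_leftLim h

/-- A countable description of the left limit, valid jointly in level and path; it gives joint
measurability. -/
lemma lt_undershoot_iff (hL : RegularLevy L P) {a x : ℝ} {ω : Ω} :
    a < undershoot L x ω ↔ ∃ q : ℚ, (q : ℝ) < hit L x ω ∧ a < L q ω := by
  constructor
  · intro h
    have h1 := (hL.tendsto_undershoot x ω).eventually (lt_mem_nhds h)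
    obtain ⟨u, hu, hua⟩ := (h1.and self_mem_nhdsWithin).exists
    obtain ⟨q, hq1, hq2⟩ := exists_rat_btwn (show u < hit L x ω from hua)
    exact ⟨q, hq2, hu.trans (hL.strictMono ω hq1)⟩
  · rintro ⟨q, hq, ha⟩
    exact ha.trans_le (hL.le_undershoot hq)

/-- For an increasing right-continuous path, being below a at time s means being below a at some
later rational time. -/
lemma measurable_uncurry (hL : RegularLevy L P) : Measurable (fun p : ℝ × Ω => L p.1 p.2) := by
  refine measurable_of_Iio fun a => ?_
  have : (fun p : ℝ × Ω => L p.1 p.2) ⁻¹' Set.Iio a =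
      ⋃ q : ℚ, Set.Iio (q : ℝ) ×ˢ {ω | L q ω < a} := by
    ext ⟨s, ω⟩
    simp only [Set.mem_preimage, Set.mem_Iio, Set.mem_iUnion, Set.mem_prod, Set.mem_ofPred_eq]
    constructor
    · intro h
      have h1 : Tendsto (fun u => L u ω) (𝓝[>] s) (𝓝 (L s ω)) :=
        (hL.rightCont ω _).mono Set.Ioi_subset_Ici_self
      obtain ⟨u, hu, hsu⟩ := ((h1.eventually (gt_mem_nhds h)).and self_mem_nhdsWithin).exists
      obtain ⟨q, hq1, hq2⟩ := exists_rat_btwn (show s < u from hsu)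
      exact ⟨q, hq1, (hL.strictMono ω hq2).trans hu⟩
    · rintro ⟨q, hq, ha⟩
      exact (hL.strictMono ω hq).trans ha
  rw [this]
  exact MeasurableSet.iUnion fun q =>
    measurableSet_Iio.prod (measurableSet_lt (hL.measurable _) measurable_const)

lemma measurable_hit_uncurry (hL : RegularLevy L P) :
    Measurable (fun p : ℝ × Ω => hit L p.1 p.2) := by
  refine measurable_of_Iic fun a => ?_
  have : (fun p : ℝ × Ω => hit L p.1 p.2) ⁻¹' Set.Iic a = {p | p.1 ≤ L a p.2} := by
    ext p; exact hL.hit_le_iff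
  rw [this]
  exact measurableSet_le measurable_fst ((hL.measurable a).comp measurable_snd)

lemma measurable_undershoot_uncurry (hL : RegularLevy L P) :
    Measurable (fun p : ℝ × Ω => undershoot L p.1 p.2) := by
  refine measurable_of_Ioi fun a => ?_
  have : (fun p : ℝ × Ω => undershoot L p.1 p.2) ⁻¹' Set.Ioi a =
      ⋃ q : ℚ, {p | (q : ℝ) < hit L p.1 p.2} ∩ {p | a < L q p.2} := by
    ext p
    simp only [Set.mem_preimage, Set.mem_Ioi, Set.mem_iUnion, Set.mem_inter_iff, Set.mem_ofPred_eq]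
    exact hL.lt_undershoot_iff
  rw [this]
  exact MeasurableSet.iUnion fun q =>
    (measurableSet_lt measurable_const hL.measurable_hit_uncurry).inter
      (measurableSet_lt measurable_const ((hL.measurable _).comp measurable_snd))

lemma measurable_charBase_uncurry (hL : RegularLevy L P) :
    Measurable (fun p : ℝ × ℝ × Ω => charBase L p.1 p.2.1 p.2.2) :=
  hL.measurable_uncurry.comp
    (((hL.measurable_hit_uncurry.comp (measurable_fst.prodMk
      (measurable_snd.comp measurable_snd))).sub (measurable_fst.comp measurable_snd)).prodMk
        (measurable_snd.comp measurable_snd))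

lemma measurable_hit (hL : RegularLevy L P) (x : ℝ) : Measurable (hit L x) :=
  hL.measurable_hit_uncurry.comp measurable_prodMk_left

lemma measurable_undershoot (hL : RegularLevy L P) (x : ℝ) : Measurable (undershoot L x) :=
  hL.measurable_undershoot_uncurry.comp measurable_prodMk_left

lemma measurable_charBase (hL : RegularLevy L P) (x t : ℝ) : Measurable (charBase L x t) :=
  hL.measurable_charBase_uncurry.comp (f := fun ω => (x, t, ω)) (by fun_prop)

lemma measurable_hitPair (hL : RegularLevy L P) (x : ℝ) :
    Measurable (fun ω => (hit L x ω, undershoot L x ω)) :=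
  (hL.measurable_hit x).prodMk (hL.measurable_undershoot x)

lemma hit_nonneg (hL : RegularLevy L P) {x : ℝ} (hx : 0 ≤ x) (ω : Ω) : 0 ≤ hit L x ω := by
  by_contra! h
  have h1 := hL.strictMono ω h
  have h2 := hL.le_apply_hit x ω
  simp only [hL.zero ω] at h1
  linarith

lemma hit_pos (hL : RegularLevy L P) {x : ℝ} (hx : 0 < x) (ω : Ω) : 0 < hit L x ω := by
  rw [hL.lt_hit_iff, hL.zero]; exact hx

lemma undershoot_nonneg (hL : RegularLevy L P) {x : ℝ} (hx : 0 < x) (ω : Ω) :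
    0 ≤ undershoot L x ω := by
  rw [← hL.zero ω]; exact hL.le_undershoot (hL.hit_pos hx ω)

lemma hit_zero (hL : RegularLevy L P) (ω : Ω) : hit L 0 ω = 0 :=
  le_antisymm (hL.hit_le_iff.2 (hL.zero ω).ge) (hL.hit_nonneg le_rfl ω)

lemma undershoot_zero_ae (hL : RegularLevy L P) : ∀ᵐ ω ∂P, undershoot L 0 ω = 0 := by
  filter_upwards [hL.leftLim_eq 0] with ω hω
  rw [undershoot, hL.hit_zero, hω, hL.zero]

/-- A jump at time zero could carry the path across x only at time zero; almost surely there is no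
such jump. -/
lemma hit_neg_ae (hL : RegularLevy L P) {x : ℝ} (hx : x < 0) : ∀ᵐ ω ∂P, hit L x ω < 0 := by
  filter_upwards [hL.leftLim_eq 0] with ω hω
  have h1 := (hL.strictMono ω).monotone.tendsto_leftLim 0
  rw [hω, hL.zero] at h1
  obtain ⟨u, hu, hu0⟩ := ((h1.eventually (lt_mem_nhds hx)).and self_mem_nhdsWithin).exists
  exact (hL.hit_le_iff.2 hu.le).trans_lt hu0

/-- At a fixed time `s` there is no jump, so hitting `x` at time `s` means `L s = x`. -/
lemma hit_eq_iff_ae (hL : RegularLevy L P) (s : ℝ) :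
    ∀ᵐ ω ∂P, ∀ x, (hit L x ω = s → undershoot L x ω = x ∧ L s ω = x) ∧
      (L s ω = x → hit L x ω = s) := by
  filter_upwards [hL.leftLim_eq s] with ω hω x
  refine ⟨fun h => ?_, fun h => ?_⟩
  · have h1 : undershoot L x ω = L s ω := by rw [undershoot, h, hω]
    have h2 := hL.undershoot_le x ω
    have h3 := hL.le_apply_hit x ω
    rw [h] at h3
    exact ⟨by linarith, by linarith⟩
  · refine le_antisymm (hL.hit_le_iff.2 h.ge) ?_
    rw [← (hL.strictMono ω).le_iff_le]
    exact h.le.trans (hL.le_apply_hit x ω)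

end RegularLevy
end LevyChar

/-! ### Window averages over deterministic times -/

namespace LevyChar

/-- The pairs `(s, ω)` for which the path `L · ω` crosses the level `x` between `s` and `s + ε`. -/
def crossing {Ω : Type*} (L : ℝ → Ω → ℝ) (x ε : ℝ) : Set (ℝ × Ω) :=
  {p | L p.1 p.2 < x ∧ x ≤ L (p.1 + ε) p.2}

/-- The width of the `n`-th averaging window. -/
noncomputable def mesh (n : ℕ) : ℝ := 1 / ((n : ℝ) + 1)

lemma mesh_pos (n : ℕ) : 0 < mesh n := by unfold mesh; positivity

lemma mesh_mul (n : ℕ) : ((n : ℝ) + 1) * mesh n = 1 := by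
  unfold mesh; field_simp

lemma tendsto_mesh : Tendsto mesh atTop (𝓝 0) := tendsto_one_div_add_atTop_nhds_zero_nat

namespace RegularLevy

variable {Ω : Type*} [MeasurableSpace Ω] {P : Measure Ω} {L : ℝ → Ω → ℝ}

/-- Each path crosses the level from a set of starting times of length exactly ε, ending at the
hitting time. Averaging over crossings is therefore averaging just before that time, without any
random normalisation. -/
lemma mem_crossing_iff (hL : RegularLevy L P) {x ε : ℝ} {p : ℝ × Ω} :
    p ∈ crossing L x ε ↔ p.1 ∈ Set.Ico (hit L x p.2 - ε) (hit L x p.2) := by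
  rw [crossing, Set.mem_ofPred_eq, ← hL.lt_hit_iff, ← hL.hit_le_iff, Set.mem_Ico, sub_le_iff_le_add,
    and_comm]

lemma measurable_apply_add (hL : RegularLevy L P) (c : ℝ) :
    Measurable (fun p : ℝ × Ω => L (p.1 + c) p.2) :=
  hL.measurable_uncurry.comp ((measurable_fst.add_const c).prodMk measurable_snd)

lemma measurableSet_crossing (hL : RegularLevy L P) (x ε : ℝ) :
    MeasurableSet (crossing L x ε) :=
  (measurableSet_lt hL.measurable_uncurry measurable_const).inter
    (measurableSet_le measurable_const (hL.measurable_apply_add ε))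

lemma volume_prod_crossing [IsProbabilityMeasure P] (hL : RegularLevy L P) (x ε : ℝ) :
    (volume.prod P) (crossing L x ε) = ENNReal.ofReal ε := by
  rw [Measure.prod_apply_symm (hL.measurableSet_crossing x ε)]
  have : ∀ ω, (fun s => (s, ω)) ⁻¹' (crossing L x ε) = Set.Ico (hit L x ω - ε) (hit L x ω) := by
    intro ω; ext s; exact hL.mem_crossing_iff
  simp [this]

/-- The four quantities read off at the left end of a window of width `ε`. -/
lemma measurable_window (hL : RegularLevy L P) (t ε : ℝ) :
    Measurable (fun p : ℝ × Ω => (p.1, p.1 + ε, L p.1 p.2, L (p.1 + ε - t) p.2)) := by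
  have h := hL.measurable_apply_add (ε - t)
  simp only [← add_sub_assoc] at h
  exact measurable_fst.prodMk ((measurable_fst.add_const _).prodMk
    (hL.measurable_uncurry.prodMk h))

lemma integrableOn_crossing [IsProbabilityMeasure P] (hL : RegularLevy L P) (x ε : ℝ)
    {f : ℝ × Ω → ℝ} (hf : Measurable f) {C : ℝ} (hC : ∀ p, |f p| ≤ C) :
    IntegrableOn f (crossing L x ε) (volume.prod P) := by
  refine Measure.integrableOn_of_bounded (M := C) ?_ hf.aestronglyMeasurable
    (Eventually.of_forall fun p => hC p)
  rw [hL.volume_prod_crossing]; exact ENNReal.ofReal_ne_top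

/-- After rescaling the window to the unit interval, its left end approaches the hitting time T
strictly from below, which produces the undershoot. The earlier value is read at the distance t from
the right end of the window, because that time approaches T - t from above and right-continuity
gives its limit even if the path jumps at T - t. -/
lemma tendsto_path_average (hL : RegularLevy L P) (x t : ℝ) {F : ℝ × ℝ × ℝ × ℝ → ℝ}
    (hF : Continuous F) {C : ℝ} (hC : ∀ q, |F q| ≤ C) (ω : Ω) :
    Tendsto (fun n : ℕ => ((n : ℝ) + 1) * ∫ s in Set.Ico (hit L x ω - mesh n) (hit L x ω),
      F (s, s + mesh n, L s ω, L (s + mesh n - t) ω)) atTop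
      (𝓝 (F (hit L x ω, hit L x ω, undershoot L x ω, charBase L x t ω))) := by
  set T := hit L x ω with hT
  have key : ∀ n : ℕ, ((n : ℝ) + 1) * ∫ s in Set.Ico (T - mesh n) T,
      F (s, s + mesh n, L s ω, L (s + mesh n - t) ω) =
      ∫ v in (0 : ℝ)..1, F (T - mesh n * v, T - mesh n * v + mesh n, L (T - mesh n * v) ω,
        L (T - mesh n * v + mesh n - t) ω) := by
    intro n
    have h := intervalIntegral.smul_integral_comp_sub_mul (a := 0) (b := 1)
      (fun s => F (s, s + mesh n, L s ω, L (s + mesh n - t) ω)) (mesh n) T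
    simp only [mul_one, mul_zero, sub_zero, smul_eq_mul] at h
    rw [integral_Ico_eq_integral_Ioo, ← integral_Ioc_eq_integral_Ioo,
      ← intervalIntegral.integral_of_le (by linarith [mesh_pos n]), ← h, ← mul_assoc, mesh_mul,
      one_mul]
  simp only [key]
  have hlim : F (T, T, undershoot L x ω, charBase L x t ω) = ∫ v in (0 : ℝ)..1,
      F (T, T, undershoot L x ω, charBase L x t ω) := by simp
  rw [hlim]
  have hmL : Measurable (fun s => L s ω) := (hL.strictMono ω).monotone.measurable
  refine intervalIntegral.tendsto_integral_filter_of_dominated_convergence (fun _ => C) ?_ ?_ ?_ ?_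
  · refine Eventually.of_forall fun n => Measurable.aestronglyMeasurable ?_
    refine hF.measurable.comp ?_
    refine Measurable.prodMk (by fun_prop) (Measurable.prodMk (by fun_prop)
      (Measurable.prodMk (hmL.comp (by fun_prop)) (hmL.comp (by fun_prop))))
  · exact Eventually.of_forall fun n => Eventually.of_forall fun v _ => hC _
  · simp
  · refine Eventually.of_forall fun v hv => ?_
    rw [Set.uIoc_of_le zero_le_one] at hv
    have ha : Tendsto (fun n => T - mesh n * v) atTop (𝓝 T) := by
      simpa using tendsto_const_nhds.sub (tendsto_mesh.mul_const v)
    have hb : Tendsto (fun n => T - mesh n * v + mesh n) atTop (𝓝 T) := by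
      simpa using ha.add tendsto_mesh
    refine (hF.tendsto _).comp (ha.prodMk_nhds (hb.prodMk_nhds (Tendsto.prodMk_nhds ?_ ?_)))
    · refine (hL.tendsto_undershoot x ω).comp (tendsto_nhdsWithin_iff.2 ⟨ha, ?_⟩)
      refine Eventually.of_forall fun n => ?_
      have := mul_pos (mesh_pos n) hv.1
      simp only [Set.mem_Iio, ← hT]; linarith
    · have h1 : Tendsto (fun n => T - mesh n * v + mesh n - t) atTop (𝓝[≥] (T - t)) := by
        refine tendsto_nhdsWithin_iff.2 ⟨hb.sub_const t, Eventually.of_forall fun n => ?_⟩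
        have := mul_le_mul_of_nonneg_left hv.2 (mesh_pos n).le
        simp only [Set.mem_Ici]; linarith
      exact Tendsto.comp (hL.rightCont ω (T - t)) h1

lemma setIntegral_crossing [IsProbabilityMeasure P] (hL : RegularLevy L P) (x ε : ℝ)
    {f : ℝ × Ω → ℝ} (hf : Measurable f) {C : ℝ} (hC : ∀ p, |f p| ≤ C) :
    ∫ p in crossing L x ε, f p ∂(volume.prod P) =
      ∫ ω, (∫ s in Set.Ico (hit L x ω - ε) (hit L x ω), f (s, ω)) ∂P := by
  rw [← integral_indicator (hL.measurableSet_crossing x ε), integral_prod_symm _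
    ((hL.integrableOn_crossing x ε hf hC).integrable_indicator (hL.measurableSet_crossing x ε))]
  refine integral_congr_ae (Eventually.of_forall fun ω => ?_)
  dsimp only
  rw [← integral_indicator measurableSet_Ico]
  refine integral_congr_ae (Eventually.of_forall fun s => ?_)
  simp only [Set.indicator, hL.mem_crossing_iff]

/-- The opposite order of integration: with the time outermost and fixed, independence of increments
can be used inside. -/
lemma setIntegral_crossing_eq_indicator [IsProbabilityMeasure P] (hL : RegularLevy L P) (x ε : ℝ)
    {f : ℝ × Ω → ℝ} (hf : Measurable f) {C : ℝ} (hC : ∀ p, |f p| ≤ C) :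
    ∫ p in crossing L x ε, f p ∂(volume.prod P) =
      ∫ s, ∫ ω, (crossing L x ε).indicator f (s, ω) ∂P := by
  rw [← integral_indicator (hL.measurableSet_crossing x ε), integral_prod _
    ((hL.integrableOn_crossing x ε hf hC).integrable_indicator (hL.measurableSet_crossing x ε))]

/-- The law of the process seen from the hitting time is the limit of its averages over short
windows of deterministic times in which the level is crossed. -/
lemma tendsto_average [IsProbabilityMeasure P] (hL : RegularLevy L P) (x t : ℝ)
    {F : ℝ × ℝ × ℝ × ℝ → ℝ} (hF : Continuous F) {C : ℝ} (hC : ∀ q, |F q| ≤ C) :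
    Tendsto (fun n : ℕ => ((n : ℝ) + 1) * ∫ p in crossing L x (mesh n),
      F (p.1, p.1 + mesh n, L p.1 p.2, L (p.1 + mesh n - t) p.2) ∂(volume.prod P)) atTop
      (𝓝 (∫ ω, F (hit L x ω, hit L x ω, undershoot L x ω, charBase L x t ω) ∂P)) := by
  have hm : ∀ n : ℕ, Measurable (fun p : ℝ × Ω => F (p.1, p.1 + mesh n, L p.1 p.2,
      L (p.1 + mesh n - t) p.2)) := fun n => hF.measurable.comp (hL.measurable_window t _)
  have key : ∀ n : ℕ, ((n : ℝ) + 1) * ∫ p in crossing L x (mesh n),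
      F (p.1, p.1 + mesh n, L p.1 p.2, L (p.1 + mesh n - t) p.2) ∂(volume.prod P) =
      ∫ ω, (((n : ℝ) + 1) * ∫ s in Set.Ico (hit L x ω - mesh n) (hit L x ω),
        F (s, s + mesh n, L s ω, L (s + mesh n - t) ω)) ∂P := by
    intro n
    rw [hL.setIntegral_crossing x _ (hm n) (fun p => hC _), integral_const_mul]
  simp only [key]
  -- The window has length exactly `mesh n` on every path, so the normalised average never exceeds
  -- the bound of F.
  refine tendsto_integral_of_dominated_convergence (fun _ => C) ?_ (integrable_const _) ?_ ?_
  · intro n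
    refine AEStronglyMeasurable.const_mul ?_ _
    have h1 : StronglyMeasurable ((crossing L x (mesh n)).indicator (fun p : ℝ × Ω =>
        F (p.1, p.1 + mesh n, L p.1 p.2, L (p.1 + mesh n - t) p.2))) :=
      ((hm n).indicator (hL.measurableSet_crossing x _)).stronglyMeasurable
    have h2 := h1.integral_prod_left' (μ := volume)
    refine h2.aestronglyMeasurable.congr (Eventually.of_forall fun ω => ?_)
    dsimp only
    rw [← integral_indicator measurableSet_Ico]
    refine integral_congr_ae (Eventually.of_forall fun s => ?_)
    simp only [Set.indicator, hL.mem_crossing_iff]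
  · intro n
    refine Eventually.of_forall fun ω => ?_
    have h := norm_setIntegral_le_of_norm_le_const (μ := volume)
      (s := Set.Ico (hit L x ω - mesh n) (hit L x ω)) (C := C)
      (f := fun s => F (s, s + mesh n, L s ω, L (s + mesh n - t) ω)) (by simp)
      (fun s _ => hC _)
    have h3 : volume.real (Set.Ico (hit L x ω - mesh n) (hit L x ω)) = mesh n := by
      simp [Measure.real, (mesh_pos n).le]
    rw [h3] at h
    have hn : (0 : ℝ) ≤ (n : ℝ) + 1 := by positivity
    rw [norm_mul, Real.norm_of_nonneg hn]
    calc ((n : ℝ) + 1) * _ ≤ ((n : ℝ) + 1) * (C * mesh n) := mul_le_mul_of_nonneg_left h hn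
      _ = C := by rw [mul_left_comm, mesh_mul, mul_one]
  · exact Eventually.of_forall fun ω => hL.tendsto_path_average x t hF hC ω

end RegularLevy
end LevyChar

/-! ### Identifying conditional laws through weighted test functions -/

namespace LevyChar

section WeightedLaw

variable {Ω α : Type*} [MeasurableSpace Ω] [MeasurableSpace α]

lemma map_withDensity_comp {β : Type*} [MeasurableSpace β] (μ : Measure Ω) {f : Ω → β}
    (hf : Measurable f) {g : β → ℝ≥0∞} (hg : Measurable g) :
    (μ.withDensity (fun ω => g (f ω))).map f = (μ.map f).withDensity g := by
  ext s hs
  rw [Measure.map_apply hf hs, withDensity_apply _ (hf hs), withDensity_apply _ hs,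
    setLIntegral_map hs hg hf]

lemma withDensity_compProd_left (μ : Measure α) [SFinite μ] {β : Type*} [MeasurableSpace β]
    (κ : Kernel α β) [IsSFiniteKernel κ] {h : α → ℝ≥0∞} (hh : Measurable h)
    [SFinite (μ.withDensity h)] :
    (μ.withDensity h) ⊗ₘ κ = (μ ⊗ₘ κ).withDensity (fun p => h p.1) := by
  ext s hs
  rw [Measure.compProd_apply hs, withDensity_apply _ hs, ← lintegral_indicator hs,
    Measure.lintegral_compProd (f := s.indicator fun p : α × β => h p.1)
      ((hh.comp measurable_fst).indicator hs),
    lintegral_withDensity_eq_lintegral_mul _ hh (Kernel.measurable_kernel_prodMk_left hs)]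
  refine lintegral_congr fun a => ?_
  have : ∀ b, s.indicator (fun p : α × β => h p.1) (a, b) =
      (Prod.mk a ⁻¹' s).indicator (fun _ => h a) b := fun b => rfl
  simp only [this, Pi.mul_apply]
  rw [lintegral_indicator_const (measurable_prodMk_left hs)]

/-- A conditional law may be identified on the set where a weight depending only on the
conditioning variable is positive. -/
lemma condDistrib_ae_eq_of_withDensity {P : Measure Ω} [IsFiniteMeasure P] {Z : Ω → α}
    {W : Ω → ℝ} (hZ : Measurable Z) (hW : Measurable W) {h : α → ℝ≥0∞} (hh : Measurable h)
    (κ : Kernel α ℝ) [IsMarkovKernel κ] (hfin : ∫⁻ ω, h (Z ω) ∂P ≠ ∞)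
    (H : (P.withDensity (fun ω => h (Z ω))).map (fun ω => (Z ω, W ω)) =
      (P.withDensity (fun ω => h (Z ω))).map Z ⊗ₘ κ) :
    ∀ᵐ z ∂(P.map Z), h z ≠ 0 → condDistrib W Z P z = κ z := by
  have hf : IsFiniteMeasure ((P.map Z).withDensity h) :=
    isFiniteMeasure_withDensity (by rwa [lintegral_map hh hZ])
  have h1 := map_withDensity_comp P (hZ.prodMk hW) (g := fun p => h p.1) (hh.comp measurable_fst)
  rw [H, map_withDensity_comp P hZ hh, ← compProd_map_condDistrib hW.aemeasurable,
    ← withDensity_compProd_left _ _ hh] at h1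
  -- Disintegrations are unique up to null sets of the weighted law, and these are the null sets of
  -- the original law within the region where the weight is nonzero.
  have h2 := Kernel.ae_eq_of_compProd_eq h1
  rw [Filter.EventuallyEq, ae_withDensity_iff hh] at h2
  filter_upwards [h2] with z hz h0 using (hz h0).symm

/-- Two-variable test functions identify a weighted joint law as a composition-product. -/
lemma map_prodMk_eq_compProd_of_integral_eq [TopologicalSpace α] [BorelSpace α]
    [SecondCountableTopology α] [HasOuterApproxClosed α]
    {μ : Measure Ω} {Z : Ω → α} {W : Ω → ℝ} (hZ : Measurable Z) (hW : Measurable W) {ψ : α → ℝ}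
    (hψ : Measurable ψ) (hψ0 : ∀ z, 0 ≤ ψ z) (hint : Integrable (fun ω => ψ (Z ω)) μ)
    (κ : Kernel α ℝ) [IsMarkovKernel κ]
    (H : ∀ (φ : α →ᵇ ℝ) (g : ℝ →ᵇ ℝ), ∫ ω, φ (Z ω) * ψ (Z ω) * g (W ω) ∂μ =
      ∫ ω, φ (Z ω) * ψ (Z ω) * (∫ w, g w ∂(κ (Z ω))) ∂μ) :
    (μ.withDensity (fun ω => ENNReal.ofReal (ψ (Z ω)))).map (fun ω => (Z ω, W ω)) =
      (μ.withDensity (fun ω => ENNReal.ofReal (ψ (Z ω)))).map Z ⊗ₘ κ := by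
  have hd : Measurable (fun ω => ENNReal.ofReal (ψ (Z ω))) := (hψ.comp hZ).ennreal_ofReal
  have hfin : IsFiniteMeasure (μ.withDensity (fun ω => ENNReal.ofReal (ψ (Z ω)))) :=
    isFiniteMeasure_withDensity_ofReal hint.2
  refine Measure.ext_of_integral_mul_boundedContinuousFunction fun φ g => ?_
  have hφ : Measurable φ := φ.continuous.measurable
  have hg : Measurable g := g.continuous.measurable
  have hφg : Measurable (fun p : α × ℝ => φ p.1 * g p.2) :=
    (hφ.comp measurable_fst).mul (hg.comp measurable_snd)
  rw [integral_map (hZ.prodMk hW).aemeasurable hφg.aestronglyMeasurable,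
    Measure.integral_compProd, integral_map hZ.aemeasurable,
    integral_withDensity_eq_integral_toReal_smul hd (by simp),
    integral_withDensity_eq_integral_toReal_smul hd (by simp)]
  · simp only [ENNReal.toReal_ofReal (hψ0 _), smul_eq_mul, integral_const_mul]
    have := H φ g
    convert! this using 2 <;> (funext ω; ring)
  · refine StronglyMeasurable.aestronglyMeasurable ?_
    exact StronglyMeasurable.integral_kernel_prod_right' (κ := κ)
      hφg.stronglyMeasurable
  · refine Integrable.of_bound (C := ‖φ‖ * ‖g‖) hφg.aestronglyMeasurable
      (Eventually.of_forall fun p => ?_)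
    rw [norm_mul]
    exact mul_le_mul (φ.norm_coe_le_norm _) (g.norm_coe_le_norm _) (norm_nonneg _) (norm_nonneg _)

/-- The criterion used for the limits of window averages: the weight confines the claim to the
region where the increments are suitably ordered, and it is taken continuous so that it survives the
limit. -/
lemma condDistrib_ae_eq_of_integral_eq [TopologicalSpace α] [BorelSpace α]
    [SecondCountableTopology α] [HasOuterApproxClosed α]
    {P : Measure Ω} [IsFiniteMeasure P] {Z : Ω → α} {W : Ω → ℝ} (hZ : Measurable Z)
    (hW : Measurable W) {ψ : α → ℝ}
    (hψ : Measurable ψ) (hψ0 : ∀ z, 0 ≤ ψ z) {C : ℝ} (hC : ∀ z, ψ z ≤ C)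
    (κ : Kernel α ℝ) [IsMarkovKernel κ]
    (H : ∀ (φ : α →ᵇ ℝ) (g : ℝ →ᵇ ℝ), ∫ ω, φ (Z ω) * ψ (Z ω) * g (W ω) ∂P =
      ∫ ω, φ (Z ω) * ψ (Z ω) * (∫ w, g w ∂(κ (Z ω))) ∂P) :
    ∀ᵐ z ∂(P.map Z), 0 < ψ z → condDistrib W Z P z = κ z := by
  have hint : Integrable (fun ω => ψ (Z ω)) P :=
    Integrable.of_bound (C := C) (hψ.comp hZ).aestronglyMeasurable
      (Eventually.of_forall fun ω => by rw [Real.norm_of_nonneg (hψ0 _)]; exact hC _)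
  have := condDistrib_ae_eq_of_withDensity hZ hW hψ.ennreal_ofReal κ
    hint.lintegral_lt_top.ne
    (map_prodMk_eq_compProd_of_integral_eq hZ hW hψ hψ0 hint κ H)
  filter_upwards [this] with z hz h0
  exact hz (by simpa using h0)

end WeightedLaw

/-! ### Independence, Laplace transform and unboundedness of the increments -/

section Increments

variable {Ω : Type*} [MeasurableSpace Ω] {P : Measure Ω} {L : ℝ → Ω → ℝ}

lemma iIndepFun_three_increments (hi : HasIndepIncrements L P) {r a b c : ℝ} (hra : r ≤ a)
    (hab : a ≤ b) (hbc : b ≤ c) (hm : ∀ t, Measurable (L t)) :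
    IndepFun (fun ω => L a ω - L r ω) (fun ω => (L b ω - L a ω, L c ω - L b ω)) P ∧
    IndepFun (fun ω => (L a ω - L r ω, L b ω - L a ω)) (fun ω => L c ω - L b ω) P := by
  let τ : ℕ → ℝ
    | 0 => r
    | 1 => a
    | 2 => b
    | _ => c
  have h := hi.nat (t := τ) (monotone_nat_of_le_succ fun n => by
    match n with
    | 0 => exact hra
    | 1 => exact hab
    | 2 => exact hbc
    | n + 3 => exact le_rfl)
  have hm' : ∀ i, Measurable (fun ω => L (τ (i + 1)) ω - L (τ i) ω) :=
    fun i => (hm _).sub (hm _)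
  exact ⟨(h.indepFun_prodMk hm' 1 2 0 (by decide) (by decide)).symm,
    h.indepFun_prodMk hm' 0 1 2 (by decide) (by decide)⟩

namespace IsStrictlyIncreasingLevy

lemma ae_pos (hL : IsStrictlyIncreasingLevy L P) {t : ℝ} (ht : 0 < t) : ∀ᵐ ω ∂P, 0 < L t ω := by
  filter_upwards [hL.zero, hL.strictMono] with ω h0 h
  rw [← h0]; exact h ht

/-- Independence splits the exponential of the sum, and stationarity resets the second increment to
start at zero. -/
lemma integral_exp_neg_add (hL : IsStrictlyIncreasingLevy L P) {s t : ℝ} (h0s : 0 ≤ s) (h0t : 0 ≤ t) :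
    ∫ ω, Real.exp (-L (s + t) ω) ∂P =
      (∫ ω, Real.exp (-L s ω) ∂P) * ∫ ω, Real.exp (-L t ω) ∂P := by
  have h1 : IndepFun (L s) (L (s + t) - L s) P :=
    hL.indep.indepFun_eval_sub h0s (by linarith) hL.zero
  have h2 := h1.integral_fun_comp_mul_comp (f := fun u => Real.exp (-u))
    (g := fun u => Real.exp (-u)) (hL.measurable s).aemeasurable ((hL.measurable _).sub (hL.measurable _)).aemeasurable
    (by fun_prop) (by fun_prop)
  have h3 := ((hL.stationary s t h0t).comp (u := fun u => Real.exp (-u)) (by fun_prop)).integral_eq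
  simp only [Function.comp_def] at h3
  rw [← h3]
  simp only [Pi.sub_apply] at h2
  rw [← h2]
  refine integral_congr_ae (Eventually.of_forall fun ω => ?_)
  dsimp only
  rw [← Real.exp_add]; congr 1; ring

lemma integral_exp_neg_nat_mul [IsProbabilityMeasure P] (hL : IsStrictlyIncreasingLevy L P) {t : ℝ} (ht : 0 ≤ t) (n : ℕ) :
    ∫ ω, Real.exp (-L (n * t) ω) ∂P = (∫ ω, Real.exp (-L t ω) ∂P) ^ n := by
  induction n with
  | zero =>
    have : ∫ ω, Real.exp (-L 0 ω) ∂P = ∫ _, 1 ∂P :=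
      integral_congr_ae (hL.zero.mono fun ω hω => by simp [hω])
    simp [this]
  | succ n ih =>
    have : ((n + 1 : ℕ) : ℝ) * t = n * t + t := by push_cast; ring
    rw [this, hL.integral_exp_neg_add (by positivity) ht, ih, pow_succ]

lemma integrable_exp_neg [IsProbabilityMeasure P] (hL : IsStrictlyIncreasingLevy L P) {t : ℝ} (ht : 0 < t) :
    Integrable (fun ω => Real.exp (-L t ω)) P := by
  refine Integrable.of_bound (C := 1) ((hL.measurable t).neg.exp).aestronglyMeasurable ?_
  filter_upwards [hL.ae_pos ht] with ω hω
  rw [Real.norm_of_nonneg (Real.exp_pos _).le]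
  exact Real.exp_le_one_iff.2 (by linarith)

lemma integral_exp_neg_lt_one [IsProbabilityMeasure P] (hL : IsStrictlyIncreasingLevy L P) {t : ℝ} (ht : 0 < t) :
    ∫ ω, Real.exp (-L t ω) ∂P < 1 := by
  have hint := hL.integrable_exp_neg ht
  have h1 : 0 < ∫ ω, (1 - Real.exp (-L t ω)) ∂P := by
    rw [integral_pos_iff_support_of_nonneg_ae]
    · have : Function.support (fun ω => 1 - Real.exp (-L t ω)) =ᵐ[P] Set.univ := by
        filter_upwards [hL.ae_pos ht] with ω hω
        refine propext ⟨fun _ => trivial, fun _ => ?_⟩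
        have := Real.exp_lt_one_iff.2 (show -L t ω < 0 by linarith)
        exact ne_of_gt (a := (1 - Real.exp (-L t ω))) (by linarith)
      rw [measure_congr this]; simp
    · filter_upwards [hL.ae_pos ht] with ω hω
      have := Real.exp_lt_one_iff.2 (show -L t ω < 0 by linarith)
      simp only [Pi.zero_apply]; linarith
    · exact (integrable_const 1).sub hint
  rw [integral_sub (integrable_const 1) hint] at h1
  simp at h1
  linarith

/-- The Laplace functional of the increments over short times is at most linear. -/
lemma exists_laplace_bound [IsProbabilityMeasure P] (hL : IsStrictlyIncreasingLevy L P) :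
    ∃ c : ℝ, ∀ n : ℕ, ((n : ℝ) + 1) * ∫ ω, (1 - Real.exp (-L (mesh n) ω)) ∂P ≤ c := by
  -- With q = E exp(-L(`mesh n`)), multiplicativity gives q^(n+1) = E exp(-L(1)); then (n+1)(1 - q)
  -- ≤ -(n+1) log q, which does not depend on n.
  refine ⟨-Real.log (∫ ω, Real.exp (-L 1 ω) ∂P), fun n => ?_⟩
  have hint := hL.integrable_exp_neg (mesh_pos n)
  have h1 := hL.integral_exp_neg_nat_mul (mesh_pos n).le (n + 1)
  have h2 : ((n + 1 : ℕ) : ℝ) * mesh n = 1 := by push_cast; exact mesh_mul n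
  have hq : 0 < ∫ ω, Real.exp (-L (mesh n) ω) ∂P := integral_exp_pos hint
  rw [h2] at h1
  rw [h1, Real.log_pow, integral_sub (integrable_const 1) hint]
  have h3 := Real.log_le_sub_one_of_pos hq
  simp only [integral_const, probReal_univ, smul_eq_mul, mul_one]
  push_cast
  have hn : (0 : ℝ) ≤ (n : ℝ) + 1 := by positivity
  nlinarith [mul_le_mul_of_nonneg_left h3 hn]

/-- Positive increments add up to infinity. -/
lemma ae_exists_nat_ge [IsProbabilityMeasure P] (hL : IsStrictlyIncreasingLevy L P) (x : ℝ) : ∀ ε : ℝ, 0 < ε →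
    ∃ n : ℕ, P.real {ω | L n ω < x} ≤ ε := by
  intro ε hε
  set a := ∫ ω, Real.exp (-L 1 ω) ∂P with ha
  have ha1 : a < 1 := hL.integral_exp_neg_lt_one one_pos
  have ha0 : 0 ≤ a := integral_nonneg fun ω => (Real.exp_pos _).le
  have hlim : Tendsto (fun n : ℕ => Real.exp x * a ^ n) atTop (𝓝 0) := by
    simpa using (tendsto_pow_atTop_nhds_zero_of_lt_one ha0 ha1).const_mul (Real.exp x)
  obtain ⟨n, hn, hn0⟩ := ((hlim.eventually (gt_mem_nhds hε)).and (eventually_gt_atTop 0)).exists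
  refine ⟨n, ?_⟩
  have hint : Integrable (fun ω => Real.exp (-L n ω)) P :=
    hL.integrable_exp_neg (by exact_mod_cast hn0)
  -- Markov's inequality for exp(-L(n)): the probability is at most exp(x) aⁿ, with a < 1.
  have h1 := mul_meas_ge_le_integral_of_nonneg (μ := P)
    (Eventually.of_forall fun ω => (Real.exp_pos (-L n ω)).le) hint (Real.exp (-x))
  have h2 := hL.integral_exp_neg_nat_mul zero_le_one n
  rw [mul_one, ← ha] at h2
  rw [h2] at h1
  have h3 : P.real {ω | L n ω < x} ≤ P.real {ω | Real.exp (-x) ≤ Real.exp (-L n ω)} := by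
    refine measureReal_mono fun ω hω => ?_
    have : L n ω < x := hω
    exact Real.exp_le_exp.2 (by linarith)
  have h4 : Real.exp x * (Real.exp (-x) * P.real {ω | Real.exp (-x) ≤ Real.exp (-L n ω)}) ≤
      Real.exp x * a ^ n := mul_le_mul_of_nonneg_left h1 (Real.exp_pos x).le
  rw [← mul_assoc, ← Real.exp_add, add_neg_cancel, Real.exp_zero, one_mul] at h4
  linarith

lemma ae_exists_ge [IsProbabilityMeasure P] (hL : IsStrictlyIncreasingLevy L P) (x : ℝ) : ∀ᵐ ω ∂P, ∃ n : ℕ, x ≤ L n ω := by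
  have : P.real {ω | ¬ ∃ n : ℕ, x ≤ L n ω} = 0 := by
    refine le_antisymm (le_of_forall_pos_le_add fun ε hε => ?_) measureReal_nonneg
    obtain ⟨n, hn⟩ := hL.ae_exists_nat_ge x ε hε
    refine (measureReal_mono fun ω hω => ?_).trans (hn.trans (by linarith))
    exact not_le.1 fun h => hω ⟨n, h⟩
  rw [measureReal_def, ENNReal.toReal_eq_zero_iff] at this
  exact this.resolve_right (measure_ne_top _ _)

lemma ae_exists_lt [IsProbabilityMeasure P] (hL : IsStrictlyIncreasingLevy L P) (x : ℝ) : ∀ᵐ ω ∂P, ∃ n : ℕ, L (-n) ω < x := by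
  have : P.real {ω | ¬ ∃ n : ℕ, L (-n) ω < x} = 0 := by
    refine le_antisymm (le_of_forall_pos_le_add fun ε hε => ?_) measureReal_nonneg
    -- By stationarity L(0) - L(-n) has the law of L(n). The extra 1 turns the weak inequality
    -- -L(-n) ≤ -x into the strict one that the estimate covers.
    obtain ⟨n, hn⟩ := hL.ae_exists_nat_ge (-x + 1) ε hε
    have h1 := (hL.stationary (-n) n n.cast_nonneg).measure_mem_eq (measurableSet_Iio (a := -x + 1))
    have h2 : P.real {ω | L n ω < -x + 1} =
        P.real {ω | L (-(n : ℝ) + n) ω - L (-n) ω < -x + 1} := by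
      rw [measureReal_def, measureReal_def]; exact congrArg _ h1.symm
    have h3 : P.real {ω | ¬ ∃ n : ℕ, L (-n) ω < x} ≤
        P.real {ω | L (-(n : ℝ) + n) ω - L (-n) ω < -x + 1} := by
      refine ENNReal.toReal_mono (measure_ne_top _ _) (measure_mono_ae ?_)
      filter_upwards [hL.zero] with ω hω h
      have h4 : x ≤ L (-n) ω := not_lt.1 fun h' => h ⟨n, h'⟩
      change L (-(n : ℝ) + n) ω - L (-n) ω < -x + 1
      rw [neg_add_cancel, hω]; linarith
    linarith
  rw [measureReal_def, ENNReal.toReal_eq_zero_iff] at this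
  exact this.resolve_right (measure_ne_top _ _)

end IsStrictlyIncreasingLevy

end Increments

end LevyChar

/-! ### The cases T < t and x < 0: a fresh independent copy -/

namespace LevyChar

/-- The kernel sending a parameter `b` to the law of `f (b, ·)`. -/
noncomputable def paramLaw {Ω β γ : Type*} [MeasurableSpace Ω] [MeasurableSpace β]
    [MeasurableSpace γ] (P : Measure Ω) (f : β × Ω → γ) : Kernel β γ :=
  (Kernel.id ×ₖ Kernel.const β P).map f

section ParamLaw

variable {Ω β γ : Type*} [MeasurableSpace Ω] [MeasurableSpace β] [MeasurableSpace γ]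
  {P : Measure Ω} {f : β × Ω → γ}

lemma paramLaw_apply [SFinite P] (hf : Measurable f) (b : β) :
    paramLaw P f b = P.map (fun ω => f (b, ω)) := by
  rw [paramLaw, Kernel.map_apply _ hf, Kernel.prod_apply, Kernel.id_apply, Kernel.const_apply,
    Measure.dirac_prod, Measure.map_map hf (by fun_prop)]
  rfl

lemma isMarkovKernel_paramLaw [IsProbabilityMeasure P] (hf : Measurable f) :
    IsMarkovKernel (paramLaw P f) :=
  Kernel.IsMarkovKernel.map _ hf

instance isFiniteKernel_paramLaw [IsFiniteMeasure P] (f : β × Ω → γ) :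
    IsFiniteKernel (paramLaw P f) := by
  unfold paramLaw; infer_instance

end ParamLaw

namespace RegularLevy

variable {Ω : Type*} [MeasurableSpace Ω] {P : Measure Ω} {L : ℝ → Ω → ℝ}

lemma continuousAt_path (hL : RegularLevy L P) (s : ℝ) :
    ∀ᵐ ω ∂P, ContinuousAt (fun u => L u ω) s := by
  filter_upwards [hL.leftLim_eq s] with ω hω
  rw [continuousAt_iff_continuous_left'_right']
  exact ⟨(hL.strictMono ω).monotone.continuousWithinAt_Iio_iff_leftLim_eq.2 hω,
    (hL.rightCont ω s).mono Set.Ioi_subset_Ici_self⟩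

/-- Since L(0) = 0, the variable -L(s - t) is the increment over an interval of length t - s ending
at zero. -/
lemma map_apply_sub (hL : RegularLevy L P) (t s : ℝ) (hst : s ≤ t) :
    P.map (L (s - t)) = P.map (fun ω => -(L (t - s) ω)) := by
  have h := (hL.levy.stationary (s - t) (t - s) (by linarith)).comp (u := fun u : ℝ => -u)
    (by fun_prop)
  rw [show (fun ω => -(L (t - s) ω)) = (fun u : ℝ => -u) ∘ (fun ω => L (t - s) ω) from rfl,
    ← h.map_eq]
  congr 1
  funext ω
  simp [hL.zero]

lemma measurable_comp_window (hL : RegularLevy L P) (t ε : ℝ) {F : ℝ × ℝ × ℝ × ℝ → ℝ}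
    (hF : Measurable F) :
    Measurable (fun p : ℝ × Ω => F (p.1, p.1 + ε, L p.1 p.2, L (p.1 + ε - t) p.2)) :=
  hF.comp (hL.measurable_window t ε)

variable [IsProbabilityMeasure P]

/-- Fixed times are almost surely continuity points. This makes the integrated test function
admissible in `tendsto_average`. -/
lemma continuous_integral_comp (hL : RegularLevy L P) (g : ℝ →ᵇ ℝ) :
    Continuous (fun u => ∫ ω, g (L u ω) ∂P) := by
  rw [continuous_iff_continuousAt]
  intro s
  refine tendsto_integral_filter_of_dominated_convergence (fun _ => ‖g‖) ?_ ?_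
    (integrable_const _) ?_
  · exact Eventually.of_forall fun u =>
      (g.continuous.measurable.comp (hL.measurable u)).aestronglyMeasurable
  · exact Eventually.of_forall fun u => Eventually.of_forall fun ω => g.norm_coe_le_norm _
  · filter_upwards [hL.continuousAt_path s] with ω hω
    exact (g.continuous.tendsto _).comp hω

lemma abs_integral_comp_le (g : ℝ →ᵇ ℝ) (u : ℝ) : |∫ ω, g (L u ω) ∂P| ≤ ‖g‖ := by
  have := norm_integral_le_of_norm_le_const (μ := P) (f := fun ω => g (L u ω)) (C := ‖g‖)
    (Eventually.of_forall fun ω => g.norm_coe_le_norm _)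
  simpa using this

/-- Before time zero the path is independent of the hitting data of a positive level. -/
lemma condLaw_of_lt (hL : RegularLevy L P) {x t : ℝ} (hx : 0 < x) :
    ∀ᵐ p ∂(hitUnderLaw L P x), p.1 < t → condLaw L P x t p = P.map (L (p.1 - t)) := by
  have hκm : Measurable (fun q : (ℝ × ℝ) × Ω => L (q.1.1 - t) q.2) :=
    hL.measurable_uncurry.comp (f := fun q : (ℝ × ℝ) × Ω => (q.1.1 - t, q.2)) (by fun_prop)
  have := isMarkovKernel_paramLaw (P := P) hκm
  -- The weight is positive exactly for hitting times strictly between 0 and t.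
  have key := condDistrib_ae_eq_of_integral_eq (hL.measurable_hitPair x)
    (hL.measurable_charBase x t) (ψ := fun z => max 0 (min 1 (min z.1 (t - z.1)))) (C := 1)
    (by fun_prop) (fun z => le_max_left _ _)
    (fun z => max_le zero_le_one (min_le_left _ _))
    (paramLaw P fun q : (ℝ × ℝ) × Ω => L (q.1.1 - t) q.2) (P := P) ?_
  · have hpos : ∀ᵐ p ∂(hitUnderLaw L P x), 0 < p.1 := by
      rw [hitUnderLaw, ae_map_iff (hL.measurable_hitPair x).aemeasurable
        (measurableSet_lt measurable_const measurable_fst)]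
      exact Eventually.of_forall fun ω => hL.hit_pos hx ω
    filter_upwards [key, hpos] with p hp hp0 hpt
    rw [condLaw, hp, paramLaw_apply hκm]
    exact lt_max_of_lt_right (lt_min one_pos (lt_min hp0 (by linarith)))
  intro φ g
  set m : ℝ → ℝ := fun u => ∫ ω, g (L u ω) ∂P with hm
  have hmc : Continuous m := hL.continuous_integral_comp g
  -- The lower bound is tested at the left end of the window and the upper bound at the right end. A
  -- nonzero weight then forces s + `mesh n` - t < 0 < s, so the earlier value lies on the other
  -- side of time zero from the window.
  set w : ℝ → ℝ → ℝ := fun s s' => max 0 (min 1 (min s (t - s'))) with hw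
  have hw0 : ∀ s s', 0 ≤ w s s' := fun _ _ => le_max_left _ _
  have hw1 : ∀ s s', w s s' ≤ 1 := fun _ _ => max_le zero_le_one (min_le_left _ _)
  have hbd : ∀ (z : ℝ × ℝ) (s s' d : ℝ), |d| ≤ ‖g‖ → |φ z * w s s' * d| ≤ ‖φ‖ * 1 * ‖g‖ := by
    intro z s s' d hd
    rw [abs_mul, abs_mul, abs_of_nonneg (hw0 _ _)]
    exact mul_le_mul (mul_le_mul (φ.norm_coe_le_norm z) (hw1 _ _) (hw0 _ _) (norm_nonneg _)) hd
      (abs_nonneg _) (by positivity)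
  let F : ℝ × ℝ × ℝ × ℝ → ℝ := fun q => φ (q.1, q.2.2.1) * w q.1 q.2.1 * g q.2.2.2
  let G : ℝ × ℝ × ℝ × ℝ → ℝ := fun q => φ (q.1, q.2.2.1) * w q.1 q.2.1 * m (q.2.1 - t)
  have hwc : Continuous (fun q : ℝ × ℝ × ℝ × ℝ => w q.1 q.2.1) := by
    simp only [hw]; fun_prop
  have hFc : Continuous F :=
    ((φ.continuous.comp (by fun_prop)).mul hwc).mul (g.continuous.comp (by fun_prop))
  have hGc : Continuous G :=
    ((φ.continuous.comp (by fun_prop)).mul hwc).mul (hmc.comp (by fun_prop))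
  have hFC : ∀ q, |F q| ≤ ‖φ‖ * 1 * ‖g‖ := fun q => hbd _ _ _ _ (g.norm_coe_le_norm _)
  have hGC : ∀ q, |G q| ≤ ‖φ‖ * 1 * ‖g‖ := fun q => hbd _ _ _ _ (abs_integral_comp_le g _)
  have hF := hL.tendsto_average x t hFc hFC
  have hG := hL.tendsto_average x t hGc hGC
  have heq : ∀ n : ℕ, ∫ p in crossing L x (mesh n),
      F (p.1, p.1 + mesh n, L p.1 p.2, L (p.1 + mesh n - t) p.2) ∂(volume.prod P) =
      ∫ p in crossing L x (mesh n),
      G (p.1, p.1 + mesh n, L p.1 p.2, L (p.1 + mesh n - t) p.2) ∂(volume.prod P) := by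
    intro n
    rw [hL.setIntegral_crossing_eq_indicator x _ (hL.measurable_comp_window t _ hFc.measurable)
      (fun p => hFC _), hL.setIntegral_crossing_eq_indicator x _
      (hL.measurable_comp_window t _ hGc.measurable) (fun p => hGC _)]
    refine integral_congr_ae (Eventually.of_forall fun s => ?_)
    dsimp only
    have hd := mesh_pos n
    by_cases hs : 0 < s ∧ s + mesh n < t
    · obtain ⟨hI, -⟩ := iIndepFun_three_increments hL.levy.indep
        (r := s + mesh n - t) (a := 0) (b := s) (c := s + mesh n) (by linarith) hs.1.le
        (by linarith) hL.measurable
      let f : ℝ × ℝ → ℝ := fun a => if a.1 < x ∧ x ≤ a.1 + a.2 then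
        φ (s, a.1) * w s (s + mesh n) else 0
      have hf : Measurable f := by
        refine Measurable.ite ?_ (Measurable.mul_const ?_ _) measurable_const
        swap
        · exact φ.continuous.measurable.comp (f := fun a : ℝ × ℝ => (s, a.1)) (by fun_prop)
        exact (measurableSet_lt measurable_fst measurable_const).inter
          (measurableSet_le measurable_const (measurable_fst.add measurable_snd))
      -- The first increment ends at time zero, so it is minus the earlier value; this explains the
      -- sign.
      have h1 := hI.symm.integral_fun_comp_mul_comp (f := f) (g := fun d => g (-d))
        (((hL.measurable _).sub (hL.measurable _)).prodMk
          ((hL.measurable _).sub (hL.measurable _))).aemeasurable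
        ((hL.measurable _).sub (hL.measurable _)).aemeasurable hf.aestronglyMeasurable
        (g.continuous.measurable.comp measurable_neg).aestronglyMeasurable
      simp only [hL.zero, sub_zero, zero_sub, neg_neg] at h1
      have e1 : ∀ ω, (crossing L x (mesh n)).indicator (fun p : ℝ × Ω =>
          F (p.1, p.1 + mesh n, L p.1 p.2, L (p.1 + mesh n - t) p.2)) (s, ω) =
          f (L s ω, L (s + mesh n) ω - L s ω) * g (L (s + mesh n - t) ω) := by
        intro ω
        simp only [Set.indicator, crossing, Set.mem_ofPred_eq, f, F, add_sub_cancel, ite_mul,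
          zero_mul]
        congr
      have e2 : ∀ ω, (crossing L x (mesh n)).indicator (fun p : ℝ × Ω =>
          G (p.1, p.1 + mesh n, L p.1 p.2, L (p.1 + mesh n - t) p.2)) (s, ω) =
          f (L s ω, L (s + mesh n) ω - L s ω) * m (s + mesh n - t) := by
        intro ω
        simp only [Set.indicator, crossing, Set.mem_ofPred_eq, f, G, add_sub_cancel, ite_mul,
          zero_mul]
        congr
      simp only [e1, e2, h1, integral_mul_const, hm]
    · have hz : w s (s + mesh n) = 0 := by
        refine max_eq_left ((min_le_right _ _).trans ?_)
        rcases not_and_or.1 hs with h | h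
        · exact (min_le_left _ _).trans (not_lt.1 h)
        · exact (min_le_right _ _).trans (by linarith [not_lt.1 h])
      simp [Set.indicator, F, G, hz]
  simp only [heq] at hF
  have hlim := tendsto_nhds_unique hF hG
  simp only [F, G] at hlim
  refine hlim.trans (integral_congr_ae (Eventually.of_forall fun ω => ?_))
  dsimp only
  rw [paramLaw_apply hκm]
  exact congrArg _ (integral_map (hL.measurable _).aemeasurable
    g.continuous.measurable.aestronglyMeasurable).symm

/-- At level zero the conditioning pair is almost surely the constant (0, 0), so it carries no
information. -/
lemma condLaw_zero (hL : RegularLevy L P) (t : ℝ) :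
    ∀ᵐ p ∂(hitUnderLaw L P 0), condLaw L P 0 t p = P.map (L (p.1 - t)) := by
  have h0 : (fun ω => (hit L 0 ω, undershoot L 0 ω)) =ᵐ[P] fun _ => ((0 : ℝ), (0 : ℝ)) := by
    filter_upwards [hL.undershoot_zero_ae] with ω hω
    rw [hω, hL.hit_zero]
  have hc : charBase L 0 t = L (0 - t) := by
    funext ω; rw [charBase, hL.hit_zero]
  have hI : IndepFun (fun ω => (hit L 0 ω, undershoot L 0 ω)) (charBase L 0 t) P :=
    (indepFun_const_left ((0 : ℝ), (0 : ℝ)) (charBase L 0 t)).congr h0.symm .rfl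
  have hp : IsProbabilityMeasure (P.map (charBase L 0 t)) :=
    Measure.isProbabilityMeasure_map (hL.measurable_charBase 0 t).aemeasurable
  have h1 := condDistrib_ae_eq_of_measure_eq_compProd (μ := P)
    (fun ω => (hit L 0 ω, undershoot L 0 ω)) (hL.measurable_charBase 0 t).aemeasurable
    (κ := Kernel.const _ (P.map (charBase L 0 t))) (by
      rw [Measure.compProd_const]
      exact (indepFun_iff_map_prod_eq_prod_map_map (hL.measurable_hitPair 0).aemeasurable
        (hL.measurable_charBase 0 t).aemeasurable).1 hI)
  have h2 : ∀ᵐ p ∂(hitUnderLaw L P 0), p.1 = 0 := by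
    rw [hitUnderLaw, ae_map_iff (hL.measurable_hitPair 0).aemeasurable
      (measurableSet_eq_fun measurable_fst measurable_const)]
    exact Eventually.of_forall fun ω => hL.hit_zero ω
  filter_upwards [h1, h2] with p hp hp0
  rw [condLaw, hp, Kernel.const_apply, hc, hp0]

/-- Below a negative level, the process looks backwards like a fresh copy. -/
lemma condDistrib_undershoot_sub (hL : RegularLevy L P) {x t : ℝ} (hx : x < 0) (ht : 0 < t) :
    ∀ᵐ p ∂(hitUnderLaw L P x),
      condDistrib (fun ω => undershoot L x ω - charBase L x t ω)
        (fun ω => (hit L x ω, undershoot L x ω)) P p = P.map (L t) := by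
  have : IsProbabilityMeasure (P.map (L t)) :=
    Measure.isProbabilityMeasure_map (hL.measurable t).aemeasurable
  have key := condDistrib_ae_eq_of_integral_eq (hL.measurable_hitPair x)
    ((hL.measurable_undershoot x).sub (hL.measurable_charBase x t))
    (ψ := fun z => max 0 (min 1 (-z.1))) (C := 1)
    (by fun_prop) (fun z => le_max_left _ _)
    (fun z => max_le zero_le_one (min_le_left _ _)) (Kernel.const _ (P.map (L t))) (P := P) ?_
  · have hneg : ∀ᵐ p ∂(hitUnderLaw L P x), p.1 < 0 := by
      rw [hitUnderLaw, ae_map_iff (hL.measurable_hitPair x).aemeasurable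
        (measurableSet_lt measurable_fst measurable_const)]
      exact hL.hit_neg_ae hx
    filter_upwards [key, hneg] with p hp hp0
    exact hp (lt_max_of_lt_right (lt_min one_pos (by linarith)))
  intro φ g
  set m : ℝ → ℝ := fun u => ∫ ω, g (L u ω) ∂P with hm
  have hmc : Continuous m := hL.continuous_integral_comp g
  set w : ℝ → ℝ := fun s => max 0 (min 1 (-s)) with hw
  have hw0 : ∀ s, 0 ≤ w s := fun _ => le_max_left _ _
  have hw1 : ∀ s, w s ≤ 1 := fun _ => max_le zero_le_one (min_le_left _ _)
  have hwc : Continuous w := by simp only [hw]; fun_prop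
  have hbG : ∀ (z : ℝ × ℝ) (s : ℝ), |φ z * w s| ≤ ‖φ‖ * 1 := by
    intro z s
    rw [abs_mul, abs_of_nonneg (hw0 _)]
    exact mul_le_mul (φ.norm_coe_le_norm z) (hw1 _) (hw0 _) (norm_nonneg _)
  let F : ℝ × ℝ × ℝ × ℝ → ℝ := fun q => φ (q.1, q.2.2.1) * w q.2.1 * g (q.2.2.1 - q.2.2.2)
  let G : ℝ × ℝ × ℝ × ℝ → ℝ := fun q => φ (q.1, q.2.2.1) * w q.2.1
  have hGc : Continuous G := (φ.continuous.comp (by fun_prop)).mul (hwc.comp (by fun_prop))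
  have hFc : Continuous F := hGc.mul (g.continuous.comp (by fun_prop))
  have hFC : ∀ q, |F q| ≤ ‖φ‖ * 1 * ‖g‖ := by
    intro q
    simp only [F]
    rw [abs_mul]
    exact mul_le_mul (hbG _ _) (g.norm_coe_le_norm _) (abs_nonneg _) (by positivity)
  have hGC : ∀ q, |G q| ≤ ‖φ‖ * 1 := fun q => hbG _ _
  have hF := hL.tendsto_average x t hFc hFC
  have hG := hL.tendsto_average x t hGc hGC
  have heq : ∀ᶠ n : ℕ in atTop, ((n : ℝ) + 1) * (∫ p in crossing L x (mesh n),
      G (p.1, p.1 + mesh n, L p.1 p.2, L (p.1 + mesh n - t) p.2) ∂(volume.prod P)) *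
        m (t - mesh n) = ((n : ℝ) + 1) * ∫ p in crossing L x (mesh n),
      F (p.1, p.1 + mesh n, L p.1 p.2, L (p.1 + mesh n - t) p.2) ∂(volume.prod P) := by
    filter_upwards [tendsto_mesh.eventually (gt_mem_nhds ht)] with n hn
    rw [hL.setIntegral_crossing_eq_indicator x _ (hL.measurable_comp_window t _ hFc.measurable)
      (fun p => hFC _), hL.setIntegral_crossing_eq_indicator x _
      (hL.measurable_comp_window t _ hGc.measurable) (fun p => hGC _), mul_assoc,
      ← integral_mul_const]
    congr 1
    refine integral_congr_ae (Eventually.of_forall fun s => ?_)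
    dsimp only
    have hd := mesh_pos n
    by_cases hs : s + mesh n < 0
    -- The whole window precedes time zero. The crossing is determined by the two increments from s
    -- up to time zero, hence is independent of the increment that ends at s.
    · obtain ⟨hI, -⟩ := iIndepFun_three_increments hL.levy.indep
        (r := s + mesh n - t) (a := s) (b := s + mesh n) (c := 0) (by linarith) (by linarith)
        hs.le hL.measurable
      -- The values at both ends of the window are recovered backwards from L(0) = 0.
      let f : ℝ × ℝ → ℝ := fun a => if -(a.1 + a.2) < x ∧ x ≤ -a.2 then
        φ (s, -(a.1 + a.2)) * w (s + mesh n) else 0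
      have hf : Measurable f := by
        refine Measurable.ite ?_ (Measurable.mul_const ?_ _) measurable_const
        swap
        · exact φ.continuous.measurable.comp (f := fun a : ℝ × ℝ => (s, -(a.1 + a.2)))
            (by fun_prop)
        exact (measurableSet_lt (measurable_fst.add measurable_snd).neg measurable_const).inter
          (measurableSet_le measurable_const measurable_snd.neg)
      have h1 := hI.symm.integral_fun_comp_mul_comp (f := f) (g := fun d => g d)
        (((hL.measurable _).sub (hL.measurable _)).prodMk
          ((hL.measurable _).sub (hL.measurable _))).aemeasurable
        ((hL.measurable _).sub (hL.measurable _)).aemeasurable hf.aestronglyMeasurable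
        g.continuous.measurable.aestronglyMeasurable
      -- The earlier value is read from the right end, so the free increment has length t - `mesh n`
      -- and not t; continuity of m removes the discrepancy in the limit.
      have h2 := ((hL.levy.stationary (s + mesh n - t) (t - mesh n) (by linarith)).comp
        g.continuous.measurable).integral_eq
      rw [show s + mesh n - t + (t - mesh n) = s by ring] at h2
      simp only [Function.comp_def] at h2
      have e0 : ∀ ω, f (L (s + mesh n) ω - L s ω, L 0 ω - L (s + mesh n) ω) =
          (crossing L x (mesh n)).indicator (fun p : ℝ × Ω =>
          G (p.1, p.1 + mesh n, L p.1 p.2, L (p.1 + mesh n - t) p.2)) (s, ω) := by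
        intro ω
        have a1 : -(L (s + mesh n) ω - L s ω + (L 0 ω - L (s + mesh n) ω)) = L s ω := by
          rw [hL.zero]; ring
        have a2 : -(L 0 ω - L (s + mesh n) ω) = L (s + mesh n) ω := by rw [hL.zero]; ring
        simp only [f, a1, a2, Set.indicator, crossing, Set.mem_ofPred_eq, G]
        congr
      have e1 : ∀ ω, (crossing L x (mesh n)).indicator (fun p : ℝ × Ω =>
          F (p.1, p.1 + mesh n, L p.1 p.2, L (p.1 + mesh n - t) p.2)) (s, ω) =
          (crossing L x (mesh n)).indicator (fun p : ℝ × Ω =>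
          G (p.1, p.1 + mesh n, L p.1 p.2, L (p.1 + mesh n - t) p.2)) (s, ω) *
            g (L s ω - L (s + mesh n - t) ω) := by
        intro ω
        exact Set.indicator_mul_left (crossing L x (mesh n)) (fun p : ℝ × Ω =>
          G (p.1, p.1 + mesh n, L p.1 p.2, L (p.1 + mesh n - t) p.2))
          (fun p => g (L p.1 p.2 - L (p.1 + mesh n - t) p.2))
      simp only [e0] at h1
      simp only [e1, h1, h2, hm]
    · have hz : w (s + mesh n) = 0 :=
        max_eq_left ((min_le_right _ _).trans (by linarith [not_lt.1 hs]))
      simp [Set.indicator, F, G, hz]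
  have hmt : Tendsto (fun n => m (t - mesh n)) atTop (𝓝 (m t)) := by
    refine (hmc.tendsto t).comp ?_
    simpa using tendsto_const_nhds.sub tendsto_mesh
  have hlim := tendsto_nhds_unique hF ((hG.mul hmt).congr' heq)
  simp only [F, G, ← integral_mul_const] at hlim
  refine hlim.trans (integral_congr_ae (Eventually.of_forall fun ω => ?_))
  dsimp only
  rw [Kernel.const_apply, integral_map (hL.measurable t).aemeasurable
    g.continuous.measurable.aestronglyMeasurable]

/-- The difference between undershoot and earlier value is independent of the conditioning pair; the
map (z, v) ↦ (z, z.2 - v) transports this product law into the claimed disintegration. -/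
lemma condLaw_of_neg (hL : RegularLevy L P) {x t : ℝ} (hx : x < 0) (ht : 0 < t) :
    ∀ᵐ p ∂(hitUnderLaw L P x), condLaw L P x t p = P.map (fun ω => p.2 - L t ω) := by
  have hκm : Measurable (fun q : (ℝ × ℝ) × Ω => q.1.2 - L t q.2) :=
    (by fun_prop : Measurable fun q : (ℝ × ℝ) × Ω => q.1.2).sub
      ((hL.measurable t).comp measurable_snd)
  have := isMarkovKernel_paramLaw (P := P) hκm
  set Z := fun ω => (hit L x ω, undershoot L x ω) with hZ
  have hZm : Measurable Z := hL.measurable_hitPair x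
  set V := fun ω => undershoot L x ω - charBase L x t ω with hV
  have hVm : Measurable V := (hL.measurable_undershoot x).sub (hL.measurable_charBase x t)
  have h1 : P.map Z ⊗ₘ condDistrib V Z P = P.map fun ω => (Z ω, V ω) :=
    compProd_map_condDistrib hVm.aemeasurable
  have : IsProbabilityMeasure (P.map (L t)) :=
    Measure.isProbabilityMeasure_map (hL.measurable t).aemeasurable
  have h0 : condDistrib V Z P =ᵐ[P.map Z] Kernel.const _ (P.map (L t)) :=
    hL.condDistrib_undershoot_sub hx ht
  rw [Measure.compProd_congr h0] at h1
  have h2 : P.map (fun ω => (Z ω, charBase L x t ω)) = P.map Z ⊗ₘ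
      paramLaw P fun q : (ℝ × ℝ) × Ω => q.1.2 - L t q.2 := by
    have hsub : Measurable (fun p : (ℝ × ℝ) × ℝ => (p.1, p.1.2 - p.2)) := by fun_prop
    have e : (fun ω => (Z ω, charBase L x t ω)) =
        (fun p : (ℝ × ℝ) × ℝ => (p.1, p.1.2 - p.2)) ∘ fun ω => (Z ω, V ω) := by
      funext ω; simp [hZ, hV]
    rw [e, ← Measure.map_map hsub (hZm.prodMk hVm), ← h1]
    ext A hA
    rw [Measure.map_apply hsub hA, Measure.compProd_apply (hsub hA), Measure.compProd_apply hA]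
    refine lintegral_congr fun z => ?_
    rw [Kernel.const_apply, paramLaw_apply hκm,
      Measure.map_apply (hL.measurable t) (measurable_prodMk_left (hsub hA)),
      Measure.map_apply (f := fun ω => z.2 - L t ω) (measurable_const.sub (hL.measurable t))
        (measurable_prodMk_left hA)]
    rfl
  have h3 := condDistrib_ae_eq_of_measure_eq_compProd Z
    (hL.measurable_charBase x t).aemeasurable h2
  filter_upwards [h3] with p hp
  rw [condLaw, hp, paramLaw_apply hκm]

end RegularLevy
end LevyChar

/-! ### Weights, independence of the past, and the bridge tested against functions -/

namespace LevyChar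

/-- A bounded integrable continuous weight that is positive exactly after time `t`. -/
noncomputable def timeWeight (t s : ℝ) : ℝ := max 0 (min 1 (s - t)) * (1 + s ^ 2)⁻¹

section TimeWeight

variable (t s : ℝ)

lemma continuous_timeWeight : Continuous (timeWeight t) := by
  unfold timeWeight
  refine Continuous.mul (by fun_prop) (Continuous.inv₀ (by fun_prop) fun s => by positivity)

lemma timeWeight_nonneg : 0 ≤ timeWeight t s := by unfold timeWeight; positivity

lemma timeWeight_le : timeWeight t s ≤ (1 + s ^ 2)⁻¹ := by
  unfold timeWeight
  exact mul_le_of_le_one_left (by positivity) (max_le zero_le_one (min_le_left _ _))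

lemma timeWeight_le_one : timeWeight t s ≤ 1 :=
  (timeWeight_le t s).trans (inv_le_one_of_one_le₀ (by nlinarith [sq_nonneg s]))

lemma integrable_timeWeight : Integrable (timeWeight t) :=
  integrable_inv_one_add_sq.mono' (continuous_timeWeight t).aestronglyMeasurable
    (Eventually.of_forall fun s => by
      rw [Real.norm_of_nonneg (timeWeight_nonneg t s)]; exact timeWeight_le t s)

variable {t s}

lemma timeWeight_of_le (h : s ≤ t) : timeWeight t s = 0 := by
  rw [timeWeight, max_eq_left ((min_le_right _ _).trans (by linarith)), zero_mul]

lemma timeWeight_pos (h : t < s) : 0 < timeWeight t s := by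
  unfold timeWeight
  exact mul_pos (lt_max_of_lt_right (lt_min one_pos (by linarith))) (by positivity)

end TimeWeight

/-- The weight used below a level: positive exactly after time `t` and strictly below `x`. -/
noncomputable def belowWeight (x t : ℝ) (z : ℝ × ℝ) : ℝ :=
  timeWeight t z.1 * (1 - Real.exp (-(max 0 (x - z.2))))

section BelowWeight

variable (x t : ℝ) (z : ℝ × ℝ)

lemma continuous_belowWeight : Continuous (belowWeight x t) := by
  unfold belowWeight
  exact ((continuous_timeWeight t).comp continuous_fst).mul (by fun_prop)

lemma one_sub_exp_nonneg {u : ℝ} (hu : 0 ≤ u) : 0 ≤ 1 - Real.exp (-u) := by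
  have := Real.exp_le_one_iff.2 (neg_nonpos.2 hu); linarith

lemma belowWeight_nonneg : 0 ≤ belowWeight x t z :=
  mul_nonneg (timeWeight_nonneg _ _) (one_sub_exp_nonneg (le_max_left _ _))

lemma belowWeight_le_one : belowWeight x t z ≤ 1 := by
  refine mul_le_one₀ (timeWeight_le_one _ _) (one_sub_exp_nonneg (le_max_left _ _)) ?_
  linarith [Real.exp_pos (-(max 0 (x - z.2)))]

variable {x t z}

lemma belowWeight_pos (hz : t < z.1) (hx : z.2 < x) : 0 < belowWeight x t z := by
  refine mul_pos (timeWeight_pos hz) ?_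
  have : Real.exp (-(max 0 (x - z.2))) < 1 :=
    Real.exp_lt_one_iff.2 (neg_lt_zero.2 (lt_max_of_lt_right (by linarith)))
  linarith

end BelowWeight

namespace RegularLevy

variable {Ω : Type*} [MeasurableSpace Ω] {P : Measure Ω} {L : ℝ → Ω → ℝ}

/-- The path starts at zero, so its values at nonnegative times are sums of increments from time
zero on. -/
lemma indepFun_past (hL : RegularLevy L P) {a b s s' : ℝ} (h0a : 0 ≤ a) (hab : a ≤ b)
    (hbs : b ≤ s) (hss : s ≤ s') :
    IndepFun (fun ω => (L a ω, L b ω, L s ω)) (fun ω => L s' ω - L s ω) P := by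
  let τ : ℕ → ℝ
    | 0 => 0
    | 1 => a
    | 2 => b
    | 3 => s
    | _ => s'
  have h := hL.levy.indep.nat (t := τ) (monotone_nat_of_le_succ fun n => by
    match n with
    | 0 => exact h0a
    | 1 => exact hab
    | 2 => exact hbs
    | 3 => exact hss
    | n + 4 => exact le_rfl)
  have hm' : ∀ i, Measurable (fun ω => L (τ (i + 1)) ω - L (τ i) ω) :=
    fun i => (hL.measurable _).sub (hL.measurable _)
  have h1 := h.indepFun_finset {0, 1, 2} {3} (by decide) hm'
  let u : (({0, 1, 2} : Finset ℕ) → ℝ) → ℝ × ℝ × ℝ := fun v =>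
    (v ⟨0, by decide⟩, v ⟨0, by decide⟩ + v ⟨1, by decide⟩,
      v ⟨0, by decide⟩ + v ⟨1, by decide⟩ + v ⟨2, by decide⟩)
  let u' : (({3} : Finset ℕ) → ℝ) → ℝ := fun v => v ⟨3, by decide⟩
  have h2 := h1.comp (φ := u) (ψ := u') (by fun_prop) (by fun_prop)
  convert! h2 using 1
  funext ω
  simp [u, τ, hL.zero]

variable [IsProbabilityMeasure P]

/-- Freezing D leaves an expectation over X alone; in `average_bridge` this is what reduces the
crossing condition to a condition on L(s). -/
lemma indepFun_integral_eq {α β : Type*} [MeasurableSpace α] [MeasurableSpace β] {X : Ω → α}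
    {D : Ω → β} (hX : Measurable X) (hD : Measurable D) (hI : IndepFun X D P) {f : α × β → ℝ}
    (hf : Measurable f) {C : ℝ} (hC : ∀ p, |f p| ≤ C) :
    ∫ ω, f (X ω, D ω) ∂P = ∫ d, (∫ ω, f (X ω, d) ∂P) ∂(P.map D) := by
  have := Measure.isProbabilityMeasure_map (μ := P) hX.aemeasurable
  have := Measure.isProbabilityMeasure_map (μ := P) hD.aemeasurable
  have h1 := (indepFun_iff_map_prod_eq_prod_map_map hX.aemeasurable hD.aemeasurable).1 hI
  rw [← integral_map (φ := fun ω => (X ω, D ω)) (hX.prodMk hD).aemeasurable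
    hf.aestronglyMeasurable, h1, integral_prod_symm]
  · refine integral_congr_ae (Eventually.of_forall fun d => ?_)
    exact integral_map hX.aemeasurable (hf.comp measurable_prodMk_right).aestronglyMeasurable
  · exact Integrable.of_bound hf.aestronglyMeasurable C (Eventually.of_forall hC)

/-- The Lévy bridge property, tested against functions. -/
lemma integral_bridge (hL : RegularLevy L P) {K : Kernel (ℝ × ℝ × ℝ) ℝ}
    (hK : IsLevyBridge L P K) {r s : ℝ} (hr : 0 ≤ r) (hrs : r ≤ s) {h : ℝ → ℝ} (hh : Measurable h)
    {C : ℝ} (hC : ∀ y, |h y| ≤ C) (g : ℝ →ᵇ ℝ) :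
    ∫ ω, h (L s ω) * g (L r ω) ∂P = ∫ ω, h (L s ω) * (∫ w, g w ∂(K (r, s, L s ω))) ∂P := by
  have hhg : Measurable (fun p : ℝ × ℝ => h p.1 * g p.2) :=
    (hh.comp measurable_fst).mul (g.continuous.measurable.comp measurable_snd)
  have h1 : P.map (L s) ⊗ₘ condDistrib (L r) (L s) P = P.map fun ω => (L s ω, L r ω) :=
    compProd_map_condDistrib (hL.measurable r).aemeasurable
  have hk : ∀ κ : Kernel ℝ ℝ, IsSFiniteKernel κ →
      StronglyMeasurable (fun y => h y * ∫ w, g w ∂(κ y)) := fun κ hκ =>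
    hh.stronglyMeasurable.mul (StronglyMeasurable.integral_kernel_prod_right' (κ := κ)
      (f := fun p : ℝ × ℝ => g p.2)
      (g.continuous.measurable.comp measurable_snd).stronglyMeasurable)
  have hKm := hK.markov
  calc ∫ ω, h (L s ω) * g (L r ω) ∂P
      = ∫ p, h p.1 * g p.2 ∂(P.map fun ω => (L s ω, L r ω)) :=
        (integral_map ((hL.measurable s).prodMk (hL.measurable r)).aemeasurable
          hhg.aestronglyMeasurable).symm
    _ = ∫ y, h y * (∫ w, g w ∂(condDistrib (L r) (L s) P y)) ∂(P.map (L s)) := by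
        have hp : IsProbabilityMeasure (P.map (L s)) :=
          Measure.isProbabilityMeasure_map (hL.measurable s).aemeasurable
        rw [← h1, Measure.integral_compProd]
        · simp only [integral_const_mul]
        · refine Integrable.of_bound hhg.aestronglyMeasurable (C * ‖g‖)
            (Eventually.of_forall fun p => ?_)
          rw [norm_mul]
          exact mul_le_mul (hC _) (g.norm_coe_le_norm _) (norm_nonneg _)
            ((abs_nonneg _).trans (hC 0))
    _ = ∫ y, h y * (∫ w, g w ∂(K (r, s, y))) ∂(P.map (L s)) := by
        refine integral_congr_ae ?_
        filter_upwards [hK.bridge r s hr hrs] with y hy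
        rw [hy]
    _ = _ := integral_map (hL.measurable s).aemeasurable
        (hk (K.comap (fun y => (r, s, y)) (by fun_prop)) inferInstance).aestronglyMeasurable

end RegularLevy
end LevyChar

/-! ### Uniform domination of window averages below the level -/

namespace LevyChar
namespace RegularLevy

variable {Ω : Type*} [MeasurableSpace Ω] {P : Measure Ω} {L : ℝ → Ω → ℝ}

lemma integral_one_sub_exp_increment (hL : RegularLevy L P) (s : ℝ) (n : ℕ) :
    ∫ ω, (1 - Real.exp (-(L (s + mesh n) ω - L s ω))) ∂P =
      ∫ ω, (1 - Real.exp (-L (mesh n) ω)) ∂P :=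
  ((hL.levy.stationary s (mesh n) (mesh_pos n).le).comp
    (u := fun d => 1 - Real.exp (-d)) (by fun_prop)).integral_eq

variable [IsProbabilityMeasure P]

lemma exists_nonneg_laplace_bound (hL : RegularLevy L P) :
    ∃ c : ℝ, 0 ≤ c ∧ ∀ n : ℕ, ((n : ℝ) + 1) * ∫ ω, (1 - Real.exp (-L (mesh n) ω)) ∂P ≤ c := by
  obtain ⟨c, hc⟩ := hL.levy.exists_laplace_bound
  exact ⟨max 0 c, le_max_left _ _, fun n => (hc n).trans (le_max_right _ _)⟩

lemma integrable_timeWeight_prod (t : ℝ) {f : ℝ × Ω → ℝ}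
    (hf : Measurable f) {C : ℝ} (hC : ∀ p, |f p| ≤ C) :
    Integrable (fun p : ℝ × Ω => timeWeight t p.1 * f p) (volume.prod P) := by
  have h1 : Integrable (fun p : ℝ × Ω => timeWeight t p.1) (volume.prod P) :=
    (integrable_timeWeight t).comp_fst P
  exact h1.mul_bdd (c := C) hf.aestronglyMeasurable (Eventually.of_forall fun p => hC p)

/-- Weighted window averages are dominated uniformly in the width of the window. -/
lemma abs_average_le (hL : RegularLevy L P) {c : ℝ}
    (hc : ∀ n : ℕ, ((n : ℝ) + 1) * ∫ ω, (1 - Real.exp (-L (mesh n) ω)) ∂P ≤ c)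
    (x t : ℝ) (n : ℕ) {f : ℝ × Ω → ℝ}
    (hf : Measurable f) {C : ℝ} (hC : ∀ p, |f p| ≤ C)
    (hI : ∀ s, t < s → IndepFun (fun ω => f (s, ω)) (fun ω => L (s + mesh n) ω - L s ω) P) :
    |((n : ℝ) + 1) * ∫ p in crossing L x (mesh n),
      belowWeight x t (p.1, L p.1 p.2) * f p ∂(volume.prod P)| ≤
      c * ∫ p, timeWeight t p.1 * |f p| ∂(volume.prod P) := by
  have hn : (0 : ℝ) ≤ (n : ℝ) + 1 := by positivity
  have hbm : Measurable (fun p : ℝ × Ω => belowWeight x t (p.1, L p.1 p.2)) :=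
    (continuous_belowWeight x t).measurable.comp (measurable_fst.prodMk hL.measurable_uncurry)
  have hfm : Measurable (fun p : ℝ × Ω => belowWeight x t (p.1, L p.1 p.2) * |(f p)|) :=
    hbm.mul hf.norm
  have hCabs : ∀ p : ℝ × Ω, |(belowWeight x t (p.1, L p.1 p.2) * |(f p)|)| ≤ C := by
    intro p
    rw [abs_mul, abs_abs, abs_of_nonneg (belowWeight_nonneg _ _ _)]
    exact (mul_le_of_le_one_left (abs_nonneg _) (belowWeight_le_one _ _ _)).trans (hC p)
  have hint := integrable_timeWeight_prod (P := P) t (f := fun p => |f p|) hf.norm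
    (C := C) (by simpa using hC)
  calc |((n : ℝ) + 1) * ∫ p in crossing L x (mesh n),
        belowWeight x t (p.1, L p.1 p.2) * f p ∂(volume.prod P)|
      ≤ ((n : ℝ) + 1) * ∫ p in crossing L x (mesh n),
        belowWeight x t (p.1, L p.1 p.2) * |f p| ∂(volume.prod P) := by
        rw [abs_mul, abs_of_nonneg hn]
        refine mul_le_mul_of_nonneg_left ((abs_integral_le_integral_abs).trans_eq ?_) hn
        refine integral_congr_ae (Eventually.of_forall fun p => ?_)
        dsimp only
        rw [abs_mul, abs_of_nonneg (belowWeight_nonneg _ _ _)]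
    _ = ∫ s, ((n : ℝ) + 1) * ∫ ω, (crossing L x (mesh n)).indicator
          (fun p => belowWeight x t (p.1, L p.1 p.2) * |f p|) (s, ω) ∂P := by
        rw [hL.setIntegral_crossing_eq_indicator x _ hfm hCabs, integral_const_mul]
    _ ≤ ∫ s, c * ∫ ω, timeWeight t s * |f (s, ω)| ∂P := by
        refine integral_mono_of_nonneg (Eventually.of_forall fun s => ?_)
          (hint.integral_prod_left.const_mul c) (Eventually.of_forall fun s => ?_)
        · refine mul_nonneg hn (integral_nonneg fun ω => Set.indicator_nonneg (fun p _ => ?_) _)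
          exact mul_nonneg (belowWeight_nonneg _ _ _) (abs_nonneg _)
        · dsimp only
          rcases le_or_gt s t with hst | hst
          · have hz : ∀ ω, (crossing L x (mesh n)).indicator
                (fun p => belowWeight x t (p.1, L p.1 p.2) * |f p|) (s, ω) = 0 := by
              intro ω
              simp [Set.indicator, belowWeight, timeWeight_of_le hst]
            simp [hz, timeWeight_of_le hst]
          · have hprod := (hI s hst).integral_fun_comp_mul_comp (f := fun a => |a|)
              (g := fun d => 1 - Real.exp (-d))
              (hf.comp measurable_prodMk_left).aemeasurable
              ((hL.measurable _).sub (hL.measurable _)).aemeasurable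
              (measurable_norm (α := ℝ)).aestronglyMeasurable
              (by fun_prop)
            rw [hL.integral_one_sub_exp_increment] at hprod
            have hpos : ∀ ω, 0 < L (s + mesh n) ω - L s ω := fun ω =>
              sub_pos.2 (hL.strictMono ω (by linarith [mesh_pos n]))
            have h1 : ∫ ω, (crossing L x (mesh n)).indicator
                (fun p => belowWeight x t (p.1, L p.1 p.2) * |f p|) (s, ω) ∂P ≤
                ∫ ω, timeWeight t s * (|f (s, ω)| *
                  (1 - Real.exp (-(L (s + mesh n) ω - L s ω)))) ∂P := by
              refine integral_mono_of_nonneg (Eventually.of_forall fun ω =>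
                Set.indicator_nonneg (fun p _ =>
                  mul_nonneg (belowWeight_nonneg _ _ _) (abs_nonneg _)) _) ?_
                (Eventually.of_forall fun ω => ?_)
              · refine Integrable.const_mul (Integrable.of_bound (C := C)
                  (Measurable.aestronglyMeasurable ?_) (Eventually.of_forall fun ω => ?_)) _
                · exact (hf.comp measurable_prodMk_left).norm.mul
                    (measurable_const.sub (((hL.measurable _).sub (hL.measurable _)).neg.exp))
                · rw [norm_mul, Real.norm_eq_abs, abs_abs, Real.norm_of_nonneg (one_sub_exp_nonneg (hpos ω).le)]
                  refine (mul_le_of_le_one_right (abs_nonneg _) ?_).trans (hC _)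
                  linarith [Real.exp_pos (-(L (s + mesh n) ω - L s ω))]
              · refine Set.indicator_apply_le' (fun hp => ?_) (fun _ => ?_)
                · obtain ⟨hp1, hp2⟩ := hp
                  dsimp only at hp1 hp2
                  -- To cross the level, the increment must exceed the remaining gap. The gap factor
                  -- of the weight is thus bounded by 1 - exp(-increment), which is independent of f
                  -- at time s and has mean at most c / (n + 1).
                  have hle : max 0 (x - L s ω) ≤ L (s + mesh n) ω - L s ω :=
                    max_le (hpos ω).le (by linarith)
                  have := Real.exp_le_exp.2 (neg_le_neg hle)
                  unfold belowWeight
                  dsimp only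
                  rw [mul_assoc, mul_comm (|f (s, ω)|)]
                  exact mul_le_mul_of_nonneg_left (mul_le_mul_of_nonneg_right (by linarith)
                    (abs_nonneg _)) (timeWeight_nonneg _ _)
                · exact mul_nonneg (timeWeight_nonneg _ _) (mul_nonneg (abs_nonneg _)
                    (one_sub_exp_nonneg (hpos ω).le))
            rw [integral_const_mul, hprod] at h1
            rw [integral_const_mul]
            have hE : 0 ≤ ∫ ω, |f (s, ω)| ∂P := integral_nonneg fun ω => abs_nonneg _
            calc _ ≤ ((n : ℝ) + 1) * (timeWeight t s * ((∫ ω, |f (s, ω)| ∂P) *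
                    ∫ ω, (1 - Real.exp (-L (mesh n) ω)) ∂P)) := mul_le_mul_of_nonneg_left h1 hn
              _ = (((n : ℝ) + 1) * ∫ ω, (1 - Real.exp (-L (mesh n) ω)) ∂P) *
                    (timeWeight t s * ∫ ω, |f (s, ω)| ∂P) := by ring
              _ ≤ _ := mul_le_mul_of_nonneg_right (hc n) (mul_nonneg (timeWeight_nonneg _ _) hE)
    _ = c * ∫ p, timeWeight t p.1 * |f p| ∂(volume.prod P) := by
        rw [integral_const_mul, integral_prod _ hint]

end RegularLevy
end LevyChar

/-! ### From continuous to measurable test functions -/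

namespace LevyChar
namespace RegularLevy

variable {Ω : Type*} [MeasurableSpace Ω] {P : Measure Ω} {L : ℝ → Ω → ℝ}
  [IsProbabilityMeasure P]

lemma integrableOn_belowWeight (hL : RegularLevy L P) (x t ε : ℝ) {f : ℝ × Ω → ℝ}
    (hf : Measurable f) {C : ℝ} (hC : ∀ p, |f p| ≤ C) :
    IntegrableOn (fun p => belowWeight x t (p.1, L p.1 p.2) * f p) (crossing L x ε)
      (volume.prod P) := by
  have hbm : Measurable (fun p : ℝ × Ω => belowWeight x t (p.1, L p.1 p.2)) :=
    (continuous_belowWeight x t).measurable.comp (measurable_fst.prodMk hL.measurable_uncurry)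
  refine hL.integrableOn_crossing x ε (hbm.mul hf) (C := C) fun p => ?_
  rw [abs_mul, abs_of_nonneg (belowWeight_nonneg _ _ _)]
  exact (mul_le_of_le_one_left (abs_nonneg _) (belowWeight_le_one _ _ _)).trans (hC p)

lemma average_sub (hL : RegularLevy L P) (x t : ℝ) (n : ℕ) {f g : ℝ × Ω → ℝ}
    (hf : Measurable f) {C : ℝ} (hC : ∀ p, |f p| ≤ C) (hg : Measurable g) {C' : ℝ}
    (hC' : ∀ p, |g p| ≤ C') :
    ((n : ℝ) + 1) * ∫ p in crossing L x (mesh n),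
        belowWeight x t (p.1, L p.1 p.2) * f p ∂(volume.prod P) -
      ((n : ℝ) + 1) * ∫ p in crossing L x (mesh n),
        belowWeight x t (p.1, L p.1 p.2) * g p ∂(volume.prod P) =
      ((n : ℝ) + 1) * ∫ p in crossing L x (mesh n),
        belowWeight x t (p.1, L p.1 p.2) * (f p - g p) ∂(volume.prod P) := by
  rw [← mul_sub, ← integral_sub (hL.integrableOn_belowWeight x t _ hf hC)
    (hL.integrableOn_belowWeight x t _ hg hC')]
  simp only [mul_sub]

/-- The averaging limit below the level extends to bounded measurable functions of the hitting
time and the undershoot. -/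
lemma tendsto_average_measurable (hL : RegularLevy L P) (x : ℝ) {t : ℝ} (ht : 0 ≤ t)
    {q : ℝ × ℝ → ℝ} (hq : Measurable q) {C : ℝ} (hC : ∀ z, |q z| ≤ C) :
    Tendsto (fun n : ℕ => ((n : ℝ) + 1) * ∫ p in crossing L x (mesh n),
      belowWeight x t (p.1, L p.1 p.2) * q (p.1, L p.1 p.2) ∂(volume.prod P)) atTop
      (𝓝 (∫ ω, belowWeight x t (hit L x ω, undershoot L x ω) *
        q (hit L x ω, undershoot L x ω) ∂P)) := by
  obtain ⟨c, hc0, hc⟩ := hL.exists_nonneg_laplace_bound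
  set Z := fun ω => (hit L x ω, undershoot L x ω) with hZ
  have hZm : Measurable Z := hL.measurable_hitPair x
  set Y := fun p : ℝ × Ω => (p.1, L p.1 p.2) with hY
  have hYm : Measurable Y := measurable_fst.prodMk hL.measurable_uncurry
  have hwm : Measurable (fun p : ℝ × Ω => ENNReal.ofReal (timeWeight t p.1)) :=
    ((continuous_timeWeight t).measurable.comp measurable_fst).ennreal_ofReal
  have hwint : Integrable (fun p : ℝ × Ω => timeWeight t p.1) (volume.prod P) :=
    (integrable_timeWeight t).comp_fst P
  set μ₀ := (volume.prod P).withDensity (fun p => ENNReal.ofReal (timeWeight t p.1)) with hμ₀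
  have : IsFiniteMeasure μ₀ := isFiniteMeasure_withDensity_ofReal hwint.2
  -- One continuous approximation must be good for both the window averages, controlled by the
  -- weighted law of (s, L(s)), and their limit, controlled by the law of the hitting pair; hence
  -- the sum of the two measures.
  set μ := μ₀.map Y + P.map Z with hμ
  have hqi : Integrable q μ := Integrable.of_bound hq.aestronglyMeasurable C
    (Eventually.of_forall hC)
  rw [Metric.tendsto_nhds]
  intro ε hε
  obtain ⟨q', hq', -⟩ := hqi.exists_boundedContinuous_integral_sub_le
    (show 0 < ε / (c + 3) by positivity)
  -- The errors are c η for the averages, η for the continuous limit and η for the limiting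
  -- integrals, together less than (c + 3) η.
  set η := ε / (c + 3) with hη
  have hηpos : 0 < η := by positivity
  have hq'm : Measurable q' := q'.continuous.measurable
  have hd : Measurable (fun z => ‖q z - q' z‖) := (hq.sub hq'm).norm
  have hdi : ∀ (ν : Measure (ℝ × ℝ)) [IsFiniteMeasure ν], Integrable (fun z => ‖q z - q' z‖) ν :=
    fun ν _ => Integrable.of_bound hd.aestronglyMeasurable (C + ‖q'‖)
      (Eventually.of_forall fun z => by
        rw [norm_norm]
        exact (norm_sub_le _ _).trans (add_le_add (hC z) (q'.norm_coe_le_norm z)))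
  rw [hμ, integral_add_measure (hdi _) (hdi _)] at hq'
  have hn1 : 0 ≤ ∫ z, ‖q z - q' z‖ ∂(μ₀.map Y) := integral_nonneg fun _ => norm_nonneg _
  have hn2 : 0 ≤ ∫ z, ‖q z - q' z‖ ∂(P.map Z) := integral_nonneg fun _ => norm_nonneg _
  have e1 : ∫ z, ‖q z - q' z‖ ∂(μ₀.map Y) =
      ∫ p, timeWeight t p.1 * |(q (Y p) - q' (Y p))| ∂(volume.prod P) := by
    rw [integral_map hYm.aemeasurable hd.aestronglyMeasurable, hμ₀,
      integral_withDensity_eq_integral_toReal_smul hwm (by simp)]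
    simp only [ENNReal.toReal_ofReal (timeWeight_nonneg _ _), smul_eq_mul, Real.norm_eq_abs]
  have e2 : ∫ z, ‖q z - q' z‖ ∂(P.map Z) = ∫ ω, ‖q (Z ω) - q' (Z ω)‖ ∂P :=
    integral_map hZm.aemeasurable hd.aestronglyMeasurable
  have hcont := hL.tendsto_average x t (F := fun r => belowWeight x t (r.1, r.2.2.1) *
    q' (r.1, r.2.2.1)) (C := ‖q'‖)
    (((continuous_belowWeight x t).comp (by fun_prop)).mul (q'.continuous.comp (by fun_prop)))
    (fun r => by
      rw [abs_mul, abs_of_nonneg (belowWeight_nonneg _ _ _)]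
      exact (mul_le_of_le_one_left (abs_nonneg _) (belowWeight_le_one _ _ _)).trans
        (q'.norm_coe_le_norm _))
  have hev := (Metric.tendsto_nhds.1 hcont) η hηpos
  filter_upwards [hev] with n hn
  rw [Real.dist_eq] at hn ⊢
  have hIq : ∀ f : ℝ × ℝ → ℝ, Measurable f → ∀ D : ℝ, (∀ z, |f z| ≤ D) →
      Integrable (fun ω => belowWeight x t (Z ω) * f (Z ω)) P := by
    intro f hf D hD
    refine Integrable.of_bound ((((continuous_belowWeight x t).measurable.comp hZm).mul
      (hf.comp hZm))).aestronglyMeasurable D (Eventually.of_forall fun ω => ?_)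
    rw [norm_mul, Real.norm_of_nonneg (belowWeight_nonneg _ _ _)]
    exact (mul_le_of_le_one_left (norm_nonneg _) (belowWeight_le_one _ _ _)).trans (hD _)
  have b1 := hL.abs_average_le hc x t n (f := fun p => q (Y p) - q' (Y p))
    ((hq.comp hYm).sub (hq'm.comp hYm)) (C := C + ‖q'‖)
    (fun p => (abs_sub _ _).trans (add_le_add (hC _) (q'.norm_coe_le_norm _)))
    (fun s hs => by
      have hI := hL.indepFun_past (a := 0) (b := 0) (s := s) (s' := s + mesh n) le_rfl le_rfl
        (by linarith) (by linarith [mesh_pos n])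
      exact hI.comp (φ := fun v => q (s, v.2.2) - q' (s, v.2.2)) (ψ := id)
        ((hq.comp (by fun_prop)).sub (hq'm.comp (by fun_prop))) measurable_id)
  have hsub := hL.average_sub x t n (f := fun p => q (Y p)) (g := fun p => q' (Y p))
    (hq.comp hYm) (fun p => hC _) (hq'm.comp hYm) (fun p => q'.norm_coe_le_norm _)
  rw [← hsub, ← e1] at b1
  have b2 : |(∫ ω, belowWeight x t (Z ω) * q' (Z ω) ∂P) -
      ∫ ω, belowWeight x t (Z ω) * q (Z ω) ∂P| ≤ ∫ ω, ‖q (Z ω) - q' (Z ω)‖ ∂P := by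
    rw [← integral_sub (hIq _ hq'm _ q'.norm_coe_le_norm) (hIq _ hq _ hC)]
    refine (abs_integral_le_integral_abs).trans (integral_mono_of_nonneg
      (Eventually.of_forall fun _ => abs_nonneg _) ((hdi _).comp_measurable hZm)
      (Eventually.of_forall fun ω => ?_))
    dsimp only
    rw [← mul_sub, abs_mul, abs_of_nonneg (belowWeight_nonneg _ _ _), abs_sub_comm,
      Real.norm_eq_abs]
    exact mul_le_of_le_one_left (abs_nonneg _) (belowWeight_le_one _ _ _)
  rw [← e2] at b2
  simp only [hY] at b1
  have h3 : c * ∫ z, ‖q z - q' z‖ ∂(μ₀.map Y) ≤ c * η :=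
    mul_le_mul_of_nonneg_left (by linarith) hc0
  have h4 : (c + 3) * η = ε := by rw [hη]; field_simp
  rw [abs_le] at b1 b2
  rw [abs_lt] at hn ⊢
  constructor <;> nlinarith

end RegularLevy
end LevyChar

/-! ### Jumping over the level: the bridge law -/

namespace LevyChar

/-- The bridge kernel `(s, y) ↦ K (s - t, s, y)`. -/
noncomputable def bridgeAt (K : Kernel (ℝ × ℝ × ℝ) ℝ) (t : ℝ) : Kernel (ℝ × ℝ) ℝ :=
  K.comap (fun z => (z.1 - t, z.1, z.2)) (by fun_prop)

lemma bridgeAt_apply (K : Kernel (ℝ × ℝ × ℝ) ℝ) (t : ℝ) (z : ℝ × ℝ) :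
    bridgeAt K t z = K (z.1 - t, z.1, z.2) := rfl

lemma isMarkovKernel_bridgeAt (K : Kernel (ℝ × ℝ × ℝ) ℝ) [IsMarkovKernel K] (t : ℝ) :
    IsMarkovKernel (bridgeAt K t) := by
  unfold bridgeAt; infer_instance

section KernelIntegral

variable {α : Type*} [MeasurableSpace α] (κ : Kernel α ℝ) [IsMarkovKernel κ] (g : ℝ →ᵇ ℝ)

lemma measurable_kernel_integral : Measurable (fun z => ∫ w, g w ∂(κ z)) :=
  (StronglyMeasurable.integral_kernel_prod_right' (κ := κ) (f := fun p : α × ℝ => g p.2)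
    (g.continuous.measurable.comp measurable_snd).stronglyMeasurable).measurable

lemma abs_kernel_integral_le (z : α) : |∫ w, g w ∂(κ z)| ≤ ‖g‖ := by
  have := norm_integral_le_of_norm_le_const (μ := κ z) (f := g) (C := ‖g‖)
    (Eventually.of_forall fun w => g.norm_coe_le_norm _)
  simpa using this

end KernelIntegral

namespace RegularLevy

variable {Ω : Type*} [MeasurableSpace Ω] {P : Measure Ω} {L : ℝ → Ω → ℝ}
  [IsProbabilityMeasure P]

/-- In a window average, the value of the path a time `t` earlier may be replaced by its bridge
expectation. -/
lemma average_bridge (hL : RegularLevy L P) {K : Kernel (ℝ × ℝ × ℝ) ℝ} (hK : IsLevyBridge L P K)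
    (x : ℝ) {t : ℝ} (ht : 0 < t) (n : ℕ) (φ : ℝ × ℝ →ᵇ ℝ) (g : ℝ →ᵇ ℝ) :
    ∫ p in crossing L x (mesh n), belowWeight x t (p.1, L p.1 p.2) *
      (φ (p.1, L p.1 p.2) * g (L (p.1 - t) p.2)) ∂(volume.prod P) =
    ∫ p in crossing L x (mesh n), belowWeight x t (p.1, L p.1 p.2) *
      (φ (p.1, L p.1 p.2) * ∫ w, g w ∂(bridgeAt K t (p.1, L p.1 p.2))) ∂(volume.prod P) := by
  have := hK.markov
  have := isMarkovKernel_bridgeAt K t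
  set k : ℝ × ℝ → ℝ := fun z => ∫ w, g w ∂(bridgeAt K t z) with hk
  have hkm : Measurable k := measurable_kernel_integral _ g
  have hkC : ∀ z, |k z| ≤ ‖g‖ := abs_kernel_integral_le _ g
  have hYm : Measurable (fun p : ℝ × Ω => (p.1, L p.1 p.2)) :=
    measurable_fst.prodMk hL.measurable_uncurry
  have hbm : Measurable (belowWeight x t) := (continuous_belowWeight x t).measurable
  have hφm : Measurable φ := φ.continuous.measurable
  have hgm : Measurable g := g.continuous.measurable
  have hLt : Measurable (fun p : ℝ × Ω => L (p.1 - t) p.2) := hL.measurable_apply_add (-t)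
  have hbd : ∀ (z z' : ℝ × ℝ) (d : ℝ), |d| ≤ ‖g‖ → |belowWeight x t z * (φ z' * d)| ≤ ‖φ‖ * ‖g‖ := by
    intro z z' d hd
    rw [abs_mul, abs_of_nonneg (belowWeight_nonneg _ _ _), abs_mul]
    exact (mul_le_of_le_one_left (by positivity) (belowWeight_le_one _ _ _)).trans
      (mul_le_mul (φ.norm_coe_le_norm _) hd (abs_nonneg _) (norm_nonneg _))
  have m1 : Measurable (fun p : ℝ × Ω => belowWeight x t (p.1, L p.1 p.2) *
      (φ (p.1, L p.1 p.2) * g (L (p.1 - t) p.2))) :=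
    (hbm.comp hYm).mul ((hφm.comp hYm).mul (hgm.comp hLt))
  have m2 : Measurable (fun p : ℝ × Ω => belowWeight x t (p.1, L p.1 p.2) *
      (φ (p.1, L p.1 p.2) * k (p.1, L p.1 p.2))) :=
    (hbm.comp hYm).mul ((hφm.comp hYm).mul (hkm.comp hYm))
  rw [hL.setIntegral_crossing_eq_indicator x _ m1 (fun p => hbd _ _ _ (g.norm_coe_le_norm _)),
    hL.setIntegral_crossing_eq_indicator x _ m2 (fun p => hbd _ _ _ (hkC _))]
  refine integral_congr_ae (Eventually.of_forall fun s => ?_)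
  dsimp only
  rcases le_or_gt s t with hst | hst
  · simp [Set.indicator, belowWeight, timeWeight_of_le hst]
  have hI := (hL.indepFun_past (a := s - t) (b := s - t) (s := s) (s' := s + mesh n)
    (by linarith) le_rfl (by linarith) (by linarith [mesh_pos n])).comp
    (φ := fun v : ℝ × ℝ × ℝ => v.2) (ψ := id) measurable_snd measurable_id
  have hXm : Measurable (fun ω => (L (s - t) ω, L s ω)) :=
    (hL.measurable _).prodMk (hL.measurable _)
  have hDm : Measurable (fun ω => L (s + mesh n) ω - L s ω) :=
    (hL.measurable _).sub (hL.measurable _)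
  set S : Set (ℝ × ℝ) := {q | q.1 < x ∧ x ≤ q.1 + q.2} with hS
  have hSm : MeasurableSet S := (measurableSet_lt measurable_fst measurable_const).inter
    (measurableSet_le measurable_const (measurable_fst.add measurable_snd))
  set Θ : ℝ × ℝ → ℝ := S.indicator (fun q => belowWeight x t (s, q.1) * φ (s, q.1)) with hΘ
  have hΘm : Measurable Θ := by
    refine Measurable.indicator (Measurable.mul ?_ ?_) hSm
    · exact hbm.comp (f := fun q : ℝ × ℝ => (s, q.1)) (by fun_prop)
    · exact hφm.comp (f := fun q : ℝ × ℝ => (s, q.1)) (by fun_prop)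
  have hΘC : ∀ q, |Θ q| ≤ ‖φ‖ := by
    intro q
    rw [hΘ, ← Real.norm_eq_abs]
    refine (norm_indicator_le_norm_self _ _).trans ?_
    rw [norm_mul, Real.norm_of_nonneg (belowWeight_nonneg _ _ _)]
    exact (mul_le_of_le_one_left (norm_nonneg _) (belowWeight_le_one _ _ _)).trans
      (φ.norm_coe_le_norm _)
  have hΘbd : ∀ (q : ℝ × ℝ) (d : ℝ), |d| ≤ ‖g‖ → |Θ q * d| ≤ ‖φ‖ * ‖g‖ := by
    intro q d hd
    rw [abs_mul]
    exact mul_le_mul (hΘC q) hd (abs_nonneg _) (norm_nonneg _)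
  have hcr : ∀ ω, ((s, ω) ∈ crossing L x (mesh n) ↔ (L s ω, L (s + mesh n) ω - L s ω) ∈ S) := by
    intro ω; simp [crossing, hS]
  have key : ∀ (v : Ω → ℝ) (f : ℝ × Ω → ℝ), (∀ ω, f (s, ω) =
      belowWeight x t (s, L s ω) * (φ (s, L s ω) * v ω)) → ∀ ω,
      (crossing L x (mesh n)).indicator f (s, ω) =
        Θ (L s ω, L (s + mesh n) ω - L s ω) * v ω := by
    intro v f hf ω
    by_cases h : (s, ω) ∈ crossing L x (mesh n)
    · rw [Set.indicator_of_mem h, hΘ, Set.indicator_of_mem ((hcr ω).1 h), hf]; ring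
    · rw [Set.indicator_of_notMem h, hΘ, Set.indicator_of_notMem (fun h' => h ((hcr ω).2 h')),
        zero_mul]
  rw [integral_congr_ae (Eventually.of_forall (key (fun ω => g (L (s - t) ω)) _ fun ω => rfl)),
    integral_congr_ae (Eventually.of_forall (key (fun ω => k (s, L s ω)) _ fun ω => rfl))]
  -- Once the increment d across the window is frozen, the crossing indicator and the weights are
  -- functions of L(s) only, so the defining property of the bridge applies for each d.
  have r1 := indepFun_integral_eq hXm hDm hI (C := ‖φ‖ * ‖g‖)
    (f := fun p : (ℝ × ℝ) × ℝ => Θ (p.1.2, p.2) * g p.1.1)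
    ((hΘm.comp (by fun_prop)).mul (hgm.comp (by fun_prop)))
    (fun p => hΘbd _ _ (g.norm_coe_le_norm _))
  have r2 := indepFun_integral_eq hXm hDm hI (C := ‖φ‖ * ‖g‖)
    (f := fun p : (ℝ × ℝ) × ℝ => Θ (p.1.2, p.2) * k (s, p.1.2))
    ((hΘm.comp (by fun_prop)).mul (hkm.comp (by fun_prop)))
    (fun p => hΘbd _ _ (hkC _))
  dsimp only at r1 r2
  rw [r1, r2]
  refine integral_congr_ae (Eventually.of_forall fun d => ?_)
  exact hL.integral_bridge hK (r := s - t) (s := s) (by linarith) (by linarith)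
    (h := fun y => Θ (y, d)) (hΘm.comp (by fun_prop)) (fun y => hΘC _) g

/-- Shifting the earlier time by the width of the window does not change the limit of the window
averages. -/
lemma tendsto_average_shift (hL : RegularLevy L P) (x : ℝ) {t : ℝ} (ht : 0 < t)
    (φ : ℝ × ℝ →ᵇ ℝ) (g : ℝ →ᵇ ℝ) :
    Tendsto (fun n : ℕ => ((n : ℝ) + 1) * ∫ p in crossing L x (mesh n),
        belowWeight x t (p.1, L p.1 p.2) *
          (φ (p.1, L p.1 p.2) * g (L (p.1 + mesh n - t) p.2)) ∂(volume.prod P) -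
      ((n : ℝ) + 1) * ∫ p in crossing L x (mesh n), belowWeight x t (p.1, L p.1 p.2) *
        (φ (p.1, L p.1 p.2) * g (L (p.1 - t) p.2)) ∂(volume.prod P)) atTop (𝓝 0) := by
  obtain ⟨c, hc0, hc⟩ := hL.exists_nonneg_laplace_bound
  have hYm : Measurable (fun p : ℝ × Ω => (p.1, L p.1 p.2)) :=
    measurable_fst.prodMk hL.measurable_uncurry
  have hφm : Measurable φ := φ.continuous.measurable
  have hgm : Measurable g := g.continuous.measurable
  have hLt : Measurable (fun p : ℝ × Ω => L (p.1 - t) p.2) := hL.measurable_apply_add (-t)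
  have hLn : ∀ n, Measurable (fun p : ℝ × Ω => L (p.1 + mesh n - t) p.2) := fun n => by
    have := hL.measurable_apply_add (mesh n - t)
    simpa only [← add_sub_assoc] using this
  have hbd : ∀ (z : ℝ × ℝ) (d : ℝ), |(φ z * g d)| ≤ ‖φ‖ * ‖g‖ := by
    intro z d
    rw [abs_mul]
    exact mul_le_mul (φ.norm_coe_le_norm _) (g.norm_coe_le_norm _) (abs_nonneg _) (norm_nonneg _)
  have hbd2 : ∀ (z : ℝ × ℝ) (d d' : ℝ), |φ z * g d - φ z * g d'| ≤ 2 * (‖φ‖ * ‖g‖) := by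
    intro z d d'
    have h1 := hbd z d
    have h2 := hbd z d'
    exact (abs_sub _ _).trans (by linarith)
  set f : ℕ → ℝ × Ω → ℝ := fun n p => φ (p.1, L p.1 p.2) * g (L (p.1 + mesh n - t) p.2) -
    φ (p.1, L p.1 p.2) * g (L (p.1 - t) p.2) with hf
  have hfm : ∀ n, Measurable (f n) := fun n =>
    ((hφm.comp hYm).mul (hgm.comp (hLn n))).sub ((hφm.comp hYm).mul (hgm.comp hLt))
  have hlim : Tendsto (fun n => c * ∫ p, timeWeight t p.1 * |f n p| ∂(volume.prod P)) atTop
      (𝓝 0) := by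
    have h0 : (0 : ℝ) = c * ∫ p : ℝ × Ω, (0 : ℝ) ∂(volume.prod P) := by simp
    rw [h0]
    refine Tendsto.const_mul c (tendsto_integral_of_dominated_convergence
      (fun p => timeWeight t p.1 * (2 * (‖φ‖ * ‖g‖))) ?_ ?_ ?_ ?_)
    · exact fun n => (((continuous_timeWeight t).measurable.comp measurable_fst).mul
        (hfm n).norm).aestronglyMeasurable
    · exact ((integrable_timeWeight t).comp_fst P).mul_const _
    · intro n
      refine Eventually.of_forall fun p => ?_
      rw [norm_mul, Real.norm_of_nonneg (timeWeight_nonneg _ _), Real.norm_eq_abs, abs_abs]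
      exact mul_le_mul_of_nonneg_left (hbd2 _ _ _) (timeWeight_nonneg _ _)
    · refine Eventually.of_forall fun p => ?_
      have h1 : Tendsto (fun n => p.1 + mesh n - t) atTop (𝓝[≥] (p.1 - t)) := by
        refine tendsto_nhdsWithin_iff.2 ⟨?_, Eventually.of_forall fun n => ?_⟩
        · simpa using (tendsto_const_nhds.add tendsto_mesh).sub_const t
        · simp only [Set.mem_Ici]; linarith [mesh_pos n]
      have h2 : Tendsto (fun n => L (p.1 + mesh n - t) p.2) atTop (𝓝 (L (p.1 - t) p.2)) :=
        Tendsto.comp (hL.rightCont p.2 (p.1 - t)) h1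
      have h3 := ((((g.continuous.tendsto _).comp h2).const_mul (φ (p.1, L p.1 p.2))).sub_const
        (φ (p.1, L p.1 p.2) * g (L (p.1 - t) p.2))).abs.const_mul (timeWeight t p.1)
      simpa using h3
  refine squeeze_zero_norm' ?_ hlim
  -- For `mesh n` < t the shifted earlier time still precedes s, so the difference is independent of
  -- the increment across the window.
  filter_upwards [tendsto_mesh.eventually (gt_mem_nhds ht)] with n hn
  rw [hL.average_sub x t n (f := fun p => φ (p.1, L p.1 p.2) * g (L (p.1 + mesh n - t) p.2))
    (g := fun p => φ (p.1, L p.1 p.2) * g (L (p.1 - t) p.2))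
    ((hφm.comp hYm).mul (hgm.comp (hLn n))) (fun p => hbd _ _)
    ((hφm.comp hYm).mul (hgm.comp hLt)) (fun p => hbd _ _)]
  refine hL.abs_average_le hc x t n (hfm n) (fun p => hbd2 _ _ _) fun s hs => ?_
  have hd := mesh_pos n
  have hI := hL.indepFun_past (a := s - t) (b := s + mesh n - t) (s := s) (s' := s + mesh n)
    (by linarith) (by linarith) (by linarith) (by linarith)
  have hw1 : Measurable (fun v : ℝ × ℝ × ℝ => φ (s, v.2.2)) := hφm.comp (by fun_prop)
  exact hI.comp (φ := fun v => φ (s, v.2.2) * g v.2.1 - φ (s, v.2.2) * g v.1) (ψ := id)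
    ((hw1.mul (hgm.comp (by fun_prop))).sub (hw1.mul (hgm.comp (by fun_prop)))) measurable_id

/-- Where the level is jumped over, the conditional law is the bridge law. -/
lemma condLaw_of_undershoot_lt (hL : RegularLevy L P) {K : Kernel (ℝ × ℝ × ℝ) ℝ}
    (hK : IsLevyBridge L P K) (x : ℝ) {t : ℝ} (ht : 0 < t) :
    ∀ᵐ p ∂(hitUnderLaw L P x), t ≤ p.1 → p.2 < x →
      condLaw L P x t p = K (p.1 - t, p.1, p.2) := by
  have := hK.markov
  have := isMarkovKernel_bridgeAt K t
  have key := condDistrib_ae_eq_of_integral_eq (hL.measurable_hitPair x)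
    (hL.measurable_charBase x t) (continuous_belowWeight x t).measurable
    (belowWeight_nonneg x t) (belowWeight_le_one x t) (bridgeAt K t) (P := P) ?_
  -- The weight vanishes at hitting time t, which the claim includes. This costs nothing: hitting
  -- the level at a fixed time almost surely means creeping.
  · have hne : ∀ᵐ p ∂(hitUnderLaw L P x), p.1 = t → p.2 = x := by
      have hm : MeasurableSet {p : ℝ × ℝ | p.1 = t → p.2 = x} := by
        have : {p : ℝ × ℝ | p.1 = t → p.2 = x} = {p | p.1 = t}ᶜ ∪ {p | p.2 = x} := by
          ext p; exact imp_iff_not_or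
        rw [this]
        exact (measurableSet_eq_fun measurable_fst measurable_const).compl.union
          (measurableSet_eq_fun measurable_snd measurable_const)
      rw [hitUnderLaw, ae_map_iff (hL.measurable_hitPair x).aemeasurable hm]
      filter_upwards [hL.hit_eq_iff_ae t] with ω hω h
      exact ((hω x).1 h).1
    filter_upwards [key, hne] with p hp hpne htp hpx
    rw [condLaw, hp, bridgeAt_apply]
    exact belowWeight_pos (lt_of_le_of_ne htp fun h => hpx.ne (hpne h.symm)) hpx
  intro φ g
  set k : ℝ × ℝ → ℝ := fun z => ∫ w, g w ∂(bridgeAt K t z) with hk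
  have hA := hL.tendsto_average x t (C := ‖φ‖ * ‖g‖)
    (F := fun r => belowWeight x t (r.1, r.2.2.1) * (φ (r.1, r.2.2.1) * g r.2.2.2))
    (((continuous_belowWeight x t).comp (by fun_prop)).mul
      ((φ.continuous.comp (by fun_prop)).mul (g.continuous.comp (by fun_prop))))
    (fun r => by
      rw [abs_mul, abs_of_nonneg (belowWeight_nonneg _ _ _), abs_mul]
      exact (mul_le_of_le_one_left (by positivity) (belowWeight_le_one _ _ _)).trans
        (mul_le_mul (φ.norm_coe_le_norm _) (g.norm_coe_le_norm _) (abs_nonneg _) (norm_nonneg _)))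
  have hC := hL.tendsto_average_measurable x ht.le (q := fun z => φ z * k z) (C := ‖φ‖ * ‖g‖)
    (φ.continuous.measurable.mul (measurable_kernel_integral _ g))
    (fun z => by
      rw [abs_mul]
      exact mul_le_mul (φ.norm_coe_le_norm _) (abs_kernel_integral_le _ g z) (abs_nonneg _)
        (norm_nonneg _))
  -- The averaging limit reads the path at s + `mesh n` - t, while the bridge identity is about s -
  -- t; the shift reconciles them.
  have hAB := hL.tendsto_average_shift x ht φ g
  simp only [hL.average_bridge hK x ht _ φ g] at hAB
  have hlim := tendsto_nhds_unique (hA.sub hC) hAB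
  have e := sub_eq_zero.1 hlim
  simp only [mul_left_comm _ (φ _), ← mul_assoc] at e ⊢
  exact e

end RegularLevy
end LevyChar

/-! ### Integration over levels with a cutoff near creeping -/

namespace LevyChar

/-- A weight on pairs `(s, y)`, positive exactly after time `t` and square-decaying in `y`. -/
noncomputable def levelWeight (t : ℝ) (z : ℝ × ℝ) : ℝ := timeWeight t z.1 * (1 + z.2 ^ 2)⁻¹

/-- A continuous cutoff shrinking to the indicator of the origin. -/
noncomputable def bump (m : ℕ) (v : ℝ) : ℝ := max 0 (1 - ((m : ℝ) + 1) * |v|)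

section LevelWeight

variable (t : ℝ) (z : ℝ × ℝ) (m : ℕ) (v : ℝ)

lemma inv_one_add_sq_le_one : (1 + v ^ 2)⁻¹ ≤ 1 :=
  inv_le_one_of_one_le₀ (by nlinarith [sq_nonneg v])

lemma continuous_levelWeight : Continuous (levelWeight t) := by
  unfold levelWeight
  exact ((continuous_timeWeight t).comp continuous_fst).mul
    (Continuous.inv₀ (by fun_prop) fun z => by positivity)

lemma levelWeight_nonneg : 0 ≤ levelWeight t z :=
  mul_nonneg (timeWeight_nonneg _ _) (by positivity)

lemma levelWeight_le_inv : levelWeight t z ≤ (1 + z.2 ^ 2)⁻¹ :=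
  mul_le_of_le_one_left (by positivity) (timeWeight_le_one _ _)

lemma levelWeight_le_one : levelWeight t z ≤ 1 :=
  (levelWeight_le_inv t z).trans (inv_one_add_sq_le_one _)

lemma levelWeight_pos {t : ℝ} {z : ℝ × ℝ} (h : t < z.1) : 0 < levelWeight t z :=
  mul_pos (timeWeight_pos h) (by positivity)

lemma continuous_bump : Continuous (bump m) := by unfold bump; fun_prop

lemma bump_nonneg : 0 ≤ bump m v := le_max_left _ _

lemma bump_le_one : bump m v ≤ 1 :=
  max_le zero_le_one (by
    have : 0 ≤ ((m : ℝ) + 1) * |v| := by positivity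
    linarith)

lemma bump_of_one_le {v : ℝ} (h : 1 ≤ |v|) : bump m v = 0 := by
  refine max_eq_left ?_
  have : (0 : ℝ) ≤ (m : ℝ) * |v| := by positivity
  linarith

/-- The cutoff vanishes unless x and y differ by less than 1, and then decay in y is decay in x up
to the factor 3. This is the domination that allows integrating over all levels. -/
lemma levelWeight_mul_bump_le (x : ℝ) :
    levelWeight t z * bump m (x - z.2) ≤ 3 * (1 + x ^ 2)⁻¹ := by
  rcases le_or_gt 1 |x - z.2| with h | h
  · rw [bump_of_one_le m h, mul_zero]; positivity
  · refine (mul_le_of_le_one_right (levelWeight_nonneg _ _) (bump_le_one _ _)).trans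
      ((levelWeight_le_inv t z).trans ?_)
    rw [← div_eq_mul_inv, inv_eq_one_div, div_le_div_iff₀ (by positivity) (by positivity)]
    obtain ⟨h1, h2⟩ := abs_lt.1 h
    nlinarith [sq_nonneg (x - 2 * z.2)]

lemma integrable_bump : Integrable (bump m) := by
  refine (integrable_inv_one_add_sq.const_mul 2).mono' (continuous_bump m).aestronglyMeasurable
    (Eventually.of_forall fun v => ?_)
  rw [Real.norm_of_nonneg (bump_nonneg _ _)]
  rcases le_or_gt 1 |v| with h | h
  · rw [bump_of_one_le m h]; positivity
  · refine (bump_le_one _ _).trans ?_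
    rw [← div_eq_mul_inv, le_div_iff₀ (by positivity)]
    obtain ⟨h1, h2⟩ := abs_lt.1 h
    nlinarith

lemma tendsto_bump : Tendsto (fun m => bump m v) atTop (𝓝 (if v = 0 then 1 else 0)) := by
  split_ifs with h
  · simp [bump, h]
  · refine tendsto_const_nhds.congr' ?_
    obtain ⟨N, hN⟩ := exists_nat_gt |v|⁻¹
    filter_upwards [eventually_ge_atTop N] with m hm
    have hv : 0 < |v| := abs_pos.2 h
    have h1 : |v|⁻¹ < (m : ℝ) + 1 := hN.trans (by
      have : (N : ℝ) ≤ m := by exact_mod_cast hm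
      linarith)
    have h2 : 1 ≤ ((m : ℝ) + 1) * |v| := by
      have := mul_le_mul_of_nonneg_right h1.le hv.le
      rwa [inv_mul_cancel₀ hv.ne'] at this
    exact (max_eq_left (by linarith)).symm

/-- The mass of the cutoff on an initial interval. -/
noncomputable def bumpMass (d : ℝ) : ℝ := ∫ v in (0 : ℝ)..d, bump m v

lemma continuous_bumpMass : Continuous (bumpMass m) :=
  intervalIntegral.continuous_primitive (fun _ _ => (continuous_bump m).intervalIntegrable _ _) 0

lemma abs_bumpMass_le {d : ℝ} (hd : 0 ≤ d) : |bumpMass m d| ≤ ∫ v, bump m v := by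
  rw [bumpMass, intervalIntegral.integral_of_le hd, abs_of_nonneg
    (setIntegral_nonneg measurableSet_Ioc fun v _ => bump_nonneg m v)]
  exact setIntegral_le_integral (integrable_bump m) (Eventually.of_forall (bump_nonneg m))

end LevelWeight

lemma abs_level_integrand_le (t : ℝ) (m : ℕ) (φ : ℝ × ℝ →ᵇ ℝ) (g : ℝ →ᵇ ℝ) (x : ℝ) (z : ℝ × ℝ)
    (w : ℝ) :
    |levelWeight t z * bump m (x - z.2) * (φ z * g w)| ≤ 3 * (‖φ‖ * ‖g‖) * (1 + x ^ 2)⁻¹ := by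
  rw [abs_mul, abs_of_nonneg (mul_nonneg (levelWeight_nonneg _ _) (bump_nonneg _ _)), abs_mul]
  calc _ ≤ 3 * (1 + x ^ 2)⁻¹ * (‖φ‖ * ‖g‖) :=
        mul_le_mul (levelWeight_mul_bump_le t z m x) (mul_le_mul (φ.norm_coe_le_norm _)
          (g.norm_coe_le_norm _) (abs_nonneg _) (norm_nonneg _)) (by positivity) (by positivity)
    _ = _ := by ring

namespace RegularLevy

variable {Ω : Type*} [MeasurableSpace Ω] {P : Measure Ω} {L : ℝ → Ω → ℝ}

/-- The integrand of the level average, as a function of the level and of the window. -/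
noncomputable def levelIntegrand (L : ℝ → Ω → ℝ) (t : ℝ) (m n : ℕ) (φ : ℝ × ℝ →ᵇ ℝ)
    (g : ℝ →ᵇ ℝ) (q : ℝ × ℝ × Ω) : ℝ :=
  levelWeight t (q.2.1, L q.2.1 q.2.2) * bump m (q.1 - L q.2.1 q.2.2) *
    (φ (q.2.1, L q.2.1 q.2.2) * g (L (q.2.1 + mesh n - t) q.2.2))

lemma measurable_levelIntegrand (hL : RegularLevy L P) (t : ℝ) (m n : ℕ) (φ : ℝ × ℝ →ᵇ ℝ)
    (g : ℝ →ᵇ ℝ) : Measurable (levelIntegrand L t m n φ g) := by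
  have h1 : Measurable (fun q : ℝ × ℝ × Ω => L q.2.1 q.2.2) :=
    hL.measurable_uncurry.comp measurable_snd
  have h2 : Measurable (fun q : ℝ × ℝ × Ω => (q.2.1, L q.2.1 q.2.2)) :=
    (measurable_fst.comp measurable_snd).prodMk h1
  have h3 : Measurable (fun q : ℝ × ℝ × Ω => L (q.2.1 + mesh n - t) q.2.2) := by
    have := hL.measurable_apply_add (mesh n - t)
    simp only [← add_sub_assoc] at this
    exact this.comp measurable_snd
  exact (((continuous_levelWeight t).measurable.comp h2).mul
    ((continuous_bump m).measurable.comp (measurable_fst.sub h1))).mul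
    ((φ.continuous.measurable.comp h2).mul (g.continuous.measurable.comp h3))

lemma measurableSet_crossing_uncurry (hL : RegularLevy L P) (ε : ℝ) :
    MeasurableSet {q : ℝ × ℝ × Ω | q.2 ∈ crossing L q.1 ε} :=
  (measurableSet_lt (hL.measurable_uncurry.comp measurable_snd) measurable_fst).inter
    (measurableSet_le measurable_fst ((hL.measurable_apply_add ε).comp measurable_snd))

/-- The level integrand restricted to the windows in which the level is crossed. -/
noncomputable def crossedIntegrand (L : ℝ → Ω → ℝ) (t : ℝ) (m n : ℕ) (φ : ℝ × ℝ →ᵇ ℝ)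
    (g : ℝ →ᵇ ℝ) : ℝ × ℝ × Ω → ℝ :=
  {q : ℝ × ℝ × Ω | q.2 ∈ crossing L q.1 (mesh n)}.indicator (levelIntegrand L t m n φ g)

/-- For a fixed window the crossed levels fill the interval between the values at its ends, and the
level enters only through the cutoff. The level integral is therefore a function of the increment
alone. -/
lemma integral_crossedIntegrand (hL : RegularLevy L P) (t : ℝ) (m n : ℕ)
    (φ : ℝ × ℝ →ᵇ ℝ) (g : ℝ →ᵇ ℝ) (p : ℝ × Ω) :
    ∫ x, crossedIntegrand L t m n φ g (x, p) = levelWeight t (p.1, L p.1 p.2) *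
      (φ (p.1, L p.1 p.2) * g (L (p.1 + mesh n - t) p.2)) *
      bumpMass m (L (p.1 + mesh n) p.2 - L p.1 p.2) := by
  have hle : L p.1 p.2 ≤ L (p.1 + mesh n) p.2 :=
    (hL.strictMono p.2).monotone (by linarith [mesh_pos n])
  have e : ∀ x, crossedIntegrand L t m n φ g (x, p) = (Set.Ioc (L p.1 p.2) (L (p.1 + mesh n) p.2)).indicator
      (fun x => levelWeight t (p.1, L p.1 p.2) *
        (φ (p.1, L p.1 p.2) * g (L (p.1 + mesh n - t) p.2)) * bump m (x - L p.1 p.2)) x := by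
    intro x
    have hiff : (x, p) ∈ {q : ℝ × ℝ × Ω | q.2 ∈ crossing L q.1 (mesh n)} ↔
      x ∈ Set.Ioc (L p.1 p.2) (L (p.1 + mesh n) p.2) := Iff.rfl
    by_cases h : x ∈ Set.Ioc (L p.1 p.2) (L (p.1 + mesh n) p.2)
    · rw [crossedIntegrand, Set.indicator_of_mem (hiff.2 h), Set.indicator_of_mem h, levelIntegrand]; ring
    · rw [crossedIntegrand, Set.indicator_of_notMem (fun h' => h (hiff.1 h')), Set.indicator_of_notMem h]
  simp only [e]
  rw [integral_indicator measurableSet_Ioc, integral_const_mul,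
    ← intervalIntegral.integral_of_le hle, intervalIntegral.integral_comp_sub_right
      (fun v => bump m v), sub_self]
  rfl

/-- Independence splits off the increment and stationarity makes its factor free of s; `mesh n` < t
keeps the earlier value in the past of s. -/
lemma integral_window_mul_bumpMass (hL : RegularLevy L P) {t s : ℝ} (hst : t < s)
    (m n : ℕ) (φ : ℝ × ℝ →ᵇ ℝ) (g : ℝ →ᵇ ℝ) (hn : mesh n < t) :
    ∫ ω, levelWeight t (s, L s ω) * (φ (s, L s ω) * g (L (s + mesh n - t) ω)) *
      bumpMass m (L (s + mesh n) ω - L s ω) ∂P =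
    (∫ ω, bumpMass m (L (mesh n) ω) ∂P) *
      ∫ ω, levelWeight t (s, L s ω) * (φ (s, L s ω) * g (L (s + mesh n - t) ω)) ∂P := by
  have hd := mesh_pos n
  have hI := hL.indepFun_past (a := s + mesh n - t) (b := s + mesh n - t) (s := s) (s' := s + mesh n)
    (by linarith) le_rfl (by linarith) (by linarith)
  have hw1 : Measurable (fun v : ℝ × ℝ × ℝ => (s, v.2.2)) := by fun_prop
  have hf : Measurable (fun v : ℝ × ℝ × ℝ =>
      levelWeight t (s, v.2.2) * (φ (s, v.2.2) * g v.2.1)) :=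
    ((continuous_levelWeight t).measurable.comp hw1).mul
      ((φ.continuous.measurable.comp hw1).mul
        (g.continuous.measurable.comp (measurable_fst.comp measurable_snd)))
  have hb : Measurable (bumpMass m) := (continuous_bumpMass m).measurable
  have h1 := hI.integral_fun_comp_mul_comp (𝕜 := ℝ)
    ((hL.measurable _).prodMk ((hL.measurable _).prodMk (hL.measurable _))).aemeasurable
    ((hL.measurable _).sub (hL.measurable _)).aemeasurable
    hf.aestronglyMeasurable hb.aestronglyMeasurable
  have h2 : ∫ ω, bumpMass m (L (s + mesh n) ω - L s ω) ∂P = ∫ ω, bumpMass m (L (mesh n) ω) ∂P :=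
    ((hL.levy.stationary s (mesh n) hd.le).comp hb).integral_eq
  rw [h2] at h1
  exact h1.trans (mul_comm _ _)

variable [IsProbabilityMeasure P]

lemma stronglyMeasurable_level_average (hL : RegularLevy L P) (t : ℝ) (m n : ℕ)
    (φ : ℝ × ℝ →ᵇ ℝ) (g : ℝ →ᵇ ℝ) :
    StronglyMeasurable (fun x => ∫ p in crossing L x (mesh n),
      levelIntegrand L t m n φ g (x, p) ∂(volume.prod P)) := by
  have h := ((hL.measurable_levelIntegrand t m n φ g).indicator
    (hL.measurableSet_crossing_uncurry (mesh n))).stronglyMeasurable.integral_prod_right'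
    (ν := volume.prod P)
  convert! h using 2 with x
  rw [← integral_indicator (hL.measurableSet_crossing x _)]
  rfl

lemma abs_level_average_le (hL : RegularLevy L P) (t : ℝ) (m n : ℕ)
    (φ : ℝ × ℝ →ᵇ ℝ) (g : ℝ →ᵇ ℝ) (x : ℝ) :
    ∫ p in crossing L x (mesh n), ‖levelIntegrand L t m n φ g (x, p)‖ ∂(volume.prod P) ≤
      3 * (‖φ‖ * ‖g‖) * (1 + x ^ 2)⁻¹ * mesh n := by
  have hfin : (volume.prod P) (crossing L x (mesh n)) < ∞ := by
    rw [hL.volume_prod_crossing]; exact ENNReal.ofReal_lt_top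
  have h := norm_setIntegral_le_of_norm_le_const (μ := volume.prod P)
    (s := crossing L x (mesh n)) (C := 3 * (‖φ‖ * ‖g‖) * (1 + x ^ 2)⁻¹)
    (f := fun p => ‖levelIntegrand L t m n φ g (x, p)‖) hfin
    (fun p _ => by rw [norm_norm]; exact abs_level_integrand_le t m φ g x _ _)
  rw [measureReal_def, hL.volume_prod_crossing, ENNReal.toReal_ofReal (mesh_pos n).le] at h
  exact (le_abs_self _).trans h

lemma tendsto_level_average (hL : RegularLevy L P) (t : ℝ) (m : ℕ) (φ : ℝ × ℝ →ᵇ ℝ)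
    (g : ℝ →ᵇ ℝ) :
    Tendsto (fun n : ℕ => ∫ x, ((n : ℝ) + 1) * ∫ p in crossing L x (mesh n),
        levelIntegrand L t m n φ g (x, p) ∂(volume.prod P)) atTop
      (𝓝 (∫ x, ∫ ω, levelWeight t (hit L x ω, undershoot L x ω) *
        bump m (x - undershoot L x ω) *
          (φ (hit L x ω, undershoot L x ω) * g (charBase L x t ω)) ∂P)) := by
  refine tendsto_integral_of_dominated_convergence
    (fun x => 3 * (‖φ‖ * ‖g‖) * (1 + x ^ 2)⁻¹) ?_ (integrable_inv_one_add_sq.const_mul _) ?_ ?_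
  · exact fun n => ((hL.stronglyMeasurable_level_average t m n φ g).const_mul
      _).aestronglyMeasurable
  · refine fun n => Eventually.of_forall fun x => ?_
    have hn : (0 : ℝ) ≤ (n : ℝ) + 1 := by positivity
    rw [norm_mul, Real.norm_of_nonneg hn]
    calc _ ≤ ((n : ℝ) + 1) * (3 * (‖φ‖ * ‖g‖) * (1 + x ^ 2)⁻¹ * mesh n) :=
          mul_le_mul_of_nonneg_left ((norm_integral_le_integral_norm _).trans
            (hL.abs_level_average_le t m n φ g x)) hn
      _ = _ := by rw [mul_left_comm, mesh_mul, mul_one]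
  · refine Eventually.of_forall fun x => ?_
    have hc1 : Continuous (fun r : ℝ × ℝ × ℝ × ℝ => (r.1, r.2.2.1)) := by fun_prop
    exact hL.tendsto_average x t (C := 3 * (‖φ‖ * ‖g‖) * (1 + x ^ 2)⁻¹)
      (F := fun r => levelWeight t (r.1, r.2.2.1) * bump m (x - r.2.2.1) *
        (φ (r.1, r.2.2.1) * g r.2.2.2))
      ((((continuous_levelWeight t).comp hc1).mul ((continuous_bump m).comp (by fun_prop))).mul
        ((φ.continuous.comp hc1).mul (g.continuous.comp (by fun_prop))))
      (fun r => abs_level_integrand_le t m φ g x (r.1, r.2.2.1) _)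

lemma integrable_crossedIntegrand (hL : RegularLevy L P) (t : ℝ) (m n : ℕ)
    (φ : ℝ × ℝ →ᵇ ℝ) (g : ℝ →ᵇ ℝ) :
    Integrable (crossedIntegrand L t m n φ g) (volume.prod (volume.prod P)) := by
  set G := crossedIntegrand L t m n φ g with hG
  have hGm : Measurable G := (hL.measurable_levelIntegrand t m n φ g).indicator
    (hL.measurableSet_crossing_uncurry (mesh n))
  have hGx : ∀ x p, G (x, p) = (crossing L x (mesh n)).indicator
    (fun p => levelIntegrand L t m n φ g (x, p)) p := fun x p => rfl
  have hsec : ∀ x, Measurable (fun p => levelIntegrand L t m n φ g (x, p)) := fun x =>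
    (hL.measurable_levelIntegrand t m n φ g).comp measurable_prodMk_left
  rw [integrable_prod_iff hGm.aestronglyMeasurable]
  refine ⟨Eventually.of_forall fun x => ?_, ?_⟩
  · simp only [hGx]
    exact (hL.integrableOn_crossing x _ (hsec x)
      (fun p => abs_level_integrand_le t m φ g x _ _)).integrable_indicator
      (hL.measurableSet_crossing x _)
  · refine ((integrable_inv_one_add_sq.const_mul (3 * (‖φ‖ * ‖g‖))).mul_const (mesh n)).mono'
      (hGm.stronglyMeasurable.norm.integral_prod_right').aestronglyMeasurable
      (Eventually.of_forall fun x => ?_)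
    rw [Real.norm_of_nonneg (integral_nonneg fun _ => norm_nonneg _)]
    simp only [hGx, norm_indicator_eq_indicator_norm]
    rw [integral_indicator (hL.measurableSet_crossing x _)]
    exact hL.abs_level_average_le t m n φ g x

lemma integral_level_crossing (hL : RegularLevy L P) (t : ℝ) (m n : ℕ)
    (φ : ℝ × ℝ →ᵇ ℝ) (g : ℝ →ᵇ ℝ) :
    ∫ x, (∫ p in crossing L x (mesh n),
      levelIntegrand L t m n φ g (x, p) ∂(volume.prod P)) =
      ∫ p : ℝ × Ω, levelWeight t (p.1, L p.1 p.2) *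
      (φ (p.1, L p.1 p.2) * g (L (p.1 + mesh n - t) p.2)) *
      bumpMass m (L (p.1 + mesh n) p.2 - L p.1 p.2) ∂(volume.prod P) := by
  have hGi := hL.integrable_crossedIntegrand t m n φ g
  have h1 : ∀ x, ∫ p in crossing L x (mesh n),
      levelIntegrand L t m n φ g (x, p) ∂(volume.prod P) =
        ∫ p, crossedIntegrand L t m n φ g (x, p) ∂(volume.prod P) := by
    intro x
    rw [← integral_indicator (hL.measurableSet_crossing x _)]
    rfl
  simp only [h1]
  rw [← integral_prod _ hGi, integral_prod_symm _ hGi]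
  simp only [hL.integral_crossedIntegrand]

/-- Integrated over all levels, window averages factorise. -/
lemma level_average_eq (hL : RegularLevy L P) {t : ℝ} (m n : ℕ) (hn : mesh n < t)
    (φ : ℝ × ℝ →ᵇ ℝ) (g : ℝ →ᵇ ℝ) :
    ∫ x, ((n : ℝ) + 1) * ∫ p in crossing L x (mesh n),
        levelIntegrand L t m n φ g (x, p) ∂(volume.prod P) =
      (((n : ℝ) + 1) * ∫ ω, bumpMass m (L (mesh n) ω) ∂P) *
        ∫ p : ℝ × Ω, levelWeight t (p.1, L p.1 p.2) *
          (φ (p.1, L p.1 p.2) * g (L (p.1 + mesh n - t) p.2)) ∂(volume.prod P) := by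
  have hYm : Measurable (fun p : ℝ × Ω => (p.1, L p.1 p.2)) :=
    measurable_fst.prodMk hL.measurable_uncurry
  have hLn : Measurable (fun p : ℝ × Ω => L (p.1 + mesh n - t) p.2) := by
    have := hL.measurable_apply_add (mesh n - t)
    simpa only [← add_sub_assoc] using this
  have hvm : Measurable (fun p : ℝ × Ω => (1 + (L p.1 p.2) ^ 2)⁻¹) :=
    (measurable_const.add (hL.measurable_uncurry.pow_const 2)).inv
  have hφg : Measurable (fun p : ℝ × Ω => φ (p.1, L p.1 p.2) * g (L (p.1 + mesh n - t) p.2)) :=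
    (φ.continuous.measurable.comp hYm).mul (g.continuous.measurable.comp hLn)
  have hDm : Measurable (fun p : ℝ × Ω => bumpMass m (L (p.1 + mesh n) p.2 - L p.1 p.2)) :=
    (continuous_bumpMass m).measurable.comp
      ((hL.measurable_apply_add _).sub hL.measurable_uncurry)
  have hvφ : ∀ (p : ℝ × Ω), |(1 + (L p.1 p.2) ^ 2)⁻¹ *
      (φ (p.1, L p.1 p.2) * g (L (p.1 + mesh n - t) p.2))| ≤ ‖φ‖ * ‖g‖ := by
    intro p
    rw [abs_mul, abs_of_nonneg (by positivity), abs_mul]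
    exact (mul_le_of_le_one_left (by positivity) (inv_one_add_sq_le_one _)).trans
      (mul_le_mul (φ.norm_coe_le_norm _) (g.norm_coe_le_norm _) (abs_nonneg _) (norm_nonneg _))
  have hinc : ∀ p : ℝ × Ω, 0 ≤ L (p.1 + mesh n) p.2 - L p.1 p.2 := fun p =>
    sub_nonneg.2 ((hL.strictMono p.2).monotone (by linarith [mesh_pos n]))
  have hB0 : 0 ≤ ∫ v, bump m v := integral_nonneg (bump_nonneg m)
  have hi1 : Integrable (fun p : ℝ × Ω => levelWeight t (p.1, L p.1 p.2) *
      (φ (p.1, L p.1 p.2) * g (L (p.1 + mesh n - t) p.2))) (volume.prod P) := by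
    have := integrable_timeWeight_prod (P := P) t (hvm.mul hφg) (C := ‖φ‖ * ‖g‖) hvφ
    refine this.congr (Eventually.of_forall fun p => ?_)
    simp only [levelWeight, Pi.mul_apply]; ring
  have hi2 : Integrable (fun p : ℝ × Ω => levelWeight t (p.1, L p.1 p.2) *
      (φ (p.1, L p.1 p.2) * g (L (p.1 + mesh n - t) p.2)) *
      bumpMass m (L (p.1 + mesh n) p.2 - L p.1 p.2)) (volume.prod P) :=
    hi1.mul_bdd (c := ∫ v, bump m v) hDm.aestronglyMeasurable
      (Eventually.of_forall fun p => abs_bumpMass_le m (hinc p))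
  rw [integral_const_mul, hL.integral_level_crossing, integral_prod _ hi2, integral_prod _ hi1, mul_assoc]
  congr 1
  rw [← integral_const_mul]
  refine integral_congr_ae (Eventually.of_forall fun s => ?_)
  dsimp only
  rcases le_or_gt s t with hst | hst
  · simp [levelWeight, timeWeight_of_le hst]
  exact hL.integral_window_mul_bumpMass hst m n φ g hn

end RegularLevy
end LevyChar

/-! ### Creeping samples the path at Lebesgue-typical times -/

namespace LevyChar
namespace RegularLevy

variable {Ω : Type*} [MeasurableSpace Ω] {P : Measure Ω} {L : ℝ → Ω → ℝ}

/-- The set of pairs of a level and a path such that the path creeps over the level. -/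
def creepSet (L : ℝ → Ω → ℝ) : Set (ℝ × Ω) := {p | undershoot L p.1 p.2 = p.1}

lemma measurableSet_creepSet (hL : RegularLevy L P) : MeasurableSet (creepSet L) :=
  measurableSet_eq_fun hL.measurable_undershoot_uncurry measurable_fst

lemma measurable_hitPair_uncurry (hL : RegularLevy L P) :
    Measurable (fun p : ℝ × Ω => (hit L p.1 p.2, undershoot L p.1 p.2)) :=
  hL.measurable_hit_uncurry.prodMk hL.measurable_undershoot_uncurry

lemma measurable_charBase_prod (hL : RegularLevy L P) (t : ℝ) :
    Measurable (fun p : ℝ × Ω => charBase L p.1 t p.2) :=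
  hL.measurable_charBase_uncurry.comp
    (measurable_fst.prodMk (measurable_const.prodMk measurable_snd))

lemma measurable_timePair (hL : RegularLevy L P) :
    Measurable (fun p : ℝ × Ω => (p.1, L p.1 p.2)) :=
  measurable_fst.prodMk hL.measurable_uncurry

lemma measurable_apply_sub (hL : RegularLevy L P) (t : ℝ) :
    Measurable (fun p : ℝ × Ω => L (p.1 - t) p.2) := hL.measurable_apply_add (-t)

/-- The weighted integral of test functions of `(hitting time, undershoot)` and of the earlier
value, over all levels, with a cutoff near creeping. -/
noncomputable def bumpIntegral (L : ℝ → Ω → ℝ) (P : Measure Ω) (t : ℝ) (m : ℕ)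
    (φ : ℝ × ℝ →ᵇ ℝ) (g : ℝ →ᵇ ℝ) : ℝ :=
  ∫ x, ∫ ω, levelWeight t (hit L x ω, undershoot L x ω) * bump m (x - undershoot L x ω) *
    (φ (hit L x ω, undershoot L x ω) * g (charBase L x t ω)) ∂P

/-- The weighted integral of test functions over all creeping pairs. -/
noncomputable def creepIntegral (L : ℝ → Ω → ℝ) (P : Measure Ω) (t : ℝ)
    (φ : ℝ × ℝ →ᵇ ℝ) (g : ℝ →ᵇ ℝ) : ℝ :=
  ∫ p in creepSet L, levelWeight t (hit L p.1 p.2, undershoot L p.1 p.2) *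
    (φ (hit L p.1 p.2, undershoot L p.1 p.2) * g (charBase L p.1 t p.2)) ∂(volume.prod P)

/-- The weighted integral of test functions of the path over all times. -/
noncomputable def timeIntegral (L : ℝ → Ω → ℝ) (P : Measure Ω) (t : ℝ)
    (φ : ℝ × ℝ →ᵇ ℝ) (g : ℝ →ᵇ ℝ) : ℝ :=
  ∫ p : ℝ × Ω, levelWeight t (p.1, L p.1 p.2) *
    (φ (p.1, L p.1 p.2) * g (L (p.1 - t) p.2)) ∂(volume.prod P)

variable [IsProbabilityMeasure P]

lemma tendsto_timeIntegral (hL : RegularLevy L P) (t : ℝ) (φ : ℝ × ℝ →ᵇ ℝ) (g : ℝ →ᵇ ℝ) :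
    Tendsto (fun n => ∫ p : ℝ × Ω, levelWeight t (p.1, L p.1 p.2) *
      (φ (p.1, L p.1 p.2) * g (L (p.1 + mesh n - t) p.2)) ∂(volume.prod P)) atTop
      (𝓝 (timeIntegral L P t φ g)) := by
  have hLn : ∀ n, Measurable (fun p : ℝ × Ω => L (p.1 + mesh n - t) p.2) := fun n => by
    have := hL.measurable_apply_add (mesh n - t)
    simpa only [← add_sub_assoc] using this
  refine tendsto_integral_of_dominated_convergence
    (fun p => timeWeight t p.1 * (‖φ‖ * ‖g‖)) ?_ ?_ ?_ ?_
  · exact fun n => (((continuous_levelWeight t).measurable.comp hL.measurable_timePair).mul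
      ((φ.continuous.measurable.comp hL.measurable_timePair).mul
        (g.continuous.measurable.comp (hLn n)))).aestronglyMeasurable
  · exact ((integrable_timeWeight t).comp_fst P).mul_const _
  · refine fun n => Eventually.of_forall fun p => ?_
    rw [norm_mul, Real.norm_of_nonneg (levelWeight_nonneg _ _), norm_mul]
    refine mul_le_mul ?_ (mul_le_mul (φ.norm_coe_le_norm _) (g.norm_coe_le_norm _)
      (norm_nonneg _) (norm_nonneg _)) (by positivity) (timeWeight_nonneg _ _)
    exact mul_le_of_le_one_right (timeWeight_nonneg _ _) (inv_one_add_sq_le_one _)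
  · refine Eventually.of_forall fun p => ?_
    have h1 : Tendsto (fun n => p.1 + mesh n - t) atTop (𝓝[≥] (p.1 - t)) := by
      refine tendsto_nhdsWithin_iff.2 ⟨?_, Eventually.of_forall fun n => ?_⟩
      · simpa using (tendsto_const_nhds.add tendsto_mesh).sub_const t
      · simp only [Set.mem_Ici]; linarith [mesh_pos n]
    have h2 : Tendsto (fun n => L (p.1 + mesh n - t) p.2) atTop (𝓝 (L (p.1 - t) p.2)) :=
      Tendsto.comp (hL.rightCont p.2 (p.1 - t)) h1
    exact (((g.continuous.tendsto _).comp h2).const_mul _).const_mul _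

/-- The window averages for both pairs of test functions share the prefactor (n + 1) E `bumpMass`.
Cross-multiplication cancels it, so its convergence need not be studied. -/
lemma bumpIntegral_mul_timeIntegral (hL : RegularLevy L P) {t : ℝ} (ht : 0 < t) (m : ℕ)
    (φ φ' : ℝ × ℝ →ᵇ ℝ) (g g' : ℝ →ᵇ ℝ) :
    bumpIntegral L P t m φ g * timeIntegral L P t φ' g' =
      bumpIntegral L P t m φ' g' * timeIntegral L P t φ g := by
  refine tendsto_nhds_unique (((hL.tendsto_level_average t m φ g).mul
    (hL.tendsto_timeIntegral t φ' g'))) (((hL.tendsto_level_average t m φ' g').mul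
    (hL.tendsto_timeIntegral t φ g)).congr' ?_)
  filter_upwards [tendsto_mesh.eventually (gt_mem_nhds ht)] with n hn
  rw [hL.level_average_eq m n hn, hL.level_average_eq m n hn]
  ring

/-- The cutoff tends pointwise to the indicator that undershoot and level coincide. -/
lemma tendsto_bumpIntegral (hL : RegularLevy L P) (t : ℝ) (φ : ℝ × ℝ →ᵇ ℝ) (g : ℝ →ᵇ ℝ) :
    Tendsto (fun m => bumpIntegral L P t m φ g) atTop (𝓝 (creepIntegral L P t φ g)) := by
  set F : ℕ → ℝ × Ω → ℝ := fun m p => levelWeight t (hit L p.1 p.2, undershoot L p.1 p.2) *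
    bump m (p.1 - undershoot L p.1 p.2) *
    (φ (hit L p.1 p.2, undershoot L p.1 p.2) * g (charBase L p.1 t p.2)) with hF
  have hFm : ∀ m, Measurable (F m) := fun m =>
    (((continuous_levelWeight t).measurable.comp hL.measurable_hitPair_uncurry).mul
      ((continuous_bump m).measurable.comp
        (measurable_fst.sub hL.measurable_undershoot_uncurry))).mul
      ((φ.continuous.measurable.comp hL.measurable_hitPair_uncurry).mul
        (g.continuous.measurable.comp (hL.measurable_charBase_prod t)))
  have hB : Integrable (fun p : ℝ × Ω => 3 * (‖φ‖ * ‖g‖) * (1 + p.1 ^ 2)⁻¹) (volume.prod P) :=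
    (integrable_inv_one_add_sq.const_mul (3 * (‖φ‖ * ‖g‖))).comp_fst P
  have hFB : ∀ m p, ‖F m p‖ ≤ 3 * (‖φ‖ * ‖g‖) * (1 + p.1 ^ 2)⁻¹ := fun m p =>
    abs_level_integrand_le t m φ g p.1 _ _
  have e : ∀ m, bumpIntegral L P t m φ g = ∫ p, F m p ∂(volume.prod P) := fun m =>
    (integral_prod (F m) (hB.mono' (hFm m).aestronglyMeasurable
      (Eventually.of_forall (hFB m)))).symm
  simp only [e]
  rw [creepIntegral, ← integral_indicator hL.measurableSet_creepSet]
  refine tendsto_integral_of_dominated_convergence _ (fun m => (hFm m).aestronglyMeasurable) hB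
    (fun m => Eventually.of_forall (hFB m)) (Eventually.of_forall fun p => ?_)
  have h := ((tendsto_bump (p.1 - undershoot L p.1 p.2)).const_mul
    (levelWeight t (hit L p.1 p.2, undershoot L p.1 p.2))).mul_const
    (φ (hit L p.1 p.2, undershoot L p.1 p.2) * g (charBase L p.1 t p.2))
  by_cases hp : p ∈ creepSet L
  · rw [Set.indicator_of_mem hp]
    rwa [if_pos (sub_eq_zero.2 (Eq.symm hp)), mul_one] at h
  · rw [Set.indicator_of_notMem hp]
    rwa [if_neg (fun h0 => hp (sub_eq_zero.1 h0).symm), mul_zero, zero_mul] at h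

/-- Up to a constant, creeping samples the path at Lebesgue-typical times. -/
lemma creepIntegral_mul_timeIntegral (hL : RegularLevy L P) {t : ℝ} (ht : 0 < t)
    (φ φ' : ℝ × ℝ →ᵇ ℝ) (g g' : ℝ →ᵇ ℝ) :
    creepIntegral L P t φ g * timeIntegral L P t φ' g' =
      creepIntegral L P t φ' g' * timeIntegral L P t φ g :=
  tendsto_nhds_unique ((hL.tendsto_bumpIntegral t φ g).mul_const _)
    (((hL.tendsto_bumpIntegral t φ' g').mul_const _).congr fun m =>
      (hL.bumpIntegral_mul_timeIntegral ht m φ φ' g g').symm)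

end RegularLevy
end LevyChar

/-! ### Disintegrating the creeping law over almost every level -/

namespace LevyChar

section KernelSlices

variable {α β γ : Type*} [MeasurableSpace α] [MeasurableSpace β] [MeasurableSpace γ]

/-- A disintegration of a mixture, when the mixing parameter is a function of the conditioning
variable, disintegrates almost every component. -/
lemma ae_eq_fst_compProd_of_mixture [MeasurableSpace.CountableOrCountablyGenerated α (β × γ)]
    {μ : Measure α} [IsFiniteMeasure μ]
    {η : Kernel α (β × γ)} [IsFiniteKernel η] {κ : Kernel β γ} [IsMarkovKernel κ]
    {M : Measure (β × γ)} [IsFiniteMeasure M] (hM : M = M.fst ⊗ₘ κ) {u : β → α}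
    (hu : Measurable u) (H : μ ⊗ₘ η = M.map (fun q => (u q.1, q))) :
    ∀ᵐ x ∂μ, η x = (η x).fst ⊗ₘ κ := by
  have hum : Measurable (fun q : β × γ => (u q.1, q)) := by fun_prop
  -- Each component is rebuilt from its first marginal and κ. The mixture does not change, since its
  -- conditioning variable already determines the parameter; uniqueness of disintegration then
  -- compares components.
  set η' : Kernel α (β × γ) := η.fst ⊗ₖ κ.prodMkLeft α with hη'
  have key : μ ⊗ₘ η = μ ⊗ₘ η' := by
    ext R hR
    have hF : Measurable (fun r : α × β => κ r.2 {w | (r.1, (r.2, w)) ∈ R}) := by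
      have := Kernel.measurable_kernel_prodMk_left (κ := κ.prodMkLeft α)
        (t := {v : (α × β) × γ | (v.1.1, (v.1.2, v.2)) ∈ R})
        (hR.preimage (by fun_prop : Measurable fun v : (α × β) × γ => (v.1.1, (v.1.2, v.2))))
      exact this
    have hFv : Measurable (fun v : α × β × γ => κ v.2.1 {w | (v.1, (v.2.1, w)) ∈ R}) :=
      hF.comp (by fun_prop : Measurable fun v : α × β × γ => (v.1, v.2.1))
    have h1 : (μ ⊗ₘ η') R = ∫⁻ v, κ v.2.1 {w | (v.1, (v.2.1, w)) ∈ R} ∂(μ ⊗ₘ η) := by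
      rw [Measure.lintegral_compProd hFv, Measure.compProd_apply hR]
      refine lintegral_congr fun x => ?_
      rw [hη', Kernel.compProd_apply (hR.preimage measurable_prodMk_left), Kernel.fst_apply]
      exact lintegral_map (f := fun z => κ z {w | (x, (z, w)) ∈ R})
        (hF.comp measurable_prodMk_left) measurable_fst
    rw [h1, H, lintegral_map hFv hum, Measure.map_apply hum hR]
    nth_rw 1 [hM]
    rw [Measure.compProd_apply (hR.preimage hum), Measure.fst,
      lintegral_map (Kernel.measurable_kernel_prodMk_left (hR.preimage hum)) measurable_fst]
    rfl
  filter_upwards [Kernel.ae_eq_of_compProd_eq key] with x hx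
  nth_rw 1 [hx]
  ext S hS
  rw [hη', Kernel.compProd_apply hS, Measure.compProd_apply hS, Kernel.fst_apply]
  rfl

end KernelSlices

section WeightedPairs

variable {Ω α : Type*} [MeasurableSpace Ω] [MeasurableSpace α] [TopologicalSpace α] [BorelSpace α]

lemma integral_map_withDensity_mul {μ : Measure Ω} {Z : Ω → α} {W : Ω → ℝ} (hZ : Measurable Z)
    (hW : Measurable W) {ψ : α → ℝ} (hψ : Measurable ψ) (hψ0 : ∀ z, 0 ≤ ψ z)
    (φ : α →ᵇ ℝ) (g : ℝ →ᵇ ℝ) :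
    ∫ q, φ q.1 * g q.2 ∂((μ.withDensity (fun ω => ENNReal.ofReal (ψ (Z ω)))).map
      (fun ω => (Z ω, W ω))) = ∫ ω, ψ (Z ω) * (φ (Z ω) * g (W ω)) ∂μ := by
  have hφg : Measurable (fun p : α × ℝ => φ p.1 * g p.2) :=
    (φ.continuous.measurable.comp measurable_fst).mul (g.continuous.measurable.comp measurable_snd)
  have hd : Measurable (fun ω => ENNReal.ofReal (ψ (Z ω))) := (hψ.comp hZ).ennreal_ofReal
  rw [integral_map (hZ.prodMk hW).aemeasurable hφg.aestronglyMeasurable,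
    integral_withDensity_eq_integral_toReal_smul hd (by simp)]
  simp only [ENNReal.toReal_ofReal (hψ0 _), smul_eq_mul]

end WeightedPairs

namespace RegularLevy

variable {Ω : Type*} [MeasurableSpace Ω] {P : Measure Ω} {L : ℝ → Ω → ℝ}

/-- The weighted joint law of (hitting time, undershoot) and the earlier value over all levels
that are crept over. -/
noncomputable def creepLaw (L : ℝ → Ω → ℝ) (P : Measure Ω) (t : ℝ) : Measure ((ℝ × ℝ) × ℝ) :=
  ((((volume : Measure ℝ).prod P).restrict (creepSet L)).withDensity fun p =>
    ENNReal.ofReal (levelWeight t (hit L p.1 p.2, undershoot L p.1 p.2))).map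
      (fun p => ((hit L p.1 p.2, undershoot L p.1 p.2), charBase L p.1 t p.2))

/-- The weighted joint law of (time, value) and the earlier value over all times. -/
noncomputable def timeLaw (L : ℝ → Ω → ℝ) (P : Measure Ω) (t : ℝ) : Measure ((ℝ × ℝ) × ℝ) :=
  (((volume : Measure ℝ).prod P).withDensity fun p =>
    ENNReal.ofReal (levelWeight t (p.1, L p.1 p.2))).map
      (fun p => ((p.1, L p.1 p.2), L (p.1 - t) p.2))

variable [IsProbabilityMeasure P]

/-- On creeping the undershoot is the level, so decay in the undershoot is integrability in the
level. -/
lemma isFiniteMeasure_creepLaw (hL : RegularLevy L P) (t : ℝ) :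
    IsFiniteMeasure (creepLaw L P t) := by
  have hint : Integrable (fun p : ℝ × Ω => levelWeight t (hit L p.1 p.2, undershoot L p.1 p.2))
      ((volume.prod P).restrict (creepSet L)) := by
    have hB : Integrable (fun p : ℝ × Ω => (1 + p.1 ^ 2)⁻¹) (volume.prod P) :=
      integrable_inv_one_add_sq.comp_fst P
    refine hB.restrict.mono' ((continuous_levelWeight t).measurable.comp
      hL.measurable_hitPair_uncurry).aestronglyMeasurable ?_
    refine (ae_restrict_iff' hL.measurableSet_creepSet).2 (Eventually.of_forall fun p hp => ?_)
    rw [Real.norm_of_nonneg (levelWeight_nonneg _ _)]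
    refine (levelWeight_le_inv _ _).trans_eq ?_
    have : undershoot L p.1 p.2 = p.1 := hp
    simp only [this]
  have := isFiniteMeasure_withDensity_ofReal hint.2
  unfold creepLaw
  infer_instance

lemma integrable_levelWeight_time (hL : RegularLevy L P) (t : ℝ) :
    Integrable (fun p : ℝ × Ω => levelWeight t (p.1, L p.1 p.2)) (volume.prod P) := by
  refine ((integrable_timeWeight t).comp_fst P).mono' ((continuous_levelWeight t).measurable.comp
    hL.measurable_timePair).aestronglyMeasurable (Eventually.of_forall fun p => ?_)
  rw [Real.norm_of_nonneg (levelWeight_nonneg _ _)]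
  exact mul_le_of_le_one_right (timeWeight_nonneg _ _) (inv_one_add_sq_le_one _)

lemma isFiniteMeasure_timeLaw (hL : RegularLevy L P) (t : ℝ) :
    IsFiniteMeasure (timeLaw L P t) := by
  have := isFiniteMeasure_withDensity_ofReal (hL.integrable_levelWeight_time t).2
  unfold timeLaw
  infer_instance

lemma timeIntegral_one_pos (hL : RegularLevy L P) (t : ℝ) : 0 < timeIntegral L P t 1 1 := by
  simp only [timeIntegral, BoundedContinuousFunction.coe_one, Pi.one_apply, mul_one]
  rw [integral_pos_iff_support_of_nonneg (fun p => levelWeight_nonneg _ _)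
    (hL.integrable_levelWeight_time t)]
  refine lt_of_lt_of_le ?_ (measure_mono (s := Set.Ioi t ×ˢ Set.univ) fun p hp =>
    (levelWeight_pos (z := (p.1, L p.1 p.2)) hp.1).ne')
  rw [Measure.prod_prod]
  simp

/-- The constant is the ratio of total masses, obtained from the cross-multiplied identity with
constant test functions; it may be zero, when creeping carries no mass. -/
lemma exists_creepLaw_eq_smul (hL : RegularLevy L P) {t : ℝ} (ht : 0 < t) :
    ∃ c : NNReal, creepLaw L P t = c • timeLaw L P t := by
  have := hL.isFiniteMeasure_creepLaw t
  have := hL.isFiniteMeasure_timeLaw t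
  have hI := hL.timeIntegral_one_pos t
  have hlw := (continuous_levelWeight t).measurable
  have hD : 0 ≤ creepIntegral L P t 1 1 := by
    simp only [creepIntegral, BoundedContinuousFunction.coe_one, Pi.one_apply, mul_one]
    exact integral_nonneg fun p => levelWeight_nonneg _ _
  have hc : 0 ≤ creepIntegral L P t 1 1 / timeIntegral L P t 1 1 := by positivity
  obtain ⟨c, hcc⟩ : ∃ c : NNReal,
    (c : ℝ) = creepIntegral L P t 1 1 / timeIntegral L P t 1 1 := ⟨⟨_, hc⟩, rfl⟩
  refine ⟨c, Measure.ext_of_integral_mul_boundedContinuousFunction fun φ g => ?_⟩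
  rw [integral_smul_nnreal_measure, creepLaw, timeLaw,
    integral_map_withDensity_mul hL.measurable_hitPair_uncurry (hL.measurable_charBase_prod t)
      hlw (levelWeight_nonneg t),
    integral_map_withDensity_mul hL.measurable_timePair (hL.measurable_apply_sub t)
      hlw (levelWeight_nonneg t), NNReal.smul_def, smul_eq_mul, hcc, div_mul_eq_mul_div,
    eq_div_iff hI.ne']
  exact hL.creepIntegral_mul_timeIntegral ht φ 1 g 1

/-- At each fixed time this is the definition of the bridge, and the time is part of the
conditioning variable. The null sets depending on s are absorbed by integrating over s. -/
lemma timeLaw_eq_compProd (hL : RegularLevy L P) {K : Kernel (ℝ × ℝ × ℝ) ℝ}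
    (hK : IsLevyBridge L P K) {t : ℝ} (ht : 0 < t) [IsMarkovKernel (bridgeAt K t)] :
    timeLaw L P t = (timeLaw L P t).fst ⊗ₘ bridgeAt K t := by
  have hlw := (continuous_levelWeight t).measurable
  have key := map_prodMk_eq_compProd_of_integral_eq hL.measurable_timePair
    (hL.measurable_apply_sub t) hlw (levelWeight_nonneg t) (hL.integrable_levelWeight_time t)
    (bridgeAt K t) ?_
  · rw [timeLaw, Measure.fst_map_prodMk (hL.measurable_apply_sub t)]
    exact key
  intro φ g
  have hkm := measurable_kernel_integral (bridgeAt K t) g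
  have hwφ : ∀ (p : ℝ × Ω) (d : ℝ), |d| ≤ ‖g‖ →
      ‖φ (p.1, L p.1 p.2) * levelWeight t (p.1, L p.1 p.2) * d‖ ≤
        timeWeight t p.1 * (‖φ‖ * ‖g‖) := by
    intro p d hd
    rw [norm_mul, norm_mul, Real.norm_of_nonneg (levelWeight_nonneg _ _), mul_comm ‖φ _‖, mul_assoc]
    exact mul_le_mul (mul_le_of_le_one_right (timeWeight_nonneg _ _) (inv_one_add_sq_le_one _))
      (mul_le_mul (φ.norm_coe_le_norm _) hd (abs_nonneg _) (norm_nonneg _)) (by positivity)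
      (timeWeight_nonneg _ _)
  have hB : Integrable (fun p : ℝ × Ω => timeWeight t p.1 * (‖φ‖ * ‖g‖)) (volume.prod P) :=
    ((integrable_timeWeight t).comp_fst P).mul_const _
  have hm1 : Measurable (fun p : ℝ × Ω => φ (p.1, L p.1 p.2) * levelWeight t (p.1, L p.1 p.2)) :=
    (φ.continuous.measurable.comp hL.measurable_timePair).mul (hlw.comp hL.measurable_timePair)
  have hi : ∀ d : ℝ × Ω → ℝ, Measurable d → (∀ p, |d p| ≤ ‖g‖) → Integrable (fun p =>
      φ (p.1, L p.1 p.2) * levelWeight t (p.1, L p.1 p.2) * d p) (volume.prod P) :=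
    fun d hd hdg => hB.mono' (hm1.mul hd).aestronglyMeasurable
      (Eventually.of_forall fun p => hwφ p _ (hdg p))
  rw [integral_prod _ (hi (fun p => g (L (p.1 - t) p.2))
      (g.continuous.measurable.comp (hL.measurable_apply_sub t)) fun p => g.norm_coe_le_norm _),
    integral_prod _ (hi (fun p => ∫ w, g w ∂(bridgeAt K t (p.1, L p.1 p.2)))
      (hkm.comp hL.measurable_timePair) fun p => abs_kernel_integral_le _ g _)]
  refine integral_congr_ae (Eventually.of_forall fun s => ?_)
  dsimp only
  rcases le_or_gt s t with hst | hst
  · simp [levelWeight, timeWeight_of_le hst]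
  refine hL.integral_bridge hK (r := s - t) (s := s) (by linarith) (by linarith)
    (h := fun y => φ (s, y) * levelWeight t (s, y)) (C := ‖φ‖ * 1)
    ((φ.continuous.measurable.comp measurable_prodMk_left).mul
      (hlw.comp measurable_prodMk_left)) (fun y => ?_) g
  rw [abs_mul, abs_of_nonneg (levelWeight_nonneg _ _)]
  exact mul_le_mul (φ.norm_coe_le_norm _) (levelWeight_le_one _ _) (levelWeight_nonneg _ _)
    (norm_nonneg _)

lemma creepLaw_eq_compProd (hL : RegularLevy L P) {K : Kernel (ℝ × ℝ × ℝ) ℝ}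
    (hK : IsLevyBridge L P K) {t : ℝ} (ht : 0 < t) [IsMarkovKernel (bridgeAt K t)] :
    creepLaw L P t = (creepLaw L P t).fst ⊗ₘ bridgeAt K t := by
  have := hL.isFiniteMeasure_timeLaw t
  obtain ⟨c, hc⟩ := hL.exists_creepLaw_eq_smul ht
  have h1 : (c • timeLaw L P t).fst = c • (timeLaw L P t).fst := by
    ext S hS
    simp [Measure.fst_apply hS]
  have h2 : (c • (timeLaw L P t).fst) ⊗ₘ bridgeAt K t =
      c • ((timeLaw L P t).fst ⊗ₘ bridgeAt K t) := Measure.compProd_smul_left _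
  rw [hc, h1, h2, ← hL.timeLaw_eq_compProd hK ht]

end RegularLevy
end LevyChar

namespace LevyChar
namespace RegularLevy

variable {Ω : Type*} [MeasurableSpace Ω] {P : Measure Ω} {L : ℝ → Ω → ℝ}

/-- A weight on `(hitting time, undershoot)` selecting creeping over the level `x` after time
`t`. -/
noncomputable def creepWeight (t x : ℝ) (z : ℝ × ℝ) : ℝ≥0∞ :=
  {y : ℝ | y = x}.indicator (fun _ => ENNReal.ofReal (timeWeight t z.1)) z.2

lemma measurable_creepWeight (t : ℝ) :
    Measurable (fun v : ℝ × ℝ × ℝ => creepWeight t v.1 v.2) := by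
  have h : Measurable (fun v : ℝ × ℝ × ℝ => ENNReal.ofReal (timeWeight t v.2.1)) :=
    ((continuous_timeWeight t).measurable.comp
      (measurable_fst.comp measurable_snd)).ennreal_ofReal
  exact h.indicator (s := {v : ℝ × ℝ × ℝ | v.2.2 = v.1})
    (measurableSet_eq_fun (measurable_snd.comp measurable_snd) measurable_fst)

lemma creepWeight_le_one (t x : ℝ) (z : ℝ × ℝ) : creepWeight t x z ≤ 1 :=
  (Set.indicator_le_self _ _ _).trans (ENNReal.ofReal_le_one.2 (timeWeight_le_one _ _))

lemma measurable_creepWeight_uncurry (t : ℝ) :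
    Measurable (Function.uncurry fun (x : ℝ) (q : (ℝ × ℝ) × ℝ) => creepWeight t x q.1) :=
  (measurable_creepWeight t).comp
    (measurable_fst.prodMk (measurable_fst.comp measurable_snd))

variable [IsProbabilityMeasure P]

/-- The joint law of `(hitting time, undershoot)` and of the earlier value on creeping, as a
kernel in the level. -/
noncomputable def creepKernel (L : ℝ → Ω → ℝ) (P : Measure Ω) [IsFiniteMeasure P] (t : ℝ) :
    Kernel ℝ ((ℝ × ℝ) × ℝ) :=
  Kernel.withDensity (paramLaw P fun p : ℝ × Ω =>
    ((hit L p.1 p.2, undershoot L p.1 p.2), charBase L p.1 t p.2))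
    (fun x q => creepWeight t x q.1)

lemma isFiniteKernel_creepKernel (hL : RegularLevy L P) (t : ℝ) :
    IsFiniteKernel (creepKernel L P t) := by
  have := isMarkovKernel_paramLaw (P := P)
    (hL.measurable_hitPair_uncurry.prodMk (hL.measurable_charBase_prod t))
  exact Kernel.isFiniteKernel_withDensity_of_bounded _ (B := 1) (by simp)
    fun x q => creepWeight_le_one t x q.1

lemma creepKernel_apply (hL : RegularLevy L P) (t x : ℝ) :
    creepKernel L P t x =
      (P.withDensity fun ω => creepWeight t x (hit L x ω, undershoot L x ω)).map
        (fun ω => ((hit L x ω, undershoot L x ω), charBase L x t ω)) := by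
  have hm := hL.measurable_hitPair_uncurry.prodMk (hL.measurable_charBase_prod t)
  have := isMarkovKernel_paramLaw (P := P) hm
  have hw : Measurable (fun q : (ℝ × ℝ) × ℝ => creepWeight t x q.1) :=
    (measurable_creepWeight_uncurry t).comp measurable_prodMk_left
  rw [creepKernel, Kernel.withDensity_apply _ (measurable_creepWeight_uncurry t),
    paramLaw_apply hm]
  exact (map_withDensity_comp P ((hL.measurable_hitPair x).prodMk (hL.measurable_charBase x t))
    hw).symm

/-- On creeping, `levelWeight` splits into a factor in the level alone and `creepWeight`, and the
level can be read off the undershoot. This presents `creepLaw` as a mixture over levels. -/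
lemma compProd_creepKernel (hL : RegularLevy L P) (t : ℝ) :
    ((volume : Measure ℝ).withDensity fun x => ENNReal.ofReal (1 + x ^ 2)⁻¹) ⊗ₘ
      creepKernel L P t = (creepLaw L P t).map (fun q => (q.1.2, q)) := by
  have := hL.isFiniteKernel_creepKernel t
  have hvm : Measurable (fun x : ℝ => ENNReal.ofReal (1 + x ^ 2)⁻¹) := by fun_prop
  have hqm : Measurable (fun q : (ℝ × ℝ) × ℝ => (q.1.2, q)) := by fun_prop
  have hZW := hL.measurable_hitPair_uncurry.prodMk (hL.measurable_charBase_prod t)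
  have hlw : Measurable (fun p : ℝ × Ω =>
      ENNReal.ofReal (levelWeight t (hit L p.1 p.2, undershoot L p.1 p.2))) :=
    ((continuous_levelWeight t).measurable.comp hL.measurable_hitPair_uncurry).ennreal_ofReal
  ext R hR
  have hRm := hR.preimage (hqm.comp hZW)
  rw [creepLaw, Measure.map_map hqm hZW, Measure.map_apply (hqm.comp hZW) hR,
    withDensity_apply _ hRm, Measure.compProd_apply hR,
    lintegral_withDensity_eq_lintegral_mul _ hvm (Kernel.measurable_kernel_prodMk_left hR),
    Measure.restrict_restrict hRm, ← lintegral_indicator (hRm.inter hL.measurableSet_creepSet),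
    lintegral_prod _ (hlw.indicator (hRm.inter hL.measurableSet_creepSet)).aemeasurable]
  refine lintegral_congr fun x => ?_
  have hx := (hL.measurable_hitPair x).prodMk (hL.measurable_charBase x t)
  have hcw : Measurable (fun ω => creepWeight t x (hit L x ω, undershoot L x ω)) :=
    (measurable_creepWeight t).comp (measurable_const.prodMk (hL.measurable_hitPair x))
  have hRx := (hR.preimage (measurable_prodMk_left (x := x))).preimage hx
  rw [Pi.mul_apply, hL.creepKernel_apply, Measure.map_apply hx (hR.preimage measurable_prodMk_left),
    withDensity_apply _ hRx, ← lintegral_indicator hRx, ← lintegral_const_mul _ (hcw.indicator hRx)]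
  refine lintegral_congr fun ω => ?_
  set A := (fun ω => ((hit L x ω, undershoot L x ω), charBase L x t ω)) ⁻¹' (Prod.mk x ⁻¹' R)
    with hA
  set B := ((fun q : (ℝ × ℝ) × ℝ => (q.1.2, q)) ∘ fun p : ℝ × Ω =>
    ((hit L p.1 p.2, undershoot L p.1 p.2), charBase L p.1 t p.2)) ⁻¹' R ∩ creepSet L with hB
  have hmA : ω ∈ A ↔ (x, ((hit L x ω, undershoot L x ω), charBase L x t ω)) ∈ R := Iff.rfl
  have hmB : (x, ω) ∈ B ↔ (undershoot L x ω, ((hit L x ω, undershoot L x ω),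
    charBase L x t ω)) ∈ R ∧ undershoot L x ω = x := Iff.rfl
  by_cases hu : undershoot L x ω = x
  · have hAB : (x, ω) ∈ B ↔ ω ∈ A := by rw [hmB, hmA, hu]; exact and_iff_left rfl
    by_cases hr : ω ∈ A
    · rw [Set.indicator_of_mem hr, Set.indicator_of_mem (hAB.2 hr), creepWeight,
        Set.indicator_of_mem (by exact hu), ← ENNReal.ofReal_mul (by positivity), levelWeight,
        mul_comm]
      simp only [hu]
    · rw [Set.indicator_of_notMem hr, Set.indicator_of_notMem (fun h => hr (hAB.1 h)), mul_zero]
  · have hB0 : (x, ω) ∉ B := fun h => hu (hmB.1 h).2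
    have h0 : creepWeight t x (hit L x ω, undershoot L x ω) = 0 :=
      Set.indicator_of_notMem (by exact hu) _
    rw [Set.indicator_of_notMem hB0]
    exact mul_eq_zero_of_right _ (Set.indicator_apply_eq_zero.2 fun _ => h0)

/-- For almost every level that can be crept over, the conditional law on creeping is the bridge
law. -/
lemma condLaw_of_undershoot_eq (hL : RegularLevy L P) {K : Kernel (ℝ × ℝ × ℝ) ℝ}
    (hK : IsLevyBridge L P K) {t : ℝ} (ht : 0 < t) :
    ∀ᵐ x : ℝ, ∀ᵐ p ∂(hitUnderLaw L P x), t < p.1 → p.2 = x →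
      condLaw L P x t p = K (p.1 - t, p.1, p.2) := by
  have := hK.markov
  have := isMarkovKernel_bridgeAt K t
  have := hL.isFiniteKernel_creepKernel t
  have := hL.isFiniteMeasure_creepLaw t
  have hvm : Measurable (fun x : ℝ => ENNReal.ofReal (1 + x ^ 2)⁻¹) := by fun_prop
  have : IsFiniteMeasure ((volume : Measure ℝ).withDensity
      fun x => ENNReal.ofReal (1 + x ^ 2)⁻¹) :=
    isFiniteMeasure_withDensity_ofReal integrable_inv_one_add_sq.2
  have h := ae_eq_fst_compProd_of_mixture (hL.creepLaw_eq_compProd hK ht) (u := Prod.snd)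
    measurable_snd (hL.compProd_creepKernel t)
  rw [ae_withDensity_iff hvm] at h
  filter_upwards [h] with x hx
  have hx := hx (by simp only [ne_eq, ENNReal.ofReal_eq_zero, not_le]; positivity)
  have hcw : Measurable (creepWeight t x) := (measurable_creepWeight t).comp measurable_prodMk_left
  rw [hL.creepKernel_apply, Measure.fst_map_prodMk (hL.measurable_charBase x t)] at hx
  have key := condDistrib_ae_eq_of_withDensity (hL.measurable_hitPair x)
    (hL.measurable_charBase x t) hcw (bridgeAt K t) (P := P) ?_ hx
  · filter_upwards [key] with p hp htp hpx
    rw [condLaw, hp, bridgeAt_apply]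
    rw [creepWeight, Set.indicator_of_mem (by exact hpx)]
    simpa using timeWeight_pos htp
  · refine ((lintegral_mono fun ω => creepWeight_le_one t x _).trans_lt ?_).ne
    simp

/-- Fubini: for each path a single level is excluded. -/
lemma ae_apply_ne (hL : RegularLevy L P) (s : ℝ) : ∀ᵐ x : ℝ, ∀ᵐ ω ∂P, L s ω ≠ x := by
  refine Measure.ae_ae_comm ?_ |>.1 (Eventually.of_forall fun ω => ?_)
  · exact (measurableSet_eq_fun ((hL.measurable s).comp measurable_fst) measurable_snd).compl
  · exact (Measure.ae_ne volume (L s ω)).mono fun x hx => hx.symm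

/-- For almost every level the conditional law is the bridge law. -/
lemma ae_condLaw_eq_bridge (hL : RegularLevy L P) {K : Kernel (ℝ × ℝ × ℝ) ℝ}
    (hK : IsLevyBridge L P K) {t : ℝ} (ht : 0 < t) :
    ∀ᵐ x : ℝ, ∀ᵐ p ∂(hitUnderLaw L P x), t ≤ p.1 → p.2 ≤ x →
      condLaw L P x t p = K (p.1 - t, p.1, p.2) := by
  filter_upwards [hL.condLaw_of_undershoot_eq hK ht, hL.ae_apply_ne t] with x hx hne
  -- Creeping exactly at time t escapes the weight; it requires L(t) = x, which almost every level
  -- avoids.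
  have hh : ∀ᵐ p ∂(hitUnderLaw L P x), p.1 ≠ t := by
    have hm : MeasurableSet {p : ℝ × ℝ | p.1 ≠ t} :=
      (measurableSet_eq_fun measurable_fst measurable_const).compl
    rw [hitUnderLaw, ae_map_iff (hL.measurable_hitPair x).aemeasurable hm]
    filter_upwards [hL.hit_eq_iff_ae t, hne] with ω hω h h'
    exact h ((hω x).1 h').2
  filter_upwards [hx, hL.condLaw_of_undershoot_lt hK x ht, hh] with p h1 h2 h3 h4 h5
  rcases h5.lt_or_eq with h | h
  · exact h2 h4 h
  · exact h1 (lt_of_le_of_ne h4 (Ne.symm h3)) h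

end RegularLevy
end LevyChar

/-! ### A version of the bridge adapted to one level -/

namespace LevyChar

section CondKernel

variable {Ω β γ : Type*} [MeasurableSpace Ω] [MeasurableSpace β] [MeasurableSpace γ]
  [MeasurableSpace.CountableOrCountablyGenerated β γ]

/-- Conditional distributions depending measurably on a parameter. -/
lemma map_eq_compProd_condKernel_paramLaw {P : Measure Ω} [IsFiniteMeasure P] {Z : β × Ω → γ}
    {W : β × Ω → ℝ} (hZ : Measurable Z) (hW : Measurable W) (b : β) :
    P.map (fun ω => (Z (b, ω), W (b, ω))) = P.map (fun ω => Z (b, ω)) ⊗ₘ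
      (paramLaw P (fun q => (Z q, W q))).condKernel.sectR b := by
  have hZW := hZ.prodMk hW
  have h := congrArg (fun κ => κ b) (Kernel.disintegrate (paramLaw P (fun q => (Z q, W q)))
    (paramLaw P (fun q => (Z q, W q))).condKernel)
  rw [Kernel.compProd_apply_eq_compProd_sectR, Kernel.fst_apply, paramLaw_apply hZW] at h
  rw [← h]
  congr 1
  exact (Measure.fst_map_prodMk (μ := P) (X := fun ω => Z (b, ω)) (Y := fun ω => W (b, ω))
    (hW.comp measurable_prodMk_left))

lemma condDistrib_ae_eq_condKernel_paramLaw {P : Measure Ω} [IsFiniteMeasure P] {Z : β × Ω → γ}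
    {W : β × Ω → ℝ} (hZ : Measurable Z) (hW : Measurable W) (b : β) :
    ∀ᵐ z ∂(P.map fun ω => Z (b, ω)), condDistrib (fun ω => W (b, ω)) (fun ω => Z (b, ω)) P z =
      (paramLaw P (fun q => (Z q, W q))).condKernel (b, z) :=
  condDistrib_ae_eq_of_measure_eq_compProd _ (hW.comp measurable_prodMk_left).aemeasurable
    (map_eq_compProd_condKernel_paramLaw hZ hW b)

end CondKernel

section Atom

variable {Ω β : Type*} [MeasurableSpace Ω] [MeasurableSpace β]

lemma eq_of_ae_of_map_singleton_ne_zero {P : Measure Ω} {X : Ω → β} {z : β} {p : β → Prop}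
    (h : ∀ᵐ z ∂(P.map X), p z) (hz : P.map X {z} ≠ 0) : p z := by
  by_contra hp
  exact hz (measure_mono_null (by simpa using hp) (ae_iff.1 h))

end Atom

namespace RegularLevy

variable {Ω : Type*} [MeasurableSpace Ω] {P : Measure Ω} {L : ℝ → Ω → ℝ}

lemma measurable_charBase_time (hL : RegularLevy L P) (x : ℝ) :
    Measurable (fun q : ℝ × Ω => charBase L x q.1 q.2) :=
  hL.measurable_charBase_uncurry.comp
    (measurable_const.prodMk (measurable_fst.prodMk measurable_snd))

variable [IsProbabilityMeasure P]

/-- A jointly measurable version of the conditional law of `L r` given `L s`. -/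
noncomputable def jointBridge (L : ℝ → Ω → ℝ) (P : Measure Ω) [IsFiniteMeasure P] :
    Kernel ((ℝ × ℝ) × ℝ) ℝ :=
  (paramLaw P (fun q : (ℝ × ℝ) × Ω => (L q.1.2 q.2, L q.1.1 q.2))).condKernel

/-- The conditional law of `L(L^*(x) - t)` given the hitting time, on creeping over `x`. -/
noncomputable def creepBridge (L : ℝ → Ω → ℝ) (P : Measure Ω) [IsFiniteMeasure P] (x : ℝ) :
    Kernel (ℝ × ℝ) ℝ :=
  (paramLaw (P.restrict {ω | undershoot L x ω = x})
    (fun q : ℝ × Ω => (hit L x q.2, charBase L x q.1 q.2))).condKernel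

open Classical in
/-- The version of the Lévy bridge that at the level `x` is given by creeping. -/
noncomputable def levelBridge (L : ℝ → Ω → ℝ) (P : Measure Ω) [IsFiniteMeasure P] (x : ℝ) :
    Kernel (ℝ × ℝ × ℝ) ℝ :=
  Kernel.piecewise (s := {v : ℝ × ℝ × ℝ | v.2.2 = x})
    (measurableSet_eq_fun (measurable_snd.comp measurable_snd) measurable_const)
    ((creepBridge L P x).comap (fun v => (v.2.1 - v.1, v.2.1)) (by fun_prop))
    ((jointBridge L P).comap (fun v => ((v.1, v.2.1), v.2.2)) (by fun_prop))

lemma levelBridge_self (x r s : ℝ) : levelBridge L P x (r, s, x) = creepBridge L P x (s - r, s) := by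
  rw [levelBridge, Kernel.piecewise_apply, if_pos (by rfl)]
  rfl

lemma levelBridge_of_ne {x y : ℝ} (h : y ≠ x) (r s : ℝ) :
    levelBridge L P x (r, s, y) = jointBridge L P ((r, s), y) := by
  rw [levelBridge, Kernel.piecewise_apply, if_neg (by exact h)]
  rfl

instance isMarkovKernel_levelBridge (x : ℝ) : IsMarkovKernel (levelBridge L P x) := by
  unfold levelBridge jointBridge creepBridge
  infer_instance

/-- Almost surely, L(s) = x holds exactly when the path creeps over x at time s, and then the value
at time s - r before hitting is L(r). At an atom, both conditional laws are elementary ratios over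
this same event. -/
lemma condDistrib_eq_creepBridge (hL : RegularLevy L P) {r s x : ℝ}
    (hx : P.map (L s) {x} ≠ 0) :
    condDistrib (L r) (L s) P x = creepBridge L P x (s - r, s) := by
  set Q := P.restrict {ω | undershoot L x ω = x} with hQ
  have hTm : Measurable (hit L x) := hL.measurable_hit x
  have hWm : Measurable (charBase L x (s - r)) := hL.measurable_charBase x _
  have hev : ∀ S : Set ℝ, MeasurableSet S →
      Q.map (fun ω => (hit L x ω, charBase L x (s - r) ω)) ({s} ×ˢ S) =
        P.map (fun ω => (L s ω, L r ω)) ({x} ×ˢ S) := by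
    intro S hS
    have hYm : MeasurableSet {ω | undershoot L x ω = x} :=
      measurableSet_eq_fun (hL.measurable_undershoot x) measurable_const
    rw [Measure.map_apply (hTm.prodMk hWm) ((measurableSet_singleton s).prod hS),
      Measure.map_apply ((hL.measurable s).prodMk (hL.measurable r))
        ((measurableSet_singleton x).prod hS), hQ, Measure.restrict_apply
        ((hTm.prodMk hWm) ((measurableSet_singleton s).prod hS))]
    refine measure_congr ?_
    filter_upwards [hL.hit_eq_iff_ae s] with ω hω
    refine propext ⟨fun h => ?_, fun h => ?_⟩
    · obtain ⟨⟨h1, h2⟩, -⟩ := h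
      have h1 : hit L x ω = s := h1
      have h2 : charBase L x (s - r) ω ∈ S := h2
      rw [charBase, h1, sub_sub_cancel] at h2
      exact ⟨((hω x).1 h1).2, h2⟩
    · obtain ⟨h1, h2⟩ := h
      have h3 := (hω x).2 h1
      refine ⟨⟨h3, ?_⟩, ((hω x).1 h3).1⟩
      change charBase L x (s - r) ω ∈ S
      rw [charBase, h3, sub_sub_cancel]
      exact h2
  have hatom : Q.map (hit L x) {s} = P.map (L s) {x} := by
    have := hev Set.univ MeasurableSet.univ
    rwa [Measure.map_apply (hTm.prodMk hWm) ((measurableSet_singleton s).prod MeasurableSet.univ),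
      Measure.map_apply ((hL.measurable s).prodMk (hL.measurable r))
        ((measurableSet_singleton x).prod MeasurableSet.univ), Set.mk_preimage_prod,
      Set.mk_preimage_prod, Set.preimage_univ, Set.inter_univ, Set.preimage_univ, Set.inter_univ,
      ← Measure.map_apply hTm (measurableSet_singleton s),
      ← Measure.map_apply (hL.measurable s) (measurableSet_singleton x)] at this
  have h1 : condDistrib (charBase L x (s - r)) (hit L x) Q s = creepBridge L P x (s - r, s) :=
    eq_of_ae_of_map_singleton_ne_zero (condDistrib_ae_eq_condKernel_paramLaw (P := Q)
    (hTm.comp measurable_snd) (hL.measurable_charBase_time x) (s - r)) (z := s)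
    (show Q.map (hit L x) {s} ≠ 0 by rwa [hatom])
  refine Eq.trans ?_ h1
  ext S hS
  rw [condDistrib_apply_of_ne_zero (hL.measurable r) _ hx]
  exact (Eq.trans (condDistrib_apply_of_ne_zero hWm _ (by rwa [hatom]) S)
    (by rw [hatom, hev S hS])).symm

/-- Redefinition at y = x is felt only at times s where L(s) has an atom at x, and there the
creeping law is the correct value. -/
lemma isLevyBridge_levelBridge (hL : RegularLevy L P) (x : ℝ) :
    IsLevyBridge L P (levelBridge L P x) where
  markov := inferInstance
  bridge r s _ _ := by
    have h := condDistrib_ae_eq_condKernel_paramLaw (P := P) (β := ℝ × ℝ)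
      (Z := fun q => L q.1.2 q.2) (W := fun q => L q.1.1 q.2)
      (hL.measurable_uncurry.comp ((measurable_snd.comp measurable_fst).prodMk measurable_snd))
      (hL.measurable_uncurry.comp ((measurable_fst.comp measurable_fst).prodMk measurable_snd))
      (r, s)
    have hx : ∀ᵐ y ∂(P.map (L s)), y = x → P.map (L s) {x} ≠ 0 := by
      by_cases h0 : P.map (L s) {x} = 0
      · have : ∀ᵐ y ∂(P.map (L s)), y ≠ x := by
          rw [ae_iff]; simpa using h0
        exact this.mono fun y hy h => (hy h).elim
      · exact Eventually.of_forall fun _ _ => h0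
    filter_upwards [h, hx] with y hy hyx
    by_cases hyx' : y = x
    · rw [hyx', levelBridge_self, hL.condDistrib_eq_creepBridge (hyx hyx')]
    · rw [levelBridge_of_ne hyx']
      exact hy.symm

/-- On creeping the undershoot is the constant x, so conditioning on the pair is conditioning on the
hitting time under the restricted measure. The kernel is measurable in t as well, so one version
serves all t. -/
lemma condLaw_eq_creepBridge (hL : RegularLevy L P) (x t : ℝ) :
    ∀ᵐ p ∂(hitUnderLaw L P x), p.2 = x → condLaw L P x t p = creepBridge L P x (t, p.1) := by
  set Q := P.restrict {ω | undershoot L x ω = x} with hQ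
  have hTm : Measurable (hit L x) := hL.measurable_hit x
  have hWm : Measurable (charBase L x t) := hL.measurable_charBase x _
  have hYm : MeasurableSet {ω | undershoot L x ω = x} :=
    measurableSet_eq_fun (hL.measurable_undershoot x) measurable_const
  have hym : MeasurableSet {z : ℝ × ℝ | z.2 = x} :=
    measurableSet_eq_fun measurable_snd measurable_const
  set h : ℝ × ℝ → ℝ≥0∞ := {z : ℝ × ℝ | z.2 = x}.indicator 1 with hh
  have hwd : P.withDensity (fun ω => h (hit L x ω, undershoot L x ω)) = Q := by
    rw [hQ, ← withDensity_indicator_one hYm]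
    rfl
  have : IsMarkovKernel (creepBridge L P x) := by unfold creepBridge; infer_instance
  have hdis : Q.map (fun ω => (hit L x ω, charBase L x t ω)) =
      Q.map (hit L x) ⊗ₘ (creepBridge L P x).sectR t :=
    map_eq_compProd_condKernel_paramLaw (P := Q)
      (hTm.comp measurable_snd) (hL.measurable_charBase_time x) t
  have hyQ : ∀ᵐ ω ∂Q, undershoot L x ω = x := ae_restrict_mem hYm
  have key := condDistrib_ae_eq_of_withDensity (hL.measurable_hitPair x) hWm (P := P)
    (h := h) (measurable_one.indicator hym)
    (((creepBridge L P x).sectR t).comap Prod.fst measurable_fst) ?_ ?_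
  · filter_upwards [key] with p hp hpx
    rw [condLaw, hp (by rw [hh, Set.indicator_of_mem (by exact hpx)]; simp)]
    rfl
  · have : ∀ ω, h (hit L x ω, undershoot L x ω) ≤ 1 := fun ω => Set.indicator_le_self _ _ _
    exact ((lintegral_mono this).trans_lt (by simp)).ne
  · rw [hwd]
    have e1 : Q.map (fun ω => (hit L x ω, undershoot L x ω)) =
        (Q.map (hit L x)).map (fun s => (s, x)) := by
      rw [Measure.map_map (by fun_prop) hTm]
      refine Measure.map_congr ?_
      filter_upwards [hyQ] with ω hω
      simp [hω]
    have e2 : Q.map (fun ω => ((hit L x ω, undershoot L x ω), charBase L x t ω)) =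
        (Q.map (fun ω => (hit L x ω, charBase L x t ω))).map (fun v => ((v.1, x), v.2)) := by
      rw [Measure.map_map (by fun_prop) (hTm.prodMk hWm)]
      refine Measure.map_congr ?_
      filter_upwards [hyQ] with ω hω
      simp [hω]
    rw [e1, e2, hdis]
    ext S hS
    have hSm := hS.preimage (by fun_prop : Measurable fun v : ℝ × ℝ => ((v.1, x), v.2))
    rw [Measure.map_apply (by fun_prop) hS, Measure.compProd_apply hSm, Measure.compProd_apply hS,
      lintegral_map (Kernel.measurable_kernel_prodMk_left hS) (by fun_prop)]
    rfl

/-- The conditional law is given by a version of the bridge serving all `t`. -/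
lemma condLaw_eq_levelBridge (hL : RegularLevy L P) (x : ℝ) {t : ℝ} (ht : 0 < t) :
    ∀ᵐ p ∂(hitUnderLaw L P x), t ≤ p.1 → p.2 ≤ x →
      condLaw L P x t p = levelBridge L P x (p.1 - t, p.1, p.2) := by
  filter_upwards [hL.condLaw_of_undershoot_lt (hL.isLevyBridge_levelBridge x) x ht,
    hL.condLaw_eq_creepBridge x t] with p h1 h2 htp hpx
  rcases hpx.lt_or_eq with h | h
  · exact h1 htp h
  · rw [h2 h, h, levelBridge_self, sub_sub_cancel]

end RegularLevy
end LevyChar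

/-! ### Regular modifications and copies of the process -/

namespace LevyChar

section Modification

variable {Ω : Type*} [MeasurableSpace Ω] {P : Measure Ω} {L M : ℝ → Ω → ℝ}

lemma IsStrictlyIncreasingLevy.congr (hL : IsStrictlyIncreasingLevy L P)
    (hM : ∀ t, Measurable (M t)) (h : ∀ᵐ ω ∂P, ∀ t, M t ω = L t ω) :
    IsStrictlyIncreasingLevy M P where
  measurable := hM
  zero := by filter_upwards [h, hL.zero] with ω h1 h2; rw [h1, h2]
  indep n t ht := (hL.indep n t ht).congr fun i => by
    filter_upwards [h] with ω hω
    rw [hω, hω]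
  stationary s u hu :=
    ((IdentDistrib.of_ae_eq ((hM _).sub (hM _)).aemeasurable (by
      filter_upwards [h] with ω hω
      rw [Pi.sub_apply, hω, hω])).trans (hL.stationary s u hu)).trans
      (IdentDistrib.of_ae_eq (hL.measurable u).aemeasurable (by
        filter_upwards [h] with ω hω
        rw [hω]))
  stochCont t := (hL.stochCont t).congr
    (fun i => by filter_upwards [h] with ω hω; rw [hω])
    (by filter_upwards [h] with ω hω; rw [hω])
  cadlag := by filter_upwards [h, hL.cadlag] with ω h1 h2; simpa only [h1] using h2
  strictMono := by filter_upwards [h, hL.strictMono] with ω h1 h2; simpa only [h1] using h2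

/-- Every strictly increasing Lévy process has a version with regular paths. -/
lemma IsStrictlyIncreasingLevy.exists_regular [IsProbabilityMeasure P]
    (hL : IsStrictlyIncreasingLevy L P) :
    ∃ M : ℝ → Ω → ℝ, RegularLevy M P ∧ ∀ᵐ ω ∂P, ∀ t, M t ω = L t ω := by
  classical
  have hgood : ∀ᵐ ω ∂P, L 0 ω = 0 ∧ StrictMono (fun t => L t ω) ∧
      (∀ t, ContinuousWithinAt (fun u => L u ω) (Set.Ici t) t) ∧
      (∀ k : ℕ, ∃ n : ℕ, (k : ℝ) ≤ L n ω) ∧ ∀ k : ℕ, ∃ n : ℕ, L (-n) ω < -(k : ℝ) := by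
    filter_upwards [hL.zero, hL.strictMono, hL.cadlag, ae_all_iff.2 fun k : ℕ => hL.ae_exists_ge k,
      ae_all_iff.2 fun k : ℕ => hL.ae_exists_lt (-(k : ℝ))] with ω h1 h2 h3 h4 h5
    exact ⟨h1, h2, fun t => (h3 t).1, h4, h5⟩
  obtain ⟨N, hN, hNm, hN0⟩ := exists_measurable_superset_of_null (ae_iff.1 hgood)
  have hmem : ∀ ω, ω ∉ N → _ := fun ω hω => not_not.1 fun h => hω (hN h)
  have hMN : ∀ ω ∈ N, (fun t => N.piecewise (fun _ => t) (L t) ω) = fun t => t := fun ω hω => by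
    funext t; exact Set.piecewise_eq_of_mem _ _ _ hω
  have hML : ∀ ω ∉ N, (fun t => N.piecewise (fun _ => t) (L t) ω) = fun t => L t ω :=
    fun ω hω => by funext t; exact Set.piecewise_eq_of_notMem _ _ _ hω
  have hae : ∀ᵐ ω ∂P, ∀ t, N.piecewise (fun _ => t) (L t) ω = L t ω := by
    have : ∀ᵐ ω ∂P, ω ∉ N := measure_eq_zero_iff_ae_notMem.1 hN0
    filter_upwards [this] with ω hω t using congrFun (hML ω hω) t
  -- On the exceptional null set the path is replaced by the identity, which has all the required
  -- regularity.
  refine ⟨fun t => N.piecewise (fun _ => t) (L t),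
    ⟨hL.congr (fun t => measurable_const.piecewise hNm (hL.measurable t)) hae, fun ω => ?_,
      fun ω => ?_, fun ω t => ?_, fun ω x => ?_, fun ω x => ?_⟩, hae⟩
  all_goals by_cases hω : ω ∈ N
  · exact congrFun (hMN ω hω) 0
  · exact (congrFun (hML ω hω) 0).trans (hmem ω hω).1
  · rw [hMN ω hω]; exact strictMono_id
  · rw [hML ω hω]; exact (hmem ω hω).2.1
  · rw [hMN ω hω]; exact continuous_id.continuousWithinAt
  · rw [hML ω hω]; exact (hmem ω hω).2.2.1 t
  · exact ⟨x, (congrFun (hMN ω hω) x).ge⟩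
  · obtain ⟨k, hk⟩ := exists_nat_ge x
    obtain ⟨n, hn⟩ := (hmem ω hω).2.2.2.1 k
    exact ⟨n, hk.trans (hn.trans (congrFun (hML ω hω) n).ge)⟩
  · exact ⟨x - 1, (congrFun (hMN ω hω) (x - 1)).trans_lt (sub_one_lt x)⟩
  · obtain ⟨k, hk⟩ := exists_nat_ge (-x)
    obtain ⟨n, hn⟩ := (hmem ω hω).2.2.2.2 k
    exact ⟨-n, ((congrFun (hML ω hω) (-n)).trans_lt hn).trans_le (neg_le.1 hk)⟩

lemma hit_ae_eq (h : ∀ᵐ ω ∂P, ∀ t, M t ω = L t ω) (x : ℝ) : hit M x =ᵐ[P] hit L x := by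
  filter_upwards [h] with ω hω
  simp only [hit, hω]

lemma undershoot_ae_eq (h : ∀ᵐ ω ∂P, ∀ t, M t ω = L t ω) (x : ℝ) :
    undershoot M x =ᵐ[P] undershoot L x := by
  filter_upwards [h] with ω hω
  simp only [undershoot, hit, hω]

lemma charBase_ae_eq (h : ∀ᵐ ω ∂P, ∀ t, M t ω = L t ω) (x t : ℝ) :
    charBase M x t =ᵐ[P] charBase L x t := by
  filter_upwards [h] with ω hω
  simp only [charBase, hit, hω]

lemma hitUnderLaw_congr (h : ∀ᵐ ω ∂P, ∀ t, M t ω = L t ω) (x : ℝ) :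
    hitUnderLaw M P x = hitUnderLaw L P x :=
  Measure.map_congr ((hit_ae_eq h x).prodMk (undershoot_ae_eq h x))

lemma condLaw_congr [IsFiniteMeasure P] (h : ∀ᵐ ω ∂P, ∀ t, M t ω = L t ω) (x t : ℝ) :
    condLaw M P x t = condLaw L P x t :=
  condDistrib_congr (charBase_ae_eq h x t) ((hit_ae_eq h x).prodMk (undershoot_ae_eq h x))

end Modification

section Copy

variable {Ω Ω' : Type*} [MeasurableSpace Ω] [MeasurableSpace Ω'] {P : Measure Ω}
  {P' : Measure Ω'} {L : ℝ → Ω → ℝ} {L' : ℝ → Ω' → ℝ}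

lemma map_comp_eq_of_identDistrib (h : IdentDistrib (fun ω t => L' t ω) (fun ω t => L t ω) P' P)
    {β : Type*} [MeasurableSpace β] {u : (ℝ → ℝ) → β} (hu : Measurable u) :
    P'.map (fun ω => u (fun t => L' t ω)) = P.map (fun ω => u (fun t => L t ω)) :=
  (h.comp hu).map_eq

/-- Being a bridge version depends only on the two-dimensional marginals, so it transfers between
copies in either direction. -/
lemma IsLevyBridge.of_identDistrib [IsFiniteMeasure P] [IsFiniteMeasure P']
    (h : IdentDistrib (fun ω t => L' t ω) (fun ω t => L t ω) P' P)
    {K : Kernel (ℝ × ℝ × ℝ) ℝ} (hK : IsLevyBridge L P K) : IsLevyBridge L' P' K where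
  markov := hK.markov
  bridge r s hr hs := by
    have h1 : P'.map (L' s) = P.map (L s) :=
      map_comp_eq_of_identDistrib h (u := fun f => f s) (measurable_pi_apply s)
    have h2 : P'.map (fun ω => (L' s ω, L' r ω)) = P.map (fun ω => (L s ω, L r ω)) :=
      map_comp_eq_of_identDistrib h (u := fun f => (f s, f r))
        ((measurable_pi_apply s).prodMk (measurable_pi_apply r))
    have h3 : condDistrib (L' r) (L' s) P' = condDistrib (L r) (L s) P := by
      simp only [condDistrib_def, h2]
    rw [h1, h3]
    exact hK.bridge r s hr hs

end Copy

end LevyChar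

/-! ### Supports, the mixture formula and the main theorem -/

namespace LevyChar
namespace RegularLevy

variable {Ω : Type*} [MeasurableSpace Ω] {P : Measure Ω} {L : ℝ → Ω → ℝ}

lemma hitUnderLaw_of_nonneg (hL : RegularLevy L P) {x : ℝ} (hx : 0 ≤ x) :
    ∀ᵐ p ∂(hitUnderLaw L P x), 0 ≤ p.1 ∧ 0 ≤ p.2 ∧ p.2 ≤ x := by
  have hm : MeasurableSet {p : ℝ × ℝ | 0 ≤ p.1 ∧ 0 ≤ p.2 ∧ p.2 ≤ x} := by measurability
  have h0 : ∀ᵐ ω ∂P, 0 ≤ undershoot L x ω := by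
    -- At level zero the hitting time is 0, and only the almost sure absence of a jump there keeps
    -- the undershoot from being negative; for positive levels every path works.
    rcases hx.eq_or_lt with rfl | hx
    · filter_upwards [hL.undershoot_zero_ae] with ω hω using hω.ge
    · exact Eventually.of_forall (hL.undershoot_nonneg hx)
  rw [hitUnderLaw, ae_map_iff (hL.measurable_hitPair x).aemeasurable hm]
  filter_upwards [h0] with ω hω
  exact ⟨hL.hit_nonneg hx ω, hω, hL.undershoot_le x ω⟩

lemma hitUnderLaw_of_neg (hL : RegularLevy L P) {x : ℝ} (hx : x < 0) :
    ∀ᵐ p ∂(hitUnderLaw L P x), p.1 < 0 ∧ p.2 ≤ x := by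
  have hm : MeasurableSet {p : ℝ × ℝ | p.1 < 0 ∧ p.2 ≤ x} := by measurability
  rw [hitUnderLaw, ae_map_iff (hL.measurable_hitPair x).aemeasurable hm]
  filter_upwards [hL.hit_neg_ae hx] with ω hω
  exact ⟨hω, hL.undershoot_le x ω⟩

variable [IsProbabilityMeasure P]

lemma measure_charBase_mem (hL : RegularLevy L P) (x t : ℝ) {A : Set ℝ} (hA : MeasurableSet A) :
    P {ω | charBase L x t ω ∈ A} = ∫⁻ p, condLaw L P x t p A ∂(hitUnderLaw L P x) := by
  have hW := hL.measurable_charBase x t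
  have h := condDistrib_comp_map (hL.measurable_hitPair x).aemeasurable (Y := charBase L x t)
    hW.aemeasurable (μ := P)
  have h2 := congrArg (fun ν => ν A) h
  rw [Measure.bind_apply hA (Kernel.aemeasurable _), Measure.map_apply hW hA] at h2
  exact h2.symm

lemma condLaw_of_nonneg (hL : RegularLevy L P) {x t : ℝ} (hx : 0 ≤ x) :
    ∀ᵐ p ∂(hitUnderLaw L P x), p.1 < t →
      condLaw L P x t p = P.map (fun ω => -(L (t - p.1) ω)) := by
  have h : ∀ᵐ p ∂(hitUnderLaw L P x), p.1 < t → condLaw L P x t p = P.map (L (p.1 - t)) := by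
    rcases hx.eq_or_lt with rfl | hx
    · exact (hL.condLaw_zero t).mono fun p hp _ => hp
    · exact hL.condLaw_of_lt hx
  filter_upwards [h] with p hp hpt
  rw [hp hpt, hL.map_apply_sub t p.1 hpt.le]

end RegularLevy
end LevyChar

theorem mainTheorem4 {Ω Ω' : Type*} [MeasurableSpace Ω] [MeasurableSpace Ω']
    (P : Measure Ω) [IsProbabilityMeasure P] (P' : Measure Ω') [IsProbabilityMeasure P']
    (L : ℝ → Ω → ℝ) (hL : LevyChar.IsStrictlyIncreasingLevy L P)
    -- `L'` is a copy of `L`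
    (L' : ℝ → Ω' → ℝ)
    (hL' : IdentDistrib (fun ω t => L' t ω) (fun ω t => L t ω) P' P) :
    -- hitting time, undershoot and `L(L^*(x) - t)` are well-defined random variables,
    -- and the cases below exhaust the values of hitting time and undershoot
    (∀ x : ℝ,
      (∀ᵐ ω ∂P, {u : ℝ | x ≤ L u ω}.Nonempty ∧ BddBelow {u : ℝ | x ≤ L u ω}) ∧
      AEMeasurable (LevyChar.hit L x) P ∧
      AEMeasurable (LevyChar.undershoot L x) P ∧
      (∀ t : ℝ, 0 < t → AEMeasurable (LevyChar.charBase L x t) P) ∧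
      (0 ≤ x → ∀ᵐ p ∂(LevyChar.hitUnderLaw L P x), 0 ≤ p.1 ∧ 0 ≤ p.2 ∧ p.2 ≤ x) ∧
      (x < 0 → ∀ᵐ p ∂(LevyChar.hitUnderLaw L P x), p.1 < 0 ∧ p.2 ≤ x)) ∧
    -- (1)
    (∀ x t : ℝ, 0 < t → ∀ A : Set ℝ, MeasurableSet A →
      P {ω | LevyChar.charBase L x t ω ∈ A} =
        ∫⁻ p, LevyChar.condLaw L P x t p A ∂(LevyChar.hitUnderLaw L P x)) ∧
    -- (2) for every level `x > 0`, with a version of the Lévy bridge that serves all `t > 0`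
    (∀ x : ℝ, 0 < x → ∃ K : Kernel (ℝ × ℝ × ℝ) ℝ, LevyChar.IsLevyBridge L' P' K ∧
      ∀ t : ℝ, 0 < t → ∀ᵐ p ∂(LevyChar.hitUnderLaw L P x),
        t ≤ p.1 → 0 ≤ p.2 → p.2 ≤ x →
          LevyChar.condLaw L P x t p = K (p.1 - t, p.1, p.2)) ∧
    -- (2) for every version of the Lévy bridge
    (∀ K : Kernel (ℝ × ℝ × ℝ) ℝ, LevyChar.IsLevyBridge L' P' K → ∀ t : ℝ, 0 < t →
      (∀ x : ℝ, 0 < x → ∀ᵐ p ∂(LevyChar.hitUnderLaw L P x),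
        t ≤ p.1 → 0 ≤ p.2 → p.2 < x →
          LevyChar.condLaw L P x t p = K (p.1 - t, p.1, p.2)) ∧
      (∀ᵐ x : ℝ, 0 < x → ∀ᵐ p ∂(LevyChar.hitUnderLaw L P x),
        t ≤ p.1 → 0 ≤ p.2 → p.2 ≤ x →
          LevyChar.condLaw L P x t p = K (p.1 - t, p.1, p.2))) ∧
    -- (3)
    (∀ x t : ℝ, 0 ≤ x → 0 < t → ∀ᵐ p ∂(LevyChar.hitUnderLaw L P x),
      0 ≤ p.1 → p.1 < t → 0 ≤ p.2 → p.2 ≤ x →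
        LevyChar.condLaw L P x t p = P'.map (fun ω => -(L' (t - p.1) ω))) ∧
    -- (4)
    (∀ x t : ℝ, x < 0 → 0 < t → ∀ᵐ p ∂(LevyChar.hitUnderLaw L P x),
      p.1 < 0 → p.2 ≤ x →
        LevyChar.condLaw L P x t p = P'.map (fun ω => p.2 - L' t ω)) := by
  obtain ⟨M, hM, hML⟩ := hL.exists_regular
  -- The regular version agrees with L at all times simultaneously, almost surely, so it has the
  -- same law on path space and L' is also a copy of it.
  have hid : IdentDistrib (fun ω t => L' t ω) (fun ω t => M t ω) P' P :=
    hL'.trans ((IdentDistrib.of_ae_eq hL'.aemeasurable_snd (by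
      filter_upwards [hML] with ω hω
      funext t
      exact (hω t).symm)))
  have hid' : IdentDistrib (fun ω t => M t ω) (fun ω t => L' t ω) P P' := hid.symm
  simp only [← LevyChar.hitUnderLaw_congr hML, ← LevyChar.condLaw_congr hML]
  refine ⟨fun x => ⟨?_, ?_, ?_, fun t _ => ?_, fun hx => hM.hitUnderLaw_of_nonneg hx,
      fun hx => hM.hitUnderLaw_of_neg hx⟩, fun x t _ A hA => ?_,
    fun x _ => ⟨LevyChar.RegularLevy.levelBridge M P x,
      (hM.isLevyBridge_levelBridge x).of_identDistrib hid, fun t ht => ?_⟩,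
    fun K hK t ht => ⟨fun x _ => ?_, ?_⟩, fun x t hx _ => ?_, fun x t hx ht => ?_⟩
  · filter_upwards [hML] with ω hω
    simp only [← hω]
    exact ⟨hM.exists_ge ω x, hM.bddBelow_hitSet x ω⟩
  · exact (hM.measurable_hit x).aemeasurable.congr (LevyChar.hit_ae_eq hML x)
  · exact (hM.measurable_undershoot x).aemeasurable.congr (LevyChar.undershoot_ae_eq hML x)
  · exact (hM.measurable_charBase x t).aemeasurable.congr (LevyChar.charBase_ae_eq hML x t)
  · rw [← hM.measure_charBase_mem x t hA]
    refine measure_congr ?_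
    filter_upwards [LevyChar.charBase_ae_eq hML x t] with ω hω
    exact congrArg (· ∈ A) hω.symm
  · filter_upwards [hM.condLaw_eq_levelBridge x ht] with p hp h1 _ h3 using hp h1 h3
  · filter_upwards [hM.condLaw_of_undershoot_lt (hK.of_identDistrib hid') x ht] with p hp h1 _ h3
      using hp h1 h3
  · filter_upwards [hM.ae_condLaw_eq_bridge (hK.of_identDistrib hid') ht] with x hx _
    filter_upwards [hx] with p hp h1 _ h3 using hp h1 h3
  · filter_upwards [hM.condLaw_of_nonneg (t := t) hx] with p hp _ h2 _ _
    rw [hp h2]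
    exact (LevyChar.map_comp_eq_of_identDistrib hid (u := fun f => -(f (t - p.1)))
      (measurable_pi_apply _).neg).symm
  · filter_upwards [hM.condLaw_of_neg hx ht] with p hp _ _
    rw [hp]
    exact (LevyChar.map_comp_eq_of_identDistrib hid (u := fun f => p.2 - f t)
      ((measurable_pi_apply _).const_sub _)).symm
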